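/- \textbf{Theorem.} A noncommutative algebraic branching program (ABP) over $\mathbb{Q}$ in the variables $x_1,\dots,x_n$ with $\tilde d$ layers is a directed graph whose vertices are partitioned into layers $0,1,\dots,\tilde d$, with edges only from a layer to the next one, each edge labelled by an affine linear form $c+\sum_{i=1}^n a_i x_i$ with $c,a_i\in\mathbb{Q}$, together with a source vertex in layer $0$ and a sink vertex in layer $\tilde d$. Its width is the maximal number of vertices in a layer, and it computes the polynomial in $\mathbb{Q}\langle x_1,\dots,x_n\rangle$ that is the sum, over all source-to-sink paths, of the ordered products of the labels along the path. There are a deterministic algorithm and a constant $C$ such that the following holds for all integers $n,r,\tilde d\ge 1$. On input $(n,r,\tilde d)$ the algorithm writes down, in quasipolynomial time (at most $2^{C(\lfloor\log_2(nr\tilde d)\rfloor+1)^{C}}$ on a random access machine with logarithmic cost), an integer $\ell$, a cyclic algebra $D$ and a finite set $\mathcal{H}\subseteq D^n$ such that: (1) $D=(K/F,\sigma,z)$, where $F=\mathbb{Q}(z)$ with $z$ an indeterminate, $K=F(\omega)$ with $\omega$ a primitive root of unity of some order $m$, $K/F$ is a cyclic Galois extension of degree $\ell$, and $\sigma$, given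 by $\sigma(\omega)=\omega^g$ for some integer $g$, generates $\mathrm{Gal}(K/F)$; that is, $D=K\oplus Kx\oplus\cdots\oplus Kx^{\ell-1}$ with $x^\ell=z$ and $xb=\sigma(b)x$ for all $b\in K$. The algebra $D$ is a division algebra with centre $F$ and of dimension $\ell^2$ over $F$, i.e. of index $\ell$, and $\tilde d<\ell\le (nr\tilde d+1)^{C}$. (2) $|\mathcal{H}|\le (nr(\tilde d+1))^{C\lfloor\log_2(\tilde d+1)\rfloor}$; in particular $|\mathcal{H}|= (nr\tilde d)^{O(\log\tilde d)}$ for $\tilde d\ge 2$. (3) $\mathcal{H}$ is a hitting set: for every nonzero polynomial $f\in\mathbb{Q}\langle x_1,\dots,x_n\rangle$ computed by an ABP of width at most $r$ with $\tilde d$ layers there is $q\in\mathcal{H}$ with $f(q)\ne 0$. (4) For every such $f$ and every $q\in\mathcal{H}$ with $f(q)\neq 0$, the element $f(q)$ is invertible in $D$. Hence $\mathcal{H}$ is a strong hitting set: every nonzero such $f$ takes an invertible value at some point of $\mathcal{H}$. Here $D$ is written down as $(\ell,m,g)$, and the points of $\mathcal{H}$ as tuples of finite sums of terms $\frac{a}{b}z^i\omega^jx^k$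 with $a\in\mathbb{Z}$, $b\in\mathbb{Z}_{>0}$ and $i,j,k\in\mathbb{Z}_{\geq 0}$. -/

import Mathlib

noncomputable section

/-! ## Noncommutative algebraic branching programs over `ℚ` -/

/-- The affine `ℚ`-linear form `c + ∑ i, a i * x i` in noncommuting variables `x i`. -/
structure AffineForm (n : ℕ) where
  const : ℚ
  coeff : Fin n → ℚ

/-- The noncommutative polynomial given by an affine form. -/
def AffineForm.toPoly {n : ℕ} (L : AffineForm n) : FreeAlgebra ℚ (Fin n) :=
  algebraMap ℚ (FreeAlgebra ℚ (Fin n)) L.const + ∑ i, L.coeff i • FreeAlgebra.ι ℚ i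

/-- A noncommutative algebraic branching program in `n` variables: a directed graph whose vertices
are partitioned into layers `0, …, d` (so there are `d` layers of edges), with edges only from a
layer to the next one, each labelled by an affine form, a source in layer `0` and a sink in
layer `d`. An absent edge is an edge with label `0`. -/
structure ABP (n d : ℕ) where
  /-- `card i` is the number of vertices in layer `i`. -/
  card : Fin (d + 1) → ℕ
  source : Fin (card 0)
  sink : Fin (card (Fin.last d))
  label : ∀ i : Fin d, Fin (card i.castSucc) → Fin (card i.succ) → AffineForm n

namespace ABP

variable {n d : ℕ}

/-- The width is the maximal number of vertices in a layer. -/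
def width (B : ABP n d) : ℕ := Finset.univ.sup B.card

/-- A source-to-sink path chooses one vertex in every layer. -/
def IsPath (B : ABP n d) (p : ∀ i : Fin (d + 1), Fin (B.card i)) : Prop :=
  p 0 = B.source ∧ p (Fin.last d) = B.sink

open Classical in
/-- The polynomial computed by the program: the sum over all source-to-sink paths of the ordered
product of the labels along the path. -/
def poly (B : ABP n d) : FreeAlgebra ℚ (Fin n) :=
  ∑ p : (∀ i : Fin (d + 1), Fin (B.card i)) with B.IsPath p,
    (List.ofFn fun i : Fin d => (B.label i (p i.castSucc) (p i.succ)).toPoly).prod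

end ABP

/-- The noncommutative polynomials in `n` variables over `ℚ` that are computed by programs of width
at most `r` with `d` layers (of edges). -/
def abpClass (n r d : ℕ) : Set (FreeAlgebra ℚ (Fin n)) :=
  {f | ∃ B : ABP n d, B.width ≤ r ∧ B.poly = f}

/-- Every nonzero polynomial of the class is nonzero at some point of `H`. -/
def IsHittingSet {n : ℕ} {A : Type*} [Ring A] [Algebra ℚ A]
    (𝒞 : Set (FreeAlgebra ℚ (Fin n))) (H : Finset (Fin n → A)) : Prop :=
  ∀ f ∈ 𝒞, f ≠ 0 → ∃ q ∈ H, FreeAlgebra.lift ℚ q f ≠ 0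

/-- Every nonzero polynomial of the class is invertible at some point of `H`. -/
def IsStrongHittingSet {n : ℕ} {A : Type*} [Ring A] [Algebra ℚ A]
    (𝒞 : Set (FreeAlgebra ℚ (Fin n))) (H : Finset (Fin n → A)) : Prop :=
  ∀ f ∈ 𝒞, f ≠ 0 → ∃ q ∈ H, IsUnit (FreeAlgebra.lift ℚ q f)

/-! ## Cyclic algebras, in their matrix representation -/

section Cyclic

variable {F K : Type*} [Field F] [Field K] [Algebra F K]

/-- The matrix `M(x)` of the generator `x`: ones above the diagonal, `a` in the lower left corner. -/
def cyclicX (K : Type*) [Field K] [Algebra F K] (ℓ : ℕ) (a : F) : Matrix (Fin ℓ) (Fin ℓ) K :=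
  Matrix.of fun i j =>
    if j.val = i.val + 1 then 1
    else if i.val + 1 = ℓ ∧ j.val = 0 then algebraMap F K a
    else 0

/-- The matrix `M(b) = diag(b, σ b, …, σ^(ℓ-1) b)` of an element `b` of `K`. -/
def cyclicDiag (σ : K ≃ₐ[F] K) (ℓ : ℕ) (b : K) : Matrix (Fin ℓ) (Fin ℓ) K :=
  Matrix.diagonal fun i => (σ ^ i.val) b

/-- The cyclic algebra `(K/F, σ, a) = K ⊕ K x ⊕ ⋯ ⊕ K x^(ℓ-1)`, with `x^ℓ = a` and `x b = σ(b) x`,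
as the `F`-algebra of `ℓ × ℓ` matrices over `K` generated by `M(x)` and all `M(b)`. -/
def cyclicAlgebra (σ : K ≃ₐ[F] K) (ℓ : ℕ) (a : F) : Subalgebra F (Matrix (Fin ℓ) (Fin ℓ) K) :=
  Algebra.adjoin F (insert (cyclicX K ℓ a) (Set.range (cyclicDiag σ ℓ)))

/-- The generator `x` as an element of the cyclic algebra. -/
def cyclicAlgebra.x (σ : K ≃ₐ[F] K) (ℓ : ℕ) (a : F) : cyclicAlgebra σ ℓ a :=
  ⟨cyclicX K ℓ a, Algebra.subset_adjoin (Set.mem_insert _ _)⟩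

/-- An element `b` of `K` as an element of the cyclic algebra. -/
def cyclicAlgebra.ofK (σ : K ≃ₐ[F] K) (ℓ : ℕ) (a : F) (b : K) : cyclicAlgebra σ ℓ a :=
  ⟨cyclicDiag σ ℓ b, Algebra.subset_adjoin (Set.mem_insert_of_mem _ (Set.mem_range_self b))⟩

/-- `K/F` is a cyclic Galois extension of degree `ℓ` with generator `σ`, and `(K/F, σ, a)` is a
central division algebra over `F` of dimension `ℓ ^ 2`, i.e. of index `ℓ`. -/
structure IsCyclicDivisionAlgebra (σ : K ≃ₐ[F] K) (ℓ : ℕ) (a : F) : Prop where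
  isGalois : IsGalois F K
  finrank_field : Module.finrank F K = ℓ
  generates : ∀ τ : K ≃ₐ[F] K, τ ∈ Subgroup.zpowers σ
  isCentral : Algebra.IsCentral F (cyclicAlgebra σ ℓ a)
  finrank_algebra : Module.finrank F (cyclicAlgebra σ ℓ a) = ℓ ^ 2
  pos : 0 < ℓ
  isUnit_of_ne_zero : ∀ y : cyclicAlgebra σ ℓ a, y ≠ 0 → IsUnit y

end Cyclic

/-- The field `ℚ(z)` of rational functions in one indeterminate `z`. -/
abbrev RatZ : Type := RatFunc ℚ

/-- The field `ℚ(z)(ω) = ℚ(ω, z)` with `ω` a primitive `m`-th root of unity. -/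
abbrev RatZOmega (m : ℕ) : Type := CyclotomicField m RatZ

/-- The algebra `(K/F, σ, z)` with `F = ℚ(z)` and `K = ℚ(ω, z)`. -/
abbrev CyclicD {m : ℕ} (σ : RatZOmega m ≃ₐ[RatZ] RatZOmega m) (ℓ : ℕ) : Type :=
  cyclicAlgebra σ ℓ (RatFunc.X : RatZ)

/-- The `ℚ`-algebra structure that comes from `ℚ ⊆ ℚ(z)`. -/
instance {m : ℕ} (σ : RatZOmega m ≃ₐ[RatZ] RatZOmega m) (ℓ : ℕ) : Algebra ℚ (CyclicD σ ℓ) :=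
  Algebra.compHom (CyclicD σ ℓ) (algebraMap ℚ RatZ)

/-! ## Explicit representation of elements and points -/

/-- A term `(num / den) * z ^ zExp * ω ^ wExp * x ^ xExp`. -/
structure DTerm where
  num : ℤ
  den : ℕ+
  zExp : ℕ
  wExp : ℕ
  xExp : ℕ

/-- The element of `(K/F, σ, z)` that a term stands for. -/
def DTerm.value {m : ℕ} (σ : RatZOmega m ≃ₐ[RatZ] RatZOmega m) (ℓ : ℕ) (ω : RatZOmega m)
    (t : DTerm) : CyclicD σ ℓ :=
  algebraMap RatZ (CyclicD σ ℓ) (((t.num : RatZ) / ((t.den : ℕ) : RatZ)) * RatFunc.X ^ t.zExp) *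
    cyclicAlgebra.ofK σ ℓ RatFunc.X (ω ^ t.wExp) * cyclicAlgebra.x σ ℓ RatFunc.X ^ t.xExp

/-- The point of `D ^ n` whose coordinates are given as sums of terms. -/
def pointValue {m : ℕ} (σ : RatZOmega m ≃ₐ[RatZ] RatZOmega m) (ℓ : ℕ) (ω : RatZOmega m) {n : ℕ}
    (q : Fin n → List DTerm) : Fin n → CyclicD σ ℓ :=
  fun i => ((q i).map (DTerm.value σ ℓ ω)).sum

/-- A term is written as six natural numbers; the integer `num` as its positive and negative part. -/
def DTerm.encode (t : DTerm) : List ℕ :=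
  [t.num.toNat, (-t.num).toNat, t.den, t.zExp, t.wExp, t.xExp]

/-- A sum of terms is written as the number of terms followed by the terms. -/
def encodeElem (e : List DTerm) : List ℕ := e.length :: e.flatMap DTerm.encode

/-- The written form of an algebra (index `ℓ`, order `m` of `ω`, exponent `g` with `σ ω = ω ^ g`)
together with a list of points. -/
def encodeOutput {n : ℕ} (ℓ m g : ℕ) (pts : List (Fin n → List DTerm)) : List ℕ :=
  [ℓ, m, g, pts.length] ++ pts.flatMap fun q => (List.ofFn q).flatMap encodeElem

/-! ## Deterministic time: random access machines with logarithmic cost -/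

namespace RAM

/-- Programs over registers `R 0, R 1, …` that hold natural numbers. -/
inductive Prog : Type
  /-- `R t := k` -/
  | const (t k : ℕ)
  /-- `R t := R a + R b` -/
  | add (t a b : ℕ)
  /-- `R t := R a - R b` (truncated) -/
  | sub (t a b : ℕ)
  /-- `R t := R a * R b` -/
  | mul (t a b : ℕ)
  /-- `R t := R a / R b` (rounded down, `0` if `R b = 0`) -/
  | div (t a b : ℕ)
  /-- `R t := R (R a)` -/
  | load (t a : ℕ)
  /-- `R (R t) := R a` -/
  | store (t a : ℕ)
  /-- append `R a` to the output -/
  | emit (a : ℕ)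
  /-- `P; Q` -/
  | seq (P Q : Prog)
  /-- if `R a ≠ 0` then `P` else `Q` -/
  | cond (a : ℕ) (P Q : Prog)
  /-- while `R a ≠ 0` do `P` -/
  | loop (a : ℕ) (P : Prog)

/-- A state: the contents of the registers and the output written so far. -/
structure State where
  reg : ℕ → ℕ
  out : List ℕ

/-- Assignment to a register. -/
def State.set (s : State) (t v : ℕ) : State := ⟨Function.update s.reg t v, s.out⟩

/-- `Exec P s c s'`: started in state `s`, the program `P` halts in state `s'` at total cost `c`.
Every instruction and every test is charged one plus the bit lengths (`Nat.size`) of the numbers,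
indirect addresses included, that it reads. -/
inductive Exec : Prog → State → ℕ → State → Prop
  | const (s : State) (t k : ℕ) : Exec (.const t k) s (1 + k.size) (s.set t k)
  | add (s : State) (t a b : ℕ) :
      Exec (.add t a b) s (1 + (s.reg a).size + (s.reg b).size) (s.set t (s.reg a + s.reg b))
  | sub (s : State) (t a b : ℕ) :
      Exec (.sub t a b) s (1 + (s.reg a).size + (s.reg b).size) (s.set t (s.reg a - s.reg b))
  | mul (s : State) (t a b : ℕ) :
      Exec (.mul t a b) s (1 + (s.reg a).size + (s.reg b).size) (s.set t (s.reg a * s.reg b))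
  | div (s : State) (t a b : ℕ) :
      Exec (.div t a b) s (1 + (s.reg a).size + (s.reg b).size) (s.set t (s.reg a / s.reg b))
  | load (s : State) (t a : ℕ) :
      Exec (.load t a) s (1 + (s.reg a).size + (s.reg (s.reg a)).size)
        (s.set t (s.reg (s.reg a)))
  | store (s : State) (t a : ℕ) :
      Exec (.store t a) s (1 + (s.reg t).size + (s.reg a).size) (s.set (s.reg t) (s.reg a))
  | emit (s : State) (a : ℕ) :
      Exec (.emit a) s (1 + (s.reg a).size) ⟨s.reg, s.out ++ [s.reg a]⟩
  | seq {P Q : Prog} {s s' s'' : State} {c c' : ℕ} (hP : Exec P s c s') (hQ : Exec Q s' c' s'') :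
      Exec (.seq P Q) s (c + c') s''
  | cond_true {a : ℕ} {P Q : Prog} {s s' : State} {c : ℕ} (ha : s.reg a ≠ 0)
      (hP : Exec P s c s') : Exec (.cond a P Q) s (1 + (s.reg a).size + c) s'
  | cond_false {a : ℕ} {P Q : Prog} {s s' : State} {c : ℕ} (ha : s.reg a = 0)
      (hQ : Exec Q s c s') : Exec (.cond a P Q) s (1 + c) s'
  | loop_done {a : ℕ} {P : Prog} {s : State} (ha : s.reg a = 0) : Exec (.loop a P) s 1 s
  | loop_step {a : ℕ} {P : Prog} {s s' s'' : State} {c c' : ℕ} (ha : s.reg a ≠ 0)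
      (hP : Exec P s c s') (hL : Exec (.loop a P) s' c' s'') :
      Exec (.loop a P) s (1 + (s.reg a).size + c + c') s''

/-- The initial state: the input in the first registers, all others `0`, empty output. -/
def init (input : List ℕ) : State := ⟨fun i => input.getD i 0, []⟩

/-- On the given input, `P` halts with the given output at cost at most `T`. -/
def OutputsWithin (P : Prog) (input output : List ℕ) (T : ℕ) : Prop :=
  ∃ c s, Exec P (init input) c s ∧ s.out = output ∧ c ≤ T

end RAM

end

/-! Let `h = Nat.clog 2 d`. As 2 is a primitive root modulo `m = 3 ^ (h + 1)`, the map `ω ↦ ω ^ 2`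
generates the Galois group of `ℚ(z, ω)` over `ℚ(z)`, of order `ℓ = 2 * 3 ^ h > d`. Give `z` degree
`ℓ` and `x` degree 1: the degrees of `z ^ s x ^ k` with `k < ℓ` are distinct, so leading terms
cannot cancel in a product and `D` has no zero divisors (`exists_sum_twistedTerm_ne_zero`,
`IsPolynomialModel.isDomain`). A finite-dimensional domain is a division algebra, so nonzero values
are automatically invertible and only hitting has to be proved.

At a point with coordinates `b i * x`, the letter `i` at position `k` contributes the conjugate `σ ^
k (b i)`, and a word of length `e` contributes to `x ^ e` alone (`prod_map_ofKHom_mul_x`). Thus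
positions become visible, and words of different lengths below `ℓ` do not interact. The `b i` are
built by Fourier interpolation: after replacing one copy of `z` by `ω`, the `k`-th conjugate becomes
`m * t ^ W (k, i)` (`map_pointPoly`), where `t` stands for `z ^ E`. A large `E` makes the two copies
of `z` behave as independent variables (`eval_X_pow_ne_zero`). Hence a value is nonzero as soon as,
for some length, the coefficients of the words of some weight have nonzero sum
(`sum_posProd_pointCoeff_ne_zero`).

Such weights come from basis isolation. The coefficients of a program form a linear representation
of dimension at most `r * (d + 1)` (`exists_linear_representation`), so each word has an operator
and a functional gives its coefficient. If all operators outside a basis with distinct weights are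
combinations of lighter basis operators, then in the weight of the lightest basis operator not
killed by the functional nothing cancels (`IsIsolatingBasis.exists_sum_ne_zero`). The weights are
built by doubling the length of words `h` times. At each level the products of two bases are
separated by reducing their codes modulo a number at most `N` (`exists_moduli`). Which modulus works
is unknown, so all `N ^ h` sequences are listed, which gives the quasipolynomial size.

The algorithm lists these sequences as the base `N` digits of a counter. Its correctness and cost
are proved by loop invariants, with a common bound `V` on the registers whose bit length is all that
enters the cost. -/

noncomputable section

/-! ## Basis isolating weights -/

section Isolation

open Submodule Pointwise

variable {M V : Type*} [AddCommGroup V] [Module ℚ V]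

/-- `S` is a set of at most `D` elements of `F` with distinct weights such that the value of every
other element of `F` is a combination of values of elements of `S` of smaller weight. -/
structure IsIsolatingBasis (val : M → V) (wt : M → ℕ) (F : Set M) (D : ℕ) (S : Finset M) :
    Prop where
  subset : (S : Set M) ⊆ F
  card_le : S.card ≤ D
  injOn : Set.InjOn wt S
  mem_or : ∀ a ∈ F, a ∈ S ∨ val a ∈ span ℚ (val '' {b | b ∈ S ∧ wt b < wt a})

/-- Elements are added in order of increasing weight. Injectivity of the weight makes all earlier
elements strictly lighter, so each new value lies outside their span. -/
theorem linearIndepOn_of_notMem_span_lower (val : M → V) (wt : M → ℕ) (S : Finset M)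
    (hinj : Set.InjOn wt S)
    (h : ∀ a ∈ S, val a ∉ span ℚ (val '' {c | c ∈ S ∧ wt c < wt a})) :
    LinearIndepOn ℚ val (S : Set M) := by
  classical
  suffices H : ∀ U : Finset M, U ⊆ S → LinearIndepOn ℚ val (U : Set M) from H S subset_rfl
  intro U
  induction U using Finset.induction_on_max_value wt with
  | empty => intro _; simp
  | insert a U ha hmax ih =>
    intro hU
    rw [Finset.coe_insert]
    refine (ih fun x hx => hU (Finset.mem_insert_of_mem hx)).insert fun hmem => ?_
    refine h a (hU (Finset.mem_insert_self _ _)) (span_mono ?_ hmem)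
    rintro _ ⟨c, hc, rfl⟩
    have hcS := hU (Finset.mem_insert_of_mem (Finset.mem_coe.1 hc))
    refine ⟨c, ⟨hcS, lt_of_le_of_ne (hmax c hc) fun heq => ?_⟩, rfl⟩
    exact ha (hinj hcS (hU (Finset.mem_insert_self _ _)) heq ▸ hc)

/-- The greedy basis with respect to an injective weight. -/
theorem exists_isIsolatingBasis_finset [Module.Finite ℚ V] (val : M → V) (wt : M → ℕ)
    (T : Finset M) (hinj : Set.InjOn wt T) :
    ∃ S, IsIsolatingBasis val wt (T : Set M) (Module.finrank ℚ V) S := by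
  classical
  -- The greedy choice: an element is kept when its value is not generated by the lighter elements
  -- of `T`. By strong induction on the weight, `key` then trades the elements of `T` for those of
  -- `S`.
  set S := T.filter fun a => val a ∉ span ℚ (val '' {c | c ∈ T ∧ wt c < wt a}) with hS
  have hST : S ⊆ T := Finset.filter_subset _ _
  have hSinj : Set.InjOn wt S := hinj.mono (Finset.coe_subset.2 hST)
  have key : ∀ k, ∀ a ∈ T, wt a = k → val a ∈ span ℚ (val '' {b | b ∈ S ∧ wt b ≤ wt a}) := by
    intro k
    induction k using Nat.strong_induction_on with
    | _ k ih =>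
      intro a ha hk
      by_cases haS : a ∈ S
      · exact subset_span ⟨a, ⟨haS, le_rfl⟩, rfl⟩
      · have : val a ∈ span ℚ (val '' {c | c ∈ T ∧ wt c < wt a}) := by
          by_contra hcon
          exact haS (Finset.mem_filter.2 ⟨ha, hcon⟩)
        refine span_le.2 ?_ this
        rintro _ ⟨c, ⟨hc, hlt⟩, rfl⟩
        refine span_mono (Set.image_mono ?_) (ih (wt c) (hk ▸ hlt) c hc rfl)
        exact fun b hb => ⟨hb.1, hb.2.trans hlt.le⟩
  refine ⟨S, Finset.coe_subset.2 hST, ?_, hSinj, fun a ha => ?_⟩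
  · have hli := linearIndepOn_of_notMem_span_lower val wt S hSinj fun a ha hmem => by
      refine (Finset.mem_filter.1 ha).2 (span_mono (Set.image_mono ?_) hmem)
      exact fun c hc => ⟨hST hc.1, hc.2⟩
    simpa using LinearIndependent.fintype_card_le_finrank hli
  · by_cases haS : a ∈ S
    · exact Or.inl haS
    · right
      have : val a ∈ span ℚ (val '' {c | c ∈ T ∧ wt c < wt a}) := by
        by_contra hcon
        exact haS (Finset.mem_filter.2 ⟨ha, hcon⟩)
      refine span_le.2 ?_ this
      rintro _ ⟨c, ⟨hc, hlt⟩, rfl⟩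
      refine span_mono (Set.image_mono ?_) (key _ c hc rfl)
      exact fun b hb => ⟨hb.1, hb.2.trans_lt hlt⟩

/-- A weight that refines the given one and is injective on the given basis. -/
theorem exists_isIsolatingBasis_of_refine [Module.Finite ℚ V] (val : M → V) (wt wt' : M → ℕ)
    (F : Set M) (T : Finset M) (hTF : (T : Set M) ⊆ F)
    (hT : ∀ a ∈ F, a ∈ T ∨ val a ∈ span ℚ (val '' {b | b ∈ T ∧ wt b < wt a}))
    (hlt : ∀ a ∈ F, ∀ b ∈ F, wt a < wt b → wt' a < wt' b) (hinj : Set.InjOn wt' T) :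
    ∃ S, S ⊆ T ∧ IsIsolatingBasis val wt' F (Module.finrank ℚ V) S := by
  obtain ⟨S, hS⟩ := exists_isIsolatingBasis_finset val wt' T hinj
  have hST : S ⊆ T := Finset.coe_subset.1 hS.subset
  refine ⟨S, hST, hS.subset.trans hTF, hS.card_le, hS.injOn, fun a ha => ?_⟩
  rcases hT a ha with haT | hspan
  · exact hS.mem_or a haT
  · right
    refine span_le.2 ?_ hspan
    rintro _ ⟨b, ⟨hb, hba⟩, rfl⟩
    have hba' := hlt b (hTF hb) a ha hba
    -- An element of `T` missing from `S` is rewritten by elements of `S` lighter for `wt'`, and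
    -- these stay below `a` because `wt'` respects the strict order given by `wt`.
    rcases hS.mem_or b hb with hbS | hbspan
    · exact subset_span ⟨b, ⟨hbS, hba'⟩, rfl⟩
    · refine span_mono (Set.image_mono ?_) hbspan
      exact fun c hc => ⟨hc.1, hc.2.trans hba'⟩

theorem IsIsolatingBasis.mem_span_le {val : M → V} {wt : M → ℕ} {F : Set M} {D : ℕ} {S : Finset M}
    (h : IsIsolatingBasis val wt F D S) {a : M} (ha : a ∈ F) :
    val a ∈ span ℚ (val '' {b | b ∈ S ∧ wt b ≤ wt a}) := by
  rcases h.mem_or a ha with h1 | h1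
  · exact subset_span ⟨a, ⟨h1, le_rfl⟩, rfl⟩
  · refine span_mono (Set.image_mono ?_) h1
    exact fun c hc => ⟨hc.1, hc.2.le⟩

/-- If a functional does not vanish on an isolated family, then neither does the sum of its values
over the elements of some weight. -/
theorem IsIsolatingBasis.exists_sum_ne_zero {val : M → V} {wt : M → ℕ} {F : Set M} {D : ℕ}
    {S : Finset M} (h : IsIsolatingBasis val wt F D S) (φ : V →ₗ[ℚ] ℚ) (Z : Finset M)
    (hZF : (Z : Set M) ⊆ F) (hZ : ∀ a ∈ F, a ∉ Z → φ (val a) = 0)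
    (hne : ∃ a ∈ F, φ (val a) ≠ 0) :
    ∃ w, ∑ a ∈ Z with wt a = w, φ (val a) ≠ 0 := by
  classical
  have hS : ∃ b ∈ S, φ (val b) ≠ 0 := by
    by_contra hcon
    push Not at hcon
    obtain ⟨a, ha, hφ⟩ := hne
    refine hφ ?_
    have : span ℚ (val '' {b | b ∈ S ∧ wt b ≤ wt a}) ≤ LinearMap.ker φ := by
      rw [span_le]
      rintro _ ⟨b, hb, rfl⟩
      exact hcon b hb.1
    exact this (h.mem_span_le ha)
  -- The lightest basis element not killed by `φ`. By injectivity every other element of this weight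
  -- lies outside `S`, so its value is a combination of lighter basis values, all killed by `φ`.
  obtain ⟨b, hb, hmin⟩ := (S.filter fun b => φ (val b) ≠ 0).exists_min_image wt
    (by obtain ⟨b, hb, hφ⟩ := hS; exact ⟨b, Finset.mem_filter.2 ⟨hb, hφ⟩⟩)
  rw [Finset.mem_filter] at hb
  refine ⟨wt b, ?_⟩
  have hbZ : b ∈ Z := by
    by_contra hcon
    exact hb.2 (hZ b (h.subset hb.1) hcon)
  rw [Finset.sum_eq_single b]
  · exact hb.2
  · intro c hc hcb
    rw [Finset.mem_filter] at hc
    rcases h.mem_or c (hZF hc.1) with hcS | hspan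
    · exact absurd (h.injOn hcS hb.1 hc.2) hcb
    · have : span ℚ (val '' {b | b ∈ S ∧ wt b < wt c}) ≤ LinearMap.ker φ := by
        rw [span_le]
        rintro _ ⟨e, ⟨heS, hlt⟩, rfl⟩
        by_contra hφ
        have := hmin e (Finset.mem_filter.2 ⟨heS, hφ⟩)
        omega
      exact this hspan
  · exact fun hcon => (hcon (Finset.mem_filter.2 ⟨hbZ, rfl⟩)).elim

variable {A : Type*} [Monoid M] [Ring A] [Algebra ℚ A]

theorem mul_mem_span_image_mul (val : M →* A) {U₁ U₂ : Set M} {U : Set M} {x y : A}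
    (hx : x ∈ span ℚ (val '' U₁)) (hy : y ∈ span ℚ (val '' U₂))
    (hU : ∀ a ∈ U₁, ∀ b ∈ U₂, a * b ∈ U) : x * y ∈ span ℚ (val '' U) := by
  have := Submodule.mul_mem_mul hx hy
  rw [Submodule.span_mul_span] at this
  refine span_mono ?_ this
  rintro _ ⟨_, ⟨a, ha, rfl⟩, _, ⟨b, hb, rfl⟩, rfl⟩
  exact ⟨a * b, hU a ha b hb, by simp⟩

/-- If one factor is not a basis element, its expansion loses weight while that of the other gains
none, and weights add. Products of two basis elements remain; they may share weights, which is why a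
merging step is needed. -/
theorem mul_mem_or_mem_span [DecidableEq M] (val : M →* A) (wt : M → ℕ)
    (hwt : ∀ a b, wt (a * b) = wt a + wt b) {F₁ F₂ : Set M} {D : ℕ} {S₁ S₂ : Finset M}
    (h₁ : IsIsolatingBasis val wt F₁ D S₁) (h₂ : IsIsolatingBasis val wt F₂ D S₂)
    {a : M} (ha : a ∈ F₁ * F₂) :
    a ∈ S₁ * S₂ ∨ val a ∈ span ℚ (val '' {b | b ∈ S₁ * S₂ ∧ wt b < wt a}) := by
  obtain ⟨a₁, ha₁, a₂, ha₂, rfl⟩ := ha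
  by_cases hS : a₁ ∈ S₁ ∧ a₂ ∈ S₂
  · exact Or.inl (Finset.mul_mem_mul hS.1 hS.2)
  · right
    simp only [map_mul]
    rcases h₁.mem_or a₁ ha₁ with h | h
    · have h' := (h₂.mem_or a₂ ha₂).resolve_left fun hh => hS ⟨h, hh⟩
      refine mul_mem_span_image_mul val (h₁.mem_span_le ha₁) h' fun x hx y hy => ?_
      refine ⟨Finset.mul_mem_mul hx.1 hy.1, ?_⟩
      have := hx.2
      have := hy.2
      simp only [hwt]
      omega
    · refine mul_mem_span_image_mul val h (h₂.mem_span_le ha₂) fun x hx y hy => ?_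
      refine ⟨Finset.mul_mem_mul hx.1 hy.1, ?_⟩
      have := hx.2
      have := hy.2
      simp only [hwt]
      omega

/-- Merging two isolated families: the weight is scaled and a new weight is added that separates
the products of basis elements. -/
theorem exists_isIsolatingBasis_mul [DecidableEq M] [Module.Finite ℚ A] (val : M →* A)
    (wt hash : M → ℕ) (B : ℕ)
    (hwt : ∀ a b, wt (a * b) = wt a + wt b) {F₁ F₂ : Set M} {D : ℕ} {S₁ S₂ : Finset M}
    (h₁ : IsIsolatingBasis val wt F₁ D S₁) (h₂ : IsIsolatingBasis val wt F₂ D S₂)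
    (hB : ∀ a ∈ F₁ * F₂, hash a < B) (hinj : Set.InjOn hash ((S₁ * S₂ : Finset M) : Set M)) :
    ∃ S, IsIsolatingBasis val (fun a => B * wt a + hash a) (F₁ * F₂) (Module.finrank ℚ A) S := by
  have hTF : ((S₁ * S₂ : Finset M) : Set M) ⊆ F₁ * F₂ := by
    rw [Finset.coe_mul]
    exact Set.mul_subset_mul h₁.subset h₂.subset
  -- As `hash` stays below `B`, it can only break ties of `wt`.
  have hlt : ∀ a ∈ F₁ * F₂, ∀ b ∈ F₁ * F₂, wt a < wt b →
      B * wt a + hash a < B * wt b + hash b := by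
    intro a ha b _ hab
    have h1 := hB a ha
    have h2 : B * (wt a + 1) ≤ B * wt b := Nat.mul_le_mul_left _ hab
    linarith
  have hinj' : Set.InjOn (fun a => B * wt a + hash a) ((S₁ * S₂ : Finset M) : Set M) := by
    intro a ha b hb hab
    have h1 := hB a (hTF ha)
    have h2 := hB b (hTF hb)
    refine hinj ha hb ?_
    have := congrArg (· % B) hab
    simpa [Nat.mul_add_mod, Nat.mod_eq_of_lt h1, Nat.mod_eq_of_lt h2] using this
  obtain ⟨S, -, hS⟩ := exists_isIsolatingBasis_of_refine val wt (fun a => B * wt a + hash a)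
    (F₁ * F₂) (S₁ * S₂) hTF (fun a ha => mul_mem_or_mem_span val wt hwt h₁ h₂ ha) hlt hinj'
  exact ⟨S, hS⟩

end Isolation

end

noncomputable section

/-! ## A small modulus that does not divide a given number -/

theorem two_pow_le_centralBinom (k : ℕ) : 2 ^ k ≤ k.centralBinom := by
  induction k with
  | zero => simp
  | succ k ih =>
    have h := Nat.succ_mul_centralBinom_succ k
    have h2 : (k + 1) * (2 * k.centralBinom) ≤ (k + 1) * (k + 1).centralBinom := by
      rw [h]
      nlinarith [Nat.zero_le k.centralBinom, Nat.zero_le k]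
    have := Nat.le_of_mul_le_mul_left h2 (Nat.succ_pos k)
    rw [pow_succ]
    omega

/-- The prime powers exactly dividing `L.centralBinom` are at most `2 * L`. If all numbers up to `2
* L` divided `X`, so would this binomial coefficient, which is at least `2 ^ L`. -/
theorem exists_not_dvd_of_lt_two_pow {X L : ℕ} (hX : X ≠ 0) (hL : X < 2 ^ L) :
    ∃ p, 1 ≤ p ∧ p ≤ 2 * L ∧ ¬ p ∣ X := by
  by_contra hcon
  push Not at hcon
  have hdvd : L.centralBinom ∣ X := by
    rw [← Nat.factorization_prime_le_iff_dvd (Nat.centralBinom_ne_zero L) hX]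
    intro p hp
    rw [← hp.pow_dvd_iff_le_factorization hX]
    rcases Nat.eq_zero_or_pos L with rfl | hpos
    · simp
    · refine hcon _ (Nat.one_le_pow _ _ hp.pos) ?_
      exact Nat.pow_factorization_choose_le (by omega)
  have := Nat.le_of_dvd (Nat.pos_of_ne_zero hX) hdvd
  have := two_pow_le_centralBinom L
  omega

/-! ## Weights that isolate bases for words over positioned letters -/

section Blocks

open Pointwise

/-- The sum of a weight over the letters of a word. -/
def letterSum {α : Type*} (c : α → ℕ) (u : FreeMonoid α) : ℕ := (u.toList.map c).sum

theorem letterSum_mul {α : Type*} (c : α → ℕ) (u v : FreeMonoid α) :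
    letterSum c (u * v) = letterSum c u + letterSum c v := by
  simp [letterSum]

theorem letterSum_one {α : Type*} (c : α → ℕ) : letterSum c 1 = 0 := by
  simp [letterSum]

theorem letterSum_of {α : Type*} (c : α → ℕ) (x : α) : letterSum c (FreeMonoid.of x) = c x := by
  simp [letterSum]

theorem letterSum_mul_add {α : Type*} (B : ℕ) (c c' : α → ℕ) (u : FreeMonoid α) :
    letterSum (fun x => B * c x + c' x) u = B * letterSum c u + letterSum c' u := by
  simp [letterSum, List.sum_map_add, List.sum_map_mul_left]

variable (n : ℕ)

/-- The letter `i` at position `k` as a digit of a number in base `n + 1`. -/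
def letterCode (x : ℕ × Fin n) : ℕ := (x.2 + 1) * (n + 1) ^ x.1

/-- The iterated weights of letters, built from a base `B` and a sequence of moduli. -/
def isoWeight (B : ℕ) (p : ℕ → ℕ) : ℕ → ℕ × Fin n → ℕ
  | 0, x => x.2 + 1
  | j + 1, x => B * isoWeight B p j x + letterCode n x % p j

theorem isoWeight_congr (B : ℕ) {p p' : ℕ → ℕ} {j : ℕ} (h : ∀ i < j, p i = p' i) :
    isoWeight n B p j = isoWeight n B p' j := by
  induction j with
  | zero => rfl
  | succ j ih =>
    funext x
    simp only [isoWeight]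
    rw [ih fun i hi => h i (by omega), h j (by omega)]

/-- The words with one letter at every position below `e` in the block of positions
`a * 2 ^ j, …, (a + 1) * 2 ^ j - 1`. -/
def block (e : ℕ) : ℕ → ℕ → Set (FreeMonoid (ℕ × Fin n))
  | 0, a => if a < e then Set.range fun i : Fin n => FreeMonoid.of (a, i) else {1}
  | j + 1, a => block e j (2 * a) * block e j (2 * a + 1)

variable {n}

theorem length_le_of_mem_block {e j a : ℕ} {u : FreeMonoid (ℕ × Fin n)} (hu : u ∈ block n e j a) :
    u.length ≤ 2 ^ j := by
  induction j generalizing a u with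
  | zero =>
    simp only [block] at hu
    split_ifs at hu
    · obtain ⟨i, rfl⟩ := hu
      simp
    · rw [Set.mem_singleton_iff.1 hu]
      simp
  | succ j ih =>
    obtain ⟨u₁, h₁, u₂, h₂, rfl⟩ := hu
    have := ih h₁
    have := ih h₂
    simp only [FreeMonoid.length_mul, pow_succ]
    omega

/-- Letters are nonzero digits in base `n + 1`, and positions from `e` on have digit 0. So the code
is a string of `2 ^ j` digits, shifted to the start of the block. -/
theorem exists_letterCode_eq {e j a : ℕ} {u : FreeMonoid (ℕ × Fin n)} (hu : u ∈ block n e j a) :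
    ∃ c < (n + 1) ^ 2 ^ j, letterSum (letterCode n) u = (n + 1) ^ (a * 2 ^ j) * c := by
  induction j generalizing a u with
  | zero =>
    simp only [block] at hu
    split_ifs at hu
    · obtain ⟨i, rfl⟩ := hu
      exact ⟨i + 1, by simp, by simp [letterSum_of, letterCode, mul_comm]⟩
    · rw [Set.mem_singleton_iff.1 hu]
      exact ⟨0, by simp, by simp [letterSum_one]⟩
  | succ j ih =>
    obtain ⟨u₁, h₁, u₂, h₂, rfl⟩ := hu
    obtain ⟨c₁, hc₁, e₁⟩ := ih h₁
    obtain ⟨c₂, hc₂, e₂⟩ := ih h₂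
    refine ⟨c₁ + (n + 1) ^ 2 ^ j * c₂, ?_, ?_⟩
    · have : (n + 1) ^ 2 ^ (j + 1) = (n + 1) ^ 2 ^ j * (n + 1) ^ 2 ^ j := by
        rw [pow_succ, mul_two, pow_add]
      rw [this]
      have : (n + 1) ^ 2 ^ j * (c₂ + 1) ≤ (n + 1) ^ 2 ^ j * (n + 1) ^ 2 ^ j :=
        Nat.mul_le_mul_left _ hc₂
      linarith
    · simp only [letterSum_mul, e₁, e₂]
      ring

/-- The halves of a word occupy disjoint ranges of digits, so remainder and quotient by `(n + 1) ^ 2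
^ j` recover the codes of both. -/
theorem letterCode_injOn_block {e : ℕ} (j a : ℕ) :
    Set.InjOn (letterSum (letterCode n)) (block n e j a) := by
  induction j generalizing a with
  | zero =>
    intro u hu v hv huv
    simp only [block] at hu hv
    split_ifs at hu hv
    · obtain ⟨i, rfl⟩ := hu
      obtain ⟨k, rfl⟩ := hv
      simp only [letterSum_of, letterCode] at huv
      have := Nat.eq_of_mul_eq_mul_right (by positivity) huv
      have : i = k := Fin.ext (by omega)
      rw [this]
    · rw [Set.mem_singleton_iff.1 hu, Set.mem_singleton_iff.1 hv]
  | succ j ih =>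
    rintro _ ⟨u₁, hu₁, u₂, hu₂, rfl⟩ _ ⟨v₁, hv₁, v₂, hv₂, rfl⟩ huv
    obtain ⟨c₁, hc₁, e₁⟩ := exists_letterCode_eq hu₁
    obtain ⟨c₂, hc₂, e₂⟩ := exists_letterCode_eq hu₂
    obtain ⟨d₁, hd₁, f₁⟩ := exists_letterCode_eq hv₁
    obtain ⟨d₂, hd₂, f₂⟩ := exists_letterCode_eq hv₂
    simp only [letterSum_mul] at huv
    have key : (n + 1) ^ (2 * a * 2 ^ j) * (c₁ + (n + 1) ^ 2 ^ j * c₂) =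
        (n + 1) ^ (2 * a * 2 ^ j) * (d₁ + (n + 1) ^ 2 ^ j * d₂) := by
      rw [e₁, e₂, f₁, f₂] at huv
      calc _ = (n + 1) ^ (2 * a * 2 ^ j) * c₁ + (n + 1) ^ ((2 * a + 1) * 2 ^ j) * c₂ := by ring
        _ = _ := huv
        _ = _ := by ring
    have key := Nat.eq_of_mul_eq_mul_left (by positivity) key
    have h1 : c₁ = d₁ := by
      have := congrArg (· % (n + 1) ^ 2 ^ j) key
      simpa [Nat.add_mul_mod_self_left, Nat.mod_eq_of_lt hc₁, Nat.mod_eq_of_lt hd₁] using this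
    have h2 : c₂ = d₂ := by
      rw [h1] at key
      exact Nat.eq_of_mul_eq_mul_left (by positivity) (Nat.add_left_cancel key)
    rw [ih _ hu₁ hv₁ (by rw [e₁, f₁, h1]), ih _ hu₂ hv₂ (by rw [e₂, f₂, h2])]

theorem letterCode_lt_of_mem_block {e j a h : ℕ} {u : FreeMonoid (ℕ × Fin n)}
    (hu : u ∈ block n e j a) (ha : (a + 1) * 2 ^ j ≤ 2 ^ h) :
    letterSum (letterCode n) u < 2 ^ (n * 2 ^ h) := by
  obtain ⟨c, hc, he⟩ := exists_letterCode_eq hu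
  rw [he]
  calc (n + 1) ^ (a * 2 ^ j) * c < (n + 1) ^ (a * 2 ^ j) * (n + 1) ^ 2 ^ j :=
        Nat.mul_lt_mul_of_pos_left hc (by positivity)
    _ = (n + 1) ^ ((a + 1) * 2 ^ j) := by ring
    _ ≤ (n + 1) ^ 2 ^ h := Nat.pow_le_pow_right (by omega) ha
    _ ≤ (2 ^ n) ^ 2 ^ h := Nat.pow_le_pow_left Nat.lt_two_pow_self _
    _ = 2 ^ (n * 2 ^ h) := by rw [pow_mul]

theorem letterSum_mod_lt {e j a q N : ℕ} (hq : 1 ≤ q) (hqN : q ≤ N)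
    {u : FreeMonoid (ℕ × Fin n)} (hu : u ∈ block n e j a) :
    letterSum (fun x => letterCode n x % q) u < 2 ^ j * N + 1 := by
  have h1 : letterSum (fun x => letterCode n x % q) u ≤ u.length * N := by
    have := List.sum_le_card_nsmul (u.toList.map fun x => letterCode n x % q) N (by
      intro y hy
      obtain ⟨x, -, rfl⟩ := List.mem_map.1 hy
      exact (Nat.mod_lt _ hq).le.trans hqN)
    simpa [letterSum, FreeMonoid.length] using this
  have h2 := Nat.mul_le_mul_right N (length_le_of_mem_block hu)
  omega

/-- Reducing letter by letter keeps the weight small and additive, as merging requires, and still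
determines the code modulo `q`. -/
theorem letterSum_mod_modEq {α : Type*} (c : α → ℕ) (q : ℕ) (u : FreeMonoid α) :
    letterSum (fun x => c x % q) u ≡ letterSum c u [MOD q] := by
  unfold letterSum
  induction u.toList with
  | nil => rfl
  | cons x l ih => simpa using (Nat.mod_modEq (c x) q).add ih

/-- A modulus that separates the codes of the words in each of the given finite sets. -/
theorem exists_modulus {M : Type*} [DecidableEq M] (code : M → ℕ) {k D L N : ℕ} (T : ℕ → Finset M)
    (hinj : ∀ a < k, Set.InjOn code (T a)) (hT : ∀ a < k, (T a).card ≤ D)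
    (hcode : ∀ a < k, ∀ u ∈ T a, code u < 2 ^ L) (hN : 2 * (L * D ^ 2 * k + 1) ≤ N) :
    ∃ q, 1 ≤ q ∧ q ≤ N ∧ ∀ a < k, ∀ u ∈ T a, ∀ v ∈ T a, code u ≡ code v [MOD q] → u = v := by
  -- One product collects the nonzero differences of codes over all `k` sets. A number that does not
  -- divide it divides none of the differences, so a single modulus works for every set.
  set X : ℕ := ∏ a ∈ Finset.range k, ∏ x ∈ (T a ×ˢ T a).filter (fun x => x.1 ≠ x.2),
    ((code x.1 : ℤ) - code x.2).natAbs with hX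
  have hX0 : X ≠ 0 := by
    rw [hX, Finset.prod_ne_zero_iff]
    intro a ha
    rw [Finset.prod_ne_zero_iff]
    rintro ⟨u, v⟩ hx
    simp only [Finset.mem_filter, Finset.mem_product] at hx
    intro h0
    refine hx.2 (hinj a (Finset.mem_range.1 ha) hx.1.1 hx.1.2 ?_)
    simp only at h0
    omega
  have hXle : X ≤ 2 ^ (L * D ^ 2 * k) := by
    calc X ≤ ∏ a ∈ Finset.range k, 2 ^ (L * D ^ 2) := by
          refine Finset.prod_le_prod' fun a ha => ?_
          have ha' := Finset.mem_range.1 ha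
          refine (Finset.prod_le_pow_card _ _ (2 ^ L) ?_).trans ?_
          · rintro ⟨u, v⟩ hx
            simp only [Finset.mem_filter, Finset.mem_product] at hx
            have h1 := hcode a ha' u hx.1.1
            have h2 := hcode a ha' v hx.1.2
            simp only
            omega
          · rw [pow_mul]
            refine Nat.pow_le_pow_right (by positivity) ((Finset.card_filter_le _ _).trans ?_)
            rw [Finset.card_product, pow_two]
            exact Nat.mul_le_mul (hT a ha') (hT a ha')
      _ = _ := by rw [Finset.prod_const, Finset.card_range, ← pow_mul]
  obtain ⟨q, hq1, hqL, hq⟩ := exists_not_dvd_of_lt_two_pow hX0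
    (hXle.trans_lt (Nat.pow_lt_pow_succ one_lt_two))
  refine ⟨q, hq1, hqL.trans hN, fun a ha u hu v hv huv => ?_⟩
  by_contra hne
  apply hq
  have h1 : q ∣ ((code u : ℤ) - code v).natAbs := by
    have := (Nat.modEq_iff_dvd.1 huv.symm)
    exact Int.natCast_dvd.1 this
  refine h1.trans ((Finset.dvd_prod_of_mem (fun x : M × M => ((code x.1 : ℤ) - code x.2).natAbs)
    (a := (u, v)) ?_).trans (Finset.dvd_prod_of_mem (fun a => ∏ x ∈ (T a ×ˢ T a).filter
      (fun x => x.1 ≠ x.2), ((code x.1 : ℤ) - code x.2).natAbs) (Finset.mem_range.2 ha)))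
  simp [hu, hv, hne]

theorem exists_isIsolatingBasis_leaf {A : Type*} [Ring A] [Algebra ℚ A] [Module.Finite ℚ A]
    (hA : 1 ≤ Module.finrank ℚ A)
    (val : FreeMonoid (ℕ × Fin n) →* A) (e B : ℕ) (p : ℕ → ℕ) (a : ℕ) :
    ∃ S, IsIsolatingBasis val (letterSum (isoWeight n B p 0)) (block n e 0 a)
      (Module.finrank ℚ A) S := by
  classical
  by_cases hae : a < e
  · have hinj : Set.InjOn (letterSum (isoWeight n B p 0))
        ((Finset.univ.image fun i : Fin n => FreeMonoid.of (a, i) : Finset _) : Set _) := by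
      intro u hu v hv huv
      simp only [Finset.coe_image, Finset.coe_univ, Set.image_univ, Set.mem_range] at hu hv
      obtain ⟨i, rfl⟩ := hu
      obtain ⟨k, rfl⟩ := hv
      simp only [letterSum_of, isoWeight] at huv
      have : i = k := Fin.ext (by omega)
      rw [this]
    obtain ⟨S, hS⟩ := exists_isIsolatingBasis_finset (val : FreeMonoid (ℕ × Fin n) → A) _ _ hinj
    refine ⟨S, ?_⟩
    simpa [block, hae] using hS
  -- From position `e` on the block contains only the empty word. Its basis has one element, hence
  -- the hypothesis that the dimension is positive.
  · refine ⟨{1}, ?_, by simpa using hA, by simp, fun u hu => Or.inl ?_⟩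
    · simp [block, hae]
    · simpa [block, hae] using hu

/-- Some sequence of moduli bounded by `N` gives weights that isolate a basis for all words of
length `e ≤ 2 ^ h`. -/
theorem exists_moduli {A : Type*} [Ring A] [Algebra ℚ A] [Module.Finite ℚ A]
    (hA : 1 ≤ Module.finrank ℚ A) (val : FreeMonoid (ℕ × Fin n) →* A) {D h N B : ℕ} (e : ℕ)
    (hD : Module.finrank ℚ A ≤ D) (hN : 2 * (n * 2 ^ h * D ^ 4 * 2 ^ h + 1) ≤ N)
    (hB : B = 2 ^ h * N + 1) (j : ℕ) (hj : j ≤ h) :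
    ∃ p : ℕ → ℕ, (∀ i, 1 ≤ p i ∧ p i ≤ N) ∧ ∀ a < 2 ^ (h - j),
      ∃ S, IsIsolatingBasis val (letterSum (isoWeight n B p j)) (block n e j a)
        (Module.finrank ℚ A) S := by
  classical
  induction j with
  | zero =>
    exact ⟨fun _ => 1, fun i => ⟨le_rfl, by show 1 ≤ N; omega⟩, fun a _ =>
      exists_isIsolatingBasis_leaf hA val e B _ a⟩
  | succ j ih =>
    obtain ⟨p, hp, hS⟩ := ih (by omega)
    choose! S hS using hS
    have hpow : 2 ^ (h - j) = 2 * 2 ^ (h - (j + 1)) := by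
      rw [← pow_succ']
      congr 1
      omega
    have hle : 2 ^ (h - (j + 1)) ≤ 2 ^ h := Nat.pow_le_pow_right (by omega) (by omega)
    have hsub : ∀ a < 2 ^ (h - (j + 1)),
        ((S (2 * a) * S (2 * a + 1) : Finset _) : Set _) ⊆ block n e (j + 1) a := by
      intro a ha
      rw [Finset.coe_mul]
      exact Set.mul_subset_mul (hS (2 * a) (by omega)).subset (hS (2 * a + 1) (by omega)).subset
    -- One modulus serves all blocks of the new level, so only one number per level is unknown. Two
    -- bases of size `D` have at most `D ^ 2` products, and their pairs explain the `D ^ 4` in the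
    -- bound for `N`.
    obtain ⟨q, hq1, hqN, hq⟩ := exists_modulus (letterSum (letterCode n))
      (k := 2 ^ (h - (j + 1))) (D := D ^ 2) (L := n * 2 ^ h) (N := N)
      (fun a => S (2 * a) * S (2 * a + 1))
      (fun a ha => (letterCode_injOn_block (j + 1) a).mono (hsub a ha))
      (fun a ha => by
        refine Finset.card_mul_le.trans ?_
        rw [pow_two]
        exact Nat.mul_le_mul ((hS (2 * a) (by omega)).card_le.trans hD)
          ((hS (2 * a + 1) (by omega)).card_le.trans hD))
      (fun a ha u hu => by
        refine letterCode_lt_of_mem_block (hsub a ha hu) ?_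
        calc (a + 1) * 2 ^ (j + 1) ≤ 2 ^ (h - (j + 1)) * 2 ^ (j + 1) :=
              Nat.mul_le_mul_right _ ha
          _ = 2 ^ h := by rw [← pow_add]; congr 1; omega)
      (by
        refine le_trans ?_ hN
        rw [← pow_mul]
        gcongr)
    refine ⟨Function.update p j q, fun i => ?_, fun a ha => ?_⟩
    · by_cases hi : i = j
      · subst hi
        simpa using ⟨hq1, hqN⟩
      · simpa [hi] using hp i
    · have hw : letterSum (isoWeight n B (Function.update p j q) (j + 1)) =
          fun u => B * letterSum (isoWeight n B p j) u +
            letterSum (fun x => letterCode n x % q) u := by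
        funext u
        rw [← letterSum_mul_add]
        congr 1
        funext x
        simp only [isoWeight, Function.update_self]
        rw [isoWeight_congr n B (p' := p) (fun i hi => by
          rw [Function.update_of_ne (by omega)])]
      rw [hw]
      refine exists_isIsolatingBasis_mul val _ _ B (letterSum_mul _) (hS (2 * a) (by omega))
        (hS (2 * a + 1) (by omega)) (fun u hu => ?_) (fun u hu v hv huv => ?_)
      · refine (letterSum_mod_lt (j := j + 1) (a := a) (e := e) hq1 hqN hu).trans_le ?_
        rw [hB]
        gcongr
        omega
      · refine hq a ha u hu v hv ?_
        exact ((letterSum_mod_modEq _ q u).symm.trans (by rw [huv])).trans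
          (letterSum_mod_modEq _ q v)

end Blocks

end

noncomputable section

/-! ## The structure of cyclic algebras -/

section CyclicStructure

open Matrix

variable {F K : Type*} [Field F] [Field K] [Algebra F K]

/-- The matrix of `∑ k < ℓ, b k * x ^ k`. -/
def cyclicMatrix (σ : K ≃ₐ[F] K) (ℓ : ℕ) (a : F) (b : ℕ → K) : Matrix (Fin ℓ) (Fin ℓ) K :=
  Matrix.of fun i j =>
    if i.val ≤ j.val then (σ ^ i.val) (b (j.val - i.val))
    else algebraMap F K a * (σ ^ i.val) (b (ℓ + j.val - i.val))

variable (σ : K ≃ₐ[F] K) (ℓ : ℕ) (a : F)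

theorem cyclicDiag_mul_cyclicMatrix (c : K) (b : ℕ → K) :
    cyclicDiag σ ℓ c * cyclicMatrix σ ℓ a b = cyclicMatrix σ ℓ a fun k => c * b k := by
  ext i j
  simp only [cyclicDiag, cyclicMatrix, Matrix.diagonal_mul, Matrix.of_apply]
  split_ifs
  · rw [map_mul]
  · rw [map_mul]
    ring

theorem cyclicX_mul_apply (Y : Matrix (Fin ℓ) (Fin ℓ) K) (i j : Fin ℓ) :
    (cyclicX K ℓ a * Y) i j =
      if h : i.val + 1 < ℓ then Y ⟨i.val + 1, h⟩ j
      else algebraMap F K a * Y ⟨0, i.pos⟩ j := by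
  rw [Matrix.mul_apply]
  split_ifs with h
  · rw [Finset.sum_eq_single ⟨i.val + 1, h⟩]
    · simp [cyclicX]
    · intro k _ hk
      have h1 : k.val ≠ i.val + 1 := fun h' => hk (Fin.ext h')
      have h2 : ¬ (i.val + 1 = ℓ ∧ k.val = 0) := by omega
      simp [cyclicX, h1, h2]
    · simp
  · have hi := i.2
    rw [Finset.sum_eq_single ⟨0, i.pos⟩]
    · have h1 : i.val + 1 = ℓ := by omega
      have h2 : ¬ 0 = i.val + 1 := by omega
      simp only [cyclicX, Matrix.of_apply]
      rw [if_neg h2, if_pos ⟨h1, trivial⟩]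
    · intro k _ hk
      have h1 : k.val ≠ i.val + 1 := by omega
      have h2 : ¬ (i.val + 1 = ℓ ∧ k.val = 0) := fun h' => hk (Fin.ext h'.2)
      simp [cyclicX, h1, h2]
    · simp

theorem mul_cyclicX_apply_succ (Y : Matrix (Fin ℓ) (Fin ℓ) K) (i j : Fin ℓ) (k : Fin ℓ)
    (hj : j.val = k.val + 1) : (Y * cyclicX K ℓ a) i j = Y i k := by
  rw [Matrix.mul_apply, Finset.sum_eq_single k]
  · simp [cyclicX, hj]
  · intro k' _ hk
    have h1 : j.val ≠ k'.val + 1 := fun h' => hk (Fin.ext (by omega))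
    have h2 : ¬ (k'.val + 1 = ℓ ∧ j.val = 0) := by omega
    simp [cyclicX, h1, h2]
  · simp

/-- Moving `x` past a coefficient applies `σ` and raises the exponent; the top term wraps around
through `x ^ ℓ = a`. -/
theorem cyclicX_mul_cyclicMatrix (hσ : σ ^ ℓ = 1) (b : ℕ → K) :
    cyclicX K ℓ a * cyclicMatrix σ ℓ a b = cyclicMatrix σ ℓ a fun k =>
      if k = 0 then algebraMap F K a * σ (b (ℓ - 1)) else σ (b (k - 1)) := by
  have hpow : ∀ (i : ℕ) (c : K), (σ ^ i) (σ c) = (σ ^ (i + 1)) c := by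
    intro i c
    rw [pow_succ, AlgEquiv.mul_apply]
  ext i j
  have hi := i.2
  have hj := j.2
  rw [cyclicX_mul_apply]
  simp only [cyclicMatrix, Matrix.of_apply]
  split_ifs with h1 h2 h3 h4 h5 h6 h7 <;>
    first
    | omega
    | (simp only [map_mul, AlgEquiv.commutes, hpow])
  · rw [show j.val - (i.val + 1) = j.val - i.val - 1 by omega]
  · rw [show ℓ + j.val - (i.val + 1) = ℓ - 1 by omega]
  · rw [show ℓ + j.val - (i.val + 1) = ℓ + j.val - i.val - 1 by omega]
  -- In the last row the shift wraps to row 0, and `σ ^ ℓ = 1` removes the twist.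
  · rw [show i.val + 1 = ℓ by omega, hσ, show j.val - 0 = ℓ - 1 by omega]
    rfl
  · rw [show i.val + 1 = ℓ by omega, hσ, show j.val - 0 = ℓ + j.val - i.val - 1 by omega]
    rfl

theorem cyclicMatrix_congr {b b' : ℕ → K} (h : ∀ k < ℓ, b k = b' k) :
    cyclicMatrix σ ℓ a b = cyclicMatrix σ ℓ a b' := by
  ext i j
  have hi := i.2
  have hj := j.2
  simp only [cyclicMatrix, Matrix.of_apply]
  split_ifs
  · rw [h _ (by omega)]
  · rw [h _ (by omega)]

/-- The coefficients in the row with index `0`. -/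
theorem cyclicMatrix_zero_apply (b : ℕ → K) (hℓ : 0 < ℓ) (j : Fin ℓ) :
    cyclicMatrix σ ℓ a b ⟨0, hℓ⟩ j = b j := by
  simp only [cyclicMatrix, Matrix.of_apply]
  rw [if_pos (Nat.zero_le _)]
  simp

theorem cyclicX_pow_eq (hσ : σ ^ ℓ = 1) (hℓ : 0 < ℓ) (k : ℕ) (hk : k < ℓ) :
    cyclicX K ℓ a ^ k = cyclicMatrix σ ℓ a fun i => if i = k then 1 else 0 := by
  induction k with
  | zero =>
    ext i j
    have hi := i.2
    have hj := j.2
    rw [pow_zero, Matrix.one_apply]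
    simp only [cyclicMatrix, Matrix.of_apply, Fin.ext_iff]
    split_ifs <;> first | omega | simp
  | succ k ih =>
    rw [pow_succ', ih (by omega), cyclicX_mul_cyclicMatrix σ ℓ a hσ]
    refine cyclicMatrix_congr σ ℓ a fun i hi => ?_
    split_ifs <;> first | omega | simp

/-- The elements `∑ k < ℓ, b k * x ^ k` as a linear map. -/
def cyclicLinear : (Fin ℓ → K) →ₗ[F] Matrix (Fin ℓ) (Fin ℓ) K where
  toFun b := cyclicMatrix σ ℓ a fun k => if h : k < ℓ then b ⟨k, h⟩ else 0
  map_add' b c := by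
    ext i j
    simp only [cyclicMatrix, Matrix.of_apply, Matrix.add_apply, Pi.add_apply]
    split_ifs <;> simp [mul_add]
  map_smul' r b := by
    ext i j
    simp only [cyclicMatrix, Matrix.of_apply, Matrix.smul_apply, Pi.smul_apply, RingHom.id_apply]
    split_ifs <;> simp

theorem cyclicLinear_apply (b : Fin ℓ → K) :
    cyclicLinear σ ℓ a b = cyclicMatrix σ ℓ a fun k => if h : k < ℓ then b ⟨k, h⟩ else 0 := rfl

theorem cyclicMatrix_mem_range (b : ℕ → K) :
    cyclicMatrix σ ℓ a b ∈ LinearMap.range (cyclicLinear σ ℓ a) := by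
  refine ⟨fun k => b k, ?_⟩
  rw [cyclicLinear_apply]
  exact cyclicMatrix_congr σ ℓ a fun k hk => by simp [hk]

theorem cyclicLinear_injective (hℓ : 0 < ℓ) : Function.Injective (cyclicLinear σ ℓ a) := by
  intro b c hbc
  funext j
  have := congrFun (congrFun hbc ⟨0, hℓ⟩) j
  simpa [cyclicLinear_apply, cyclicMatrix_zero_apply] using this

theorem cyclicMatrix_eq_sum (hσ : σ ^ ℓ = 1) (hℓ : 0 < ℓ) (b : ℕ → K) :
    cyclicMatrix σ ℓ a b = ∑ k ∈ Finset.range ℓ, cyclicDiag σ ℓ (b k) * cyclicX K ℓ a ^ k := by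
  have h1 : ∀ k ∈ Finset.range ℓ, cyclicDiag σ ℓ (b k) * cyclicX K ℓ a ^ k =
      cyclicMatrix σ ℓ a fun i => if i = k then b k else 0 := by
    intro k hk
    rw [cyclicX_pow_eq σ ℓ a hσ hℓ k (Finset.mem_range.1 hk), cyclicDiag_mul_cyclicMatrix]
    simp
  rw [Finset.sum_congr rfl h1]
  ext i j
  have hi := i.2
  have hj := j.2
  rw [Matrix.sum_apply]
  simp only [cyclicMatrix, Matrix.of_apply]
  split_ifs with h
  · rw [Finset.sum_eq_single (j.val - i.val)]
    · simp
    · intro k _ hk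
      simp [hk.symm]
    · intro hk
      exact absurd (Finset.mem_range.2 (by omega)) hk
  · rw [Finset.sum_eq_single (ℓ + j.val - i.val)]
    · simp
    · intro k _ hk
      simp [hk.symm]
    · intro hk
      exact absurd (Finset.mem_range.2 (by omega)) hk

/-- The normal forms `∑ b k * x ^ k` contain 1 and are stable under left multiplication by all
generators, so they exhaust the algebra. -/
theorem toSubmodule_cyclicAlgebra (hσ : σ ^ ℓ = 1) (hℓ : 0 < ℓ) :
    Subalgebra.toSubmodule (cyclicAlgebra σ ℓ a) = LinearMap.range (cyclicLinear σ ℓ a) := by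
  apply le_antisymm
  · rw [cyclicAlgebra, Algebra.adjoin_eq_span, Submodule.span_le]
    intro y hy
    induction hy using Submonoid.closure_induction_left with
    | one =>
      rw [← pow_zero (cyclicX K ℓ a), cyclicX_pow_eq σ ℓ a hσ hℓ 0 hℓ]
      exact cyclicMatrix_mem_range σ ℓ a _
    | mul_left x hx y _ ih =>
      obtain ⟨b, rfl⟩ := ih
      rcases hx with rfl | ⟨c, rfl⟩
      · rw [cyclicLinear_apply]
        rw [cyclicX_mul_cyclicMatrix σ ℓ a hσ]
        exact cyclicMatrix_mem_range σ ℓ a _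
      · rw [cyclicLinear_apply]
        rw [cyclicDiag_mul_cyclicMatrix]
        exact cyclicMatrix_mem_range σ ℓ a _
  · rintro _ ⟨b, rfl⟩
    rw [cyclicLinear_apply]
    rw [cyclicMatrix_eq_sum σ ℓ a hσ hℓ]
    refine Subalgebra.sum_mem _ fun k _ => Subalgebra.mul_mem _ ?_ (Subalgebra.pow_mem _ ?_ _)
    · exact (cyclicAlgebra.ofK σ ℓ a _).2
    · exact (cyclicAlgebra.x σ ℓ a).2

theorem exists_eq_cyclicMatrix (hσ : σ ^ ℓ = 1) (hℓ : 0 < ℓ) (y : cyclicAlgebra σ ℓ a) :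
    ∃ b : ℕ → K, (y : Matrix (Fin ℓ) (Fin ℓ) K) = cyclicMatrix σ ℓ a b := by
  have : (y : Matrix (Fin ℓ) (Fin ℓ) K) ∈ LinearMap.range (cyclicLinear σ ℓ a) := by
    rw [← toSubmodule_cyclicAlgebra σ ℓ a hσ hℓ]
    exact y.2
  obtain ⟨b, hb⟩ := this
  exact ⟨_, hb.symm.trans (cyclicLinear_apply σ ℓ a b)⟩

theorem finrank_cyclicAlgebra (hσ : σ ^ ℓ = 1) (hℓ : 0 < ℓ) [FiniteDimensional F K] :
    Module.finrank F (cyclicAlgebra σ ℓ a) = ℓ * Module.finrank F K := by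
  have h1 : Module.finrank F (cyclicAlgebra σ ℓ a) =
      Module.finrank F (Subalgebra.toSubmodule (cyclicAlgebra σ ℓ a)) := rfl
  rw [h1, toSubmodule_cyclicAlgebra σ ℓ a hσ hℓ,
    LinearMap.finrank_range_of_inj (cyclicLinear_injective σ ℓ a hℓ), Module.finrank_pi_fintype]
  simp

/-- For central `∑ b k * x ^ k`, commuting with `K` gives `b j * (σ ^ j c - c) = 0` for all `c`,
which kills `b j` for `0 < j < ℓ`. Commuting with `x` makes `b 0` fixed by `σ`, hence an element of
`F`. -/
theorem isCentral_cyclicAlgebra [IsGalois F K] [FiniteDimensional F K] (hσ : orderOf σ = ℓ)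
    (hℓ : 1 < ℓ) (hgen : ∀ τ : K ≃ₐ[F] K, τ ∈ Subgroup.zpowers σ) :
    Algebra.IsCentral F (cyclicAlgebra σ ℓ a) := by
  have hσℓ : σ ^ ℓ = 1 := hσ ▸ pow_orderOf_eq_one σ
  have hℓ0 : 0 < ℓ := by omega
  refine ⟨fun y hy => ?_⟩
  obtain ⟨b, hb⟩ := exists_eq_cyclicMatrix σ ℓ a hσℓ hℓ0 y
  rw [Subalgebra.mem_center_iff] at hy
  have hb0 : ∀ j, 0 < j → j < ℓ → b j = 0 := by
    intro j hj0 hj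
    have hne : σ ^ j ≠ 1 := fun h => by
      have := orderOf_le_of_pow_eq_one hj0 h
      omega
    obtain ⟨c, hc⟩ : ∃ c, (σ ^ j) c ≠ c := by
      by_contra hcon
      push Not at hcon
      exact hne (AlgEquiv.ext hcon)
    have h1 := congrArg (fun w : cyclicAlgebra σ ℓ a => (w : Matrix (Fin ℓ) (Fin ℓ) K) ⟨0, hℓ0⟩
      ⟨j, hj⟩) (hy (cyclicAlgebra.ofK σ ℓ a c))
    simp only [MulMemClass.coe_mul, hb, cyclicAlgebra.ofK, cyclicDiag, Matrix.diagonal_mul,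
      Matrix.mul_diagonal, cyclicMatrix_zero_apply, pow_zero] at h1
    have h2 : b j * ((σ ^ j) c - c) = 0 := by
      rw [mul_sub, ← h1]
      simp [mul_comm]
    exact (mul_eq_zero.1 h2).resolve_right (sub_ne_zero.2 hc)
  have hfix : σ (b 0) = b 0 := by
    have h1 := congrArg (fun w : cyclicAlgebra σ ℓ a => (w : Matrix (Fin ℓ) (Fin ℓ) K) ⟨0, hℓ0⟩
      ⟨1, hℓ⟩) (hy (cyclicAlgebra.x σ ℓ a))
    simp only [MulMemClass.coe_mul, hb, cyclicAlgebra.x] at h1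
    rw [cyclicX_mul_apply, mul_cyclicX_apply_succ ℓ a _ _ _ ⟨0, hℓ0⟩ rfl, dif_pos hℓ] at h1
    simpa [cyclicMatrix] using h1
  have hmem : b 0 ∈ (⊥ : IntermediateField F K) := by
    rw [IsGalois.mem_bot_iff_fixed]
    intro τ
    obtain ⟨k, rfl⟩ := Subgroup.mem_zpowers_iff.1 (hgen τ)
    exact smul_eq_self_of_mem_zpowers (α := K) (x := σ ^ k) (y := σ)
      (Subgroup.zpow_mem_zpowers σ k) hfix
  obtain ⟨c, hc⟩ := IntermediateField.mem_bot.1 hmem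
  refine Algebra.mem_bot.2 ⟨c, Subtype.ext ?_⟩
  rw [hb]
  ext i j
  have hi := i.2
  have hj := j.2
  simp only [Subalgebra.coe_algebraMap, Matrix.algebraMap_matrix_apply, cyclicMatrix,
    Matrix.of_apply, Fin.ext_iff]
  split_ifs with h1 h2 h3
  · rw [h1, Nat.sub_self, ← hc, AlgEquiv.commutes]
  · omega
  · rw [hb0 _ (by omega) (by omega), map_zero]
  · rw [hb0 _ (by omega) (by omega), map_zero, mul_zero]

end CyclicStructure

end

noncomputable section

/-! ## Zero divisors in cyclic algebras over rational function fields -/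

section Division

open Polynomial

theorem sum_ne_zero_of_dominant {ι R : Type*} [CommRing R] (s : Finset ι) (t : ι → R[X]) (i₀ : ι)
    (hi₀ : i₀ ∈ s) (h0 : t i₀ ≠ 0)
    (hlt : ∀ i ∈ s, i ≠ i₀ → t i ≠ 0 → (t i).natDegree < (t i₀).natDegree) :
    ∑ i ∈ s, t i ≠ 0 := by
  intro hsum
  have h1 := congrArg (fun q => q.coeff (t i₀).natDegree) hsum
  simp only [finsetSum_coeff, coeff_zero] at h1
  rw [Finset.sum_eq_single i₀] at h1
  · exact h0 (leadingCoeff_eq_zero.1 h1)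
  · intro i hi hne
    by_cases h : t i = 0
    · simp [h]
    · exact coeff_eq_zero_of_natDegree_lt (hlt i hi hne h)
  · exact fun h => absurd hi₀ h

/-- The term with index `(i, j)` in the product of the matrix of a twisted polynomial with a
vector of polynomials. -/
def twistedTerm {K : Type*} [Field K] (f : ℕ → K →+* K) (ℓ : ℕ) (p u : ℕ → K[X]) (i j : ℕ) : K[X] :=
  if i ≤ j then (p (j - i)).map (f i) * u j else X * (p (ℓ + j - i)).map (f i) * u j

theorem twistedTerm_ne_zero_iff {K : Type*} [Field K] (f : ℕ → K →+* K) (ℓ : ℕ) (p u : ℕ → K[X])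
    (i j : ℕ) : twistedTerm f ℓ p u i j ≠ 0 ↔
      p (if i ≤ j then j - i else ℓ + j - i) ≠ 0 ∧ u j ≠ 0 := by
  unfold twistedTerm
  split_ifs <;> simp [Polynomial.map_eq_zero]

/-- The grading with `z` of degree `ℓ` and `x` of degree 1. If `k` is the index at which `p` is
used, then `ℓ` times the degree of the term is `(ℓ * deg (p k) + k) + (ℓ * deg (u j) - j) + i`; the
form chosen avoids subtracting `j`. -/
theorem natDegree_twistedTerm {K : Type*} [Field K] (f : ℕ → K →+* K) {ℓ : ℕ} {p u : ℕ → K[X]}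
    {i j : ℕ} (hi : i < ℓ) (h : twistedTerm f ℓ p u i j ≠ 0) :
    ℓ * (twistedTerm f ℓ p u i j).natDegree + i + j =
      (ℓ * (p (if i ≤ j then j - i else ℓ + j - i)).natDegree +
        (if i ≤ j then j - i else ℓ + j - i)) + ℓ * (u j).natDegree + 2 * i := by
  rw [twistedTerm_ne_zero_iff] at h
  unfold twistedTerm
  split_ifs at h ⊢ with hij
  · rw [natDegree_mul (by simpa [Polynomial.map_eq_zero] using h.1) h.2, natDegree_map, mul_add]
    omega
  · rw [natDegree_mul (by simpa [Polynomial.map_eq_zero] using h.1) h.2, natDegree_X_mul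
      (by simpa [Polynomial.map_eq_zero] using h.1), natDegree_map, mul_add, mul_add, mul_one]
    omega

/-- Let `k₀` maximise `ℓ * deg (p k) + k` and `j₀` maximise `ℓ * deg (u j) - j`, shifted by `ℓ` to
stay in the naturals. In the row `i ≡ j₀ - k₀` modulo `ℓ` the term at `j₀` uses `p k₀` and strictly
dominates. -/
theorem exists_sum_twistedTerm_ne_zero {K : Type*} [Field K] (f : ℕ → K →+* K) {ℓ : ℕ}
    {p u : ℕ → K[X]} (hp : ∃ k < ℓ, p k ≠ 0) (hu : ∃ j < ℓ, u j ≠ 0) :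
    ∃ i < ℓ, ∑ j ∈ Finset.range ℓ, twistedTerm f ℓ p u i j ≠ 0 := by
  classical
  obtain ⟨k₀, hk₀, hkmax⟩ := ((Finset.range ℓ).filter fun k => p k ≠ 0).exists_max_image
    (fun k => ℓ * (p k).natDegree + k)
    (by obtain ⟨k, hk, h⟩ := hp; exact ⟨k, by simp [hk, h]⟩)
  obtain ⟨j₀, hj₀, hjmax⟩ := ((Finset.range ℓ).filter fun j => u j ≠ 0).exists_max_image
    (fun j => ℓ * (u j).natDegree + (ℓ - j))
    (by obtain ⟨k, hk, h⟩ := hu; exact ⟨k, by simp [hk, h]⟩)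
  simp only [Finset.mem_filter, Finset.mem_range] at hk₀ hj₀ hkmax hjmax
  set i := if k₀ ≤ j₀ then j₀ - k₀ else ℓ + j₀ - k₀ with hi
  have hiℓ : i < ℓ := by
    rw [hi]
    split_ifs <;> omega
  have hk : (if i ≤ j₀ then j₀ - i else ℓ + j₀ - i) = k₀ := by
    rw [hi]
    split_ifs <;> omega
  have hne : twistedTerm f ℓ p u i j₀ ≠ 0 := by
    rw [twistedTerm_ne_zero_iff, hk]
    exact ⟨hk₀.2, hj₀.2⟩
  refine ⟨i, hiℓ, sum_ne_zero_of_dominant _ _ j₀ (Finset.mem_range.2 hj₀.1) hne ?_⟩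
  intro j hj hjne hjt
  rw [Finset.mem_range] at hj
  have e0 := natDegree_twistedTerm f hiℓ hne
  have e1 := natDegree_twistedTerm f hiℓ hjt
  rw [hk] at e0
  rw [twistedTerm_ne_zero_iff] at hjt
  have hkℓ : (if i ≤ j then j - i else ℓ + j - i) < ℓ := by split_ifs <;> omega
  have m1 := hkmax _ ⟨hkℓ, hjt.1⟩
  have m2 := hjmax j ⟨hj, hjt.2⟩
  -- The maximiser `j₀` is unique, because the scores are distinct modulo `ℓ`.
  have m3 : ℓ * (u j).natDegree + (ℓ - j) ≠ ℓ * (u j₀).natDegree + (ℓ - j₀) := by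
    intro h
    apply hjne
    have h' : (ℓ * (u j).natDegree + (ℓ - 1 - j)) % ℓ =
        (ℓ * (u j₀).natDegree + (ℓ - 1 - j₀)) % ℓ := by congr 1; omega
    rw [Nat.mul_add_mod, Nat.mul_add_mod, Nat.mod_eq_of_lt (by omega),
      Nat.mod_eq_of_lt (by omega)] at h'
    omega
  have : ℓ * (twistedTerm f ℓ p u i j).natDegree < ℓ * (twistedTerm f ℓ p u i j₀).natDegree := by
    omega
  exact Nat.lt_of_mul_lt_mul_left this

variable {F K : Type*} [Field F] [Field K] [Algebra F K]

/-- A ring of polynomials over `K`, stable under `σ`, on which the evaluation at `a` is injective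
and such that `K` is the field of fractions of its image. -/
structure IsPolynomialModel (σ : K ≃ₐ[F] K) (a : F) (𝓛 : Subsemiring K[X]) : Prop where
  X_mem : (X : K[X]) ∈ 𝓛
  map_mem : ∀ p ∈ 𝓛, p.map (σ : K →+* K) ∈ 𝓛
  eq_zero : ∀ p ∈ 𝓛, p.eval (algebraMap F K a) = 0 → p = 0
  exists_eq : ∀ b : K, ∃ q ∈ 𝓛, q ≠ 0 ∧ ∃ p ∈ 𝓛,
    q.eval (algebraMap F K a) * b = p.eval (algebraMap F K a)

variable {σ : K ≃ₐ[F] K} {a : F} {𝓛 : Subsemiring K[X]}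

theorem IsPolynomialModel.exists_common (h : IsPolynomialModel σ a 𝓛) (b : ℕ → K) (k : ℕ) :
    ∃ q ∈ 𝓛, q ≠ 0 ∧ ∃ p : ℕ → K[X], ∀ j < k, p j ∈ 𝓛 ∧
      q.eval (algebraMap F K a) * b j = (p j).eval (algebraMap F K a) := by
  induction k with
  | zero => exact ⟨1, one_mem _, one_ne_zero, fun _ => 0, by simp⟩
  | succ k ih =>
    obtain ⟨q, hq, hq0, p, hp⟩ := ih
    obtain ⟨q', hq', hq0', p', hp', he⟩ := h.exists_eq (b k)
    refine ⟨q * q', mul_mem hq hq', mul_ne_zero hq0 hq0',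
      fun j => if j < k then p j * q' else q * p', fun j hj => ?_⟩
    by_cases hjk : j < k
    · simp only [hjk, if_true, eval_mul]
      refine ⟨mul_mem (hp j hjk).1 hq', ?_⟩
      rw [← (hp j hjk).2]
      ring
    · obtain rfl : j = k := by omega
      simp only [lt_irrefl, if_false, eval_mul]
      exact ⟨mul_mem hq hp', by rw [← he]; ring⟩

theorem IsPolynomialModel.map_pow_mem (h : IsPolynomialModel σ a 𝓛) {p : K[X]} (hp : p ∈ 𝓛)
    (i : ℕ) : p.map ((σ ^ i : K ≃ₐ[F] K) : K →+* K) ∈ 𝓛 := by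
  induction i with
  | zero =>
    have : ((σ ^ 0 : K ≃ₐ[F] K) : K →+* K) = RingHom.id K := rfl
    rwa [this, Polynomial.map_id]
  | succ i ih =>
    have : ((σ ^ (i + 1) : K ≃ₐ[F] K) : K →+* K) =
        (σ : K →+* K).comp ((σ ^ i : K ≃ₐ[F] K) : K →+* K) := by
      rw [pow_succ']
      rfl
    rw [this, ← Polynomial.map_map]
    exact h.map_mem _ ih

theorem eval_map_algEquiv (τ : K ≃ₐ[F] K) (p : K[X]) :
    (p.map (τ : K →+* K)).eval (algebraMap F K a) = τ (p.eval (algebraMap F K a)) := by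
  have h : (τ : K →+* K) (algebraMap F K a) = algebraMap F K a := τ.commutes a
  rw [eval_map, ← h, eval₂_at_apply]
  rw [h]
  rfl

/-- Clearing denominators in the coefficients and in the vector turns each row of the product, up to
these denominators, into the value at `a` of a sum of `twistedTerm`s. Some such sum is a nonzero
polynomial in `𝓛`, where evaluation at `a` is injective. -/
theorem IsPolynomialModel.mulVec_ne_zero (h : IsPolynomialModel σ a 𝓛) {ℓ : ℕ}
    {b u : ℕ → K} (hb : ∃ k < ℓ, b k ≠ 0) (hu : ∃ j < ℓ, u j ≠ 0) :
    (cyclicMatrix σ ℓ a b).mulVec (fun j => u j) ≠ 0 := by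
  intro hzero
  obtain ⟨q, hq, hq0, p, hp⟩ := h.exists_common b ℓ
  obtain ⟨q', hq', hq0', v, hv⟩ := h.exists_common u ℓ
  have hqe : q.eval (algebraMap F K a) ≠ 0 := fun h0 => hq0 (h.eq_zero q hq h0)
  have hqe' : q'.eval (algebraMap F K a) ≠ 0 := fun h0 => hq0' (h.eq_zero q' hq' h0)
  obtain ⟨i, hi, hne⟩ := exists_sum_twistedTerm_ne_zero
    (fun i => ((σ ^ i : K ≃ₐ[F] K) : K →+* K)) (ℓ := ℓ) (p := p) (u := v)
    (by
      obtain ⟨k, hk, hbk⟩ := hb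
      refine ⟨k, hk, fun h0 => ?_⟩
      have := (hp k hk).2
      rw [h0, eval_zero] at this
      exact (mul_ne_zero hqe hbk) this)
    (by
      obtain ⟨k, hk, huk⟩ := hu
      refine ⟨k, hk, fun h0 => ?_⟩
      have := (hv k hk).2
      rw [h0, eval_zero] at this
      exact (mul_ne_zero hqe' huk) this)
  refine hne (h.eq_zero _ (Subsemiring.sum_mem _ fun j hj => ?_) ?_)
  · have hj := Finset.mem_range.1 hj
    unfold twistedTerm
    split_ifs
    · exact mul_mem (h.map_pow_mem (hp _ (by omega)).1 i) (hv j hj).1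
    · exact mul_mem (mul_mem h.X_mem (h.map_pow_mem (hp _ (by omega)).1 i)) (hv j hj).1
  · have hrow := congrFun hzero ⟨i, hi⟩
    simp only [Matrix.mulVec, dotProduct, Pi.zero_apply, cyclicMatrix, Matrix.of_apply] at hrow
    rw [Fin.sum_univ_eq_sum_range (fun j => (if i ≤ j then (σ ^ i) (b (j - i))
      else algebraMap F K a * (σ ^ i) (b (ℓ + j - i))) * u j) ℓ] at hrow
    rw [eval_finsetSum]
    have : ∑ j ∈ Finset.range ℓ, eval (algebraMap F K a)
        (twistedTerm (fun i => ((σ ^ i : K ≃ₐ[F] K) : K →+* K)) ℓ p v i j) =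
        (σ ^ i) (q.eval (algebraMap F K a)) * q'.eval (algebraMap F K a) *
        ∑ j ∈ Finset.range ℓ, (if i ≤ j then (σ ^ i) (b (j - i))
          else algebraMap F K a * (σ ^ i) (b (ℓ + j - i))) * u j := by
      rw [Finset.mul_sum]
      refine Finset.sum_congr rfl fun j hj => ?_
      have hj := Finset.mem_range.1 hj
      unfold twistedTerm
      split_ifs
      · rw [eval_mul, eval_map_algEquiv, ← (hp _ (by omega)).2, ← (hv j hj).2, map_mul]
        ring
      · rw [eval_mul, eval_mul, eval_map_algEquiv, ← (hp _ (by omega)).2, ← (hv j hj).2, map_mul,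
          eval_X]
        ring
    rw [this, hrow, mul_zero]

theorem IsPolynomialModel.isDomain (h : IsPolynomialModel σ a 𝓛) {ℓ : ℕ} (hℓ : 0 < ℓ)
    (hσ : σ ^ ℓ = 1) : IsDomain (cyclicAlgebra σ ℓ a) := by
  have : Nonempty (Fin ℓ) := ⟨⟨0, hℓ⟩⟩
  have : NoZeroDivisors (cyclicAlgebra σ ℓ a) := by
    refine ⟨fun {y w} hyw => ?_⟩
    by_contra hcon
    push Not at hcon
    obtain ⟨hy, hw⟩ := hcon
    obtain ⟨b, hb⟩ := exists_eq_cyclicMatrix σ ℓ a hσ hℓ y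
    have hb0 : ∃ k < ℓ, b k ≠ 0 := by
      by_contra hall
      push Not at hall
      apply hy
      apply Subtype.ext
      rw [hb, cyclicMatrix_congr σ ℓ a hall]
      ext i j
      simp [cyclicMatrix]
    obtain ⟨i, j, hij⟩ : ∃ i j, (w : Matrix (Fin ℓ) (Fin ℓ) K) i j ≠ 0 := by
      by_contra hall
      push Not at hall
      apply hw
      apply Subtype.ext
      ext i j
      simpa using hall i j
    -- The vector is a nonzero column of `w`, which `y` would annihilate.
    refine h.mulVec_ne_zero (ℓ := ℓ) (b := b)
      (u := fun k => if hk : k < ℓ then (w : Matrix (Fin ℓ) (Fin ℓ) K) ⟨k, hk⟩ j else 0) hb0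
      ⟨i, i.2, by simpa using hij⟩ ?_
    funext k
    have := congrArg (fun y : cyclicAlgebra σ ℓ a => (y : Matrix (Fin ℓ) (Fin ℓ) K) k j) hyw
    simp only [MulMemClass.coe_mul, hb, Matrix.mul_apply] at this
    simpa [Matrix.mulVec, dotProduct] using this
  exact NoZeroDivisors.to_isDomain _

/-- In a finite-dimensional domain every nonzero element has a one-sided inverse, and cancellation
makes it two-sided. -/
theorem IsPolynomialModel.isCyclicDivisionAlgebra (h : IsPolynomialModel σ a 𝓛) {ℓ : ℕ}
    (hℓ : 1 < ℓ) (hσ : orderOf σ = ℓ) [IsGalois F K] (hK : Module.finrank F K = ℓ)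
    (hgen : ∀ τ : K ≃ₐ[F] K, τ ∈ Subgroup.zpowers σ) : IsCyclicDivisionAlgebra σ ℓ a := by
  have hσℓ : σ ^ ℓ = 1 := hσ ▸ pow_orderOf_eq_one σ
  have : FiniteDimensional F K := Module.finite_of_finrank_pos (by omega)
  have hfin : Module.finrank F (cyclicAlgebra σ ℓ a) = ℓ ^ 2 := by
    rw [finrank_cyclicAlgebra σ ℓ a hσℓ (by omega), hK, pow_two]
  have := h.isDomain (by omega) hσℓ
  refine ⟨inferInstance, hK, hgen, isCentral_cyclicAlgebra σ ℓ a hσ hℓ hgen, hfin, by omega,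
    fun y hy => ?_⟩
  have : FiniteDimensional F (cyclicAlgebra σ ℓ a) :=
    Module.finite_of_finrank_pos (by rw [hfin]; positivity)
  obtain ⟨w, hw⟩ := FiniteDimensional.exists_mul_eq_one F hy
  refine ⟨⟨y, w, hw, ?_⟩, rfl⟩
  have : y * (w * y - 1) = 0 := by rw [mul_sub, ← mul_assoc, hw, one_mul, mul_one, sub_self]
  exact sub_eq_zero.1 ((mul_eq_zero.1 this).resolve_left hy)

end Division

end

noncomputable section

/-! ## The cyclotomic extension of `ℚ(z)` of order `3 ^ (h + 1)` -/

section Cyclotomic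

open Polynomial

/-- Setting `z = 0` gives the cyclotomic polynomial over `ℚ`, so the monic polynomial over `ℚ[z]` is
irreducible; Gauss's lemma passes to `ℚ(z)`. -/
theorem irreducible_cyclotomic_ratZ {m : ℕ} (hm : 0 < m) : Irreducible (cyclotomic m RatZ) := by
  have h1 : Irreducible (cyclotomic m ℚ[X]) := by
    refine (cyclotomic.monic m ℚ[X]).irreducible_of_irreducible_map (evalRingHom (0 : ℚ)) _ ?_
    rw [map_cyclotomic]
    exact cyclotomic.irreducible_rat hm
  rw [(cyclotomic.monic m ℚ[X]).irreducible_iff_irreducible_map_fraction_map (K := RatZ),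
    map_cyclotomic] at h1
  exact h1

/-- The element `4 = 1 + 3` has order `3 ^ h`, so 2 has order `3 ^ h` or twice that. An odd power of
2 is `-1` modulo 3, which excludes the first case. -/
theorem orderOf_two_zmod_three_pow (h : ℕ) : orderOf (2 : ZMod (3 ^ (h + 1))) = 2 * 3 ^ h := by
  have h4 : orderOf ((2 : ZMod (3 ^ (h + 1))) ^ 2) = 3 ^ h := by
    rw [← ZMod.orderOf_one_add_prime Nat.prime_three (by norm_num) h]
    norm_num
  have hodd : ¬ (2 : ZMod (3 ^ (h + 1))) ^ 3 ^ h = 1 := by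
    intro hcon
    have h3 := congrArg (ZMod.castHom (dvd_pow_self 3 (Nat.succ_ne_zero h)) (ZMod 3)) hcon
    rw [map_pow, map_ofNat, map_one] at h3
    have h2 : (2 : ZMod 3) = -1 := by decide
    rw [h2, Odd.neg_one_pow (Odd.pow (by decide))] at h3
    exact absurd h3 (by decide)
  have hd1 : orderOf (2 : ZMod (3 ^ (h + 1))) ∣ 2 * 3 ^ h := by
    rw [orderOf_dvd_iff_pow_eq_one, pow_mul, ← h4, pow_orderOf_eq_one]
  have hd2 : 3 ^ h ∣ orderOf (2 : ZMod (3 ^ (h + 1))) := by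
    rw [← h4]
    exact orderOf_pow_dvd 2
  obtain ⟨c, hc⟩ := hd2
  rw [hc, mul_comm 2] at hd1
  have hc2 : c ∣ 2 := Nat.dvd_of_mul_dvd_mul_left (by positivity) hd1
  rcases (Nat.dvd_prime Nat.prime_two).1 hc2 with rfl | rfl
  · rw [mul_one] at hc
    exact absurd (hc ▸ pow_orderOf_eq_one (2 : ZMod (3 ^ (h + 1)))) hodd
  · rw [hc, mul_comm]

theorem totient_three_pow (h : ℕ) : Nat.totient (3 ^ (h + 1)) = 2 * 3 ^ h := by
  rw [Nat.totient_prime_pow_succ Nat.prime_three, mul_comm]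

theorem finrank_ratZOmega (h : ℕ) : Module.finrank RatZ (RatZOmega (3 ^ (h + 1))) = 2 * 3 ^ h := by
  rw [IsCyclotomicExtension.finrank (n := 3 ^ (h + 1)) (RatZOmega (3 ^ (h + 1)))
    (irreducible_cyclotomic_ratZ (by positivity)), totient_three_pow]

instance isGalois_ratZOmega (h : ℕ) : IsGalois RatZ (RatZOmega (3 ^ (h + 1))) :=
  IsCyclotomicExtension.isGalois {3 ^ (h + 1)} RatZ (RatZOmega (3 ^ (h + 1)))

/-- A primitive root of unity of order `3 ^ (h + 1)`. -/
def omega (h : ℕ) : RatZOmega (3 ^ (h + 1)) :=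
  IsCyclotomicExtension.zeta (3 ^ (h + 1)) RatZ (RatZOmega (3 ^ (h + 1)))

theorem isPrimitiveRoot_omega (h : ℕ) : IsPrimitiveRoot (omega h) (3 ^ (h + 1)) :=
  IsCyclotomicExtension.zeta_spec (3 ^ (h + 1)) RatZ (RatZOmega (3 ^ (h + 1)))

theorem isPrimitiveRoot_omega_sq (h : ℕ) : IsPrimitiveRoot (omega h ^ 2) (3 ^ (h + 1)) :=
  (isPrimitiveRoot_omega h).pow_of_coprime 2 (Nat.Coprime.pow_right _ (by decide))

/-- The automorphism that squares the primitive root of unity. -/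
def sigma (h : ℕ) : RatZOmega (3 ^ (h + 1)) ≃ₐ[RatZ] RatZOmega (3 ^ (h + 1)) :=
  IsCyclotomicExtension.fromZetaAut (isPrimitiveRoot_omega_sq h)
    (irreducible_cyclotomic_ratZ (by positivity))

theorem sigma_omega (h : ℕ) : sigma h (omega h) = omega h ^ 2 :=
  IsCyclotomicExtension.fromZetaAut_spec _ _

theorem sigma_pow_omega (h j : ℕ) : (sigma h ^ j) (omega h) = omega h ^ 2 ^ j := by
  induction j with
  | zero => simp
  | succ j ih =>
    rw [pow_succ' (sigma h) j, AlgEquiv.mul_apply, ih, map_pow, sigma_omega, ← pow_mul, pow_succ' 2 j]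

theorem IsPrimitiveRoot.pow_eq_pow_iff_modEq' {K : Type*} [Field K] {ω : K} {m : ℕ}
    (hω : IsPrimitiveRoot ω m) (hm : m ≠ 0) {i j : ℕ} : ω ^ i = ω ^ j ↔ i ≡ j [MOD m] := by
  obtain ⟨u, hu⟩ := hω.isUnit hm
  rw [hω.eq_orderOf, ← hu, orderOf_units, ← pow_eq_pow_iff_modEq]
  norm_cast

theorem orderOf_sigma (h : ℕ) : orderOf (sigma h) = 2 * 3 ^ h := by
  rw [← orderOf_two_zmod_three_pow]
  refine orderOf_eq_orderOf_iff.2 fun j => ?_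
  have hω := isPrimitiveRoot_omega h
  have h1 : sigma h ^ j = 1 ↔ omega h ^ 2 ^ j = omega h := by
    constructor
    · intro h'
      rw [← sigma_pow_omega, h']
      rfl
    · intro h'
      apply AlgEquiv.coe_toAlgHom_injective
      apply (hω.powerBasis RatZ).algHom_ext
      simp [IsPrimitiveRoot.powerBasis_gen, sigma_pow_omega, h']
  have h2 : (2 : ZMod (3 ^ (h + 1))) ^ j = 1 ↔ 2 ^ j ≡ 1 [MOD 3 ^ (h + 1)] := by
    rw [← ZMod.natCast_eq_natCast_iff]
    push_cast
    rfl
  rw [h1, h2]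
  nth_rewrite 2 [← pow_one (omega h)]
  exact hω.pow_eq_pow_iff_modEq' (by positivity)

theorem mem_zpowers_sigma (h : ℕ) (τ : RatZOmega (3 ^ (h + 1)) ≃ₐ[RatZ] RatZOmega (3 ^ (h + 1))) :
    τ ∈ Subgroup.zpowers (sigma h) := by
  have : FiniteDimensional RatZ (RatZOmega (3 ^ (h + 1))) :=
    Module.finite_of_finrank_pos (by rw [finrank_ratZOmega]; positivity)
  have h1 : Nat.card (Subgroup.zpowers (sigma h)) =
      Nat.card (RatZOmega (3 ^ (h + 1)) ≃ₐ[RatZ] RatZOmega (3 ^ (h + 1))) := by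
    rw [Nat.card_zpowers, orderOf_sigma, IsGalois.card_aut_eq_finrank, finrank_ratZOmega]
  rw [Subgroup.eq_top_of_card_eq _ h1]
  trivial

/-- The polynomials whose coefficients are algebraic over `ℚ`. -/
def algebraicPolys (h : ℕ) : Subsemiring (RatZOmega (3 ^ (h + 1)))[X] :=
  Polynomial.lifts (algebraMap (algebraicClosure ℚ (RatZOmega (3 ^ (h + 1))))
    (RatZOmega (3 ^ (h + 1))))

theorem mem_algebraicPolys_iff {h : ℕ} {p : (RatZOmega (3 ^ (h + 1)))[X]} :
    p ∈ algebraicPolys h ↔ ∀ k, IsAlgebraic ℚ (p.coeff k) := by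
  rw [algebraicPolys, Polynomial.lifts_iff_coeff_lifts]
  refine forall_congr' fun k => ?_
  rw [← mem_algebraicClosure_iff]
  constructor
  · rintro ⟨y, hy⟩
    rw [← hy]
    exact y.2
  · exact fun hy => ⟨⟨_, hy⟩, rfl⟩

theorem C_mem_algebraicPolys {h : ℕ} {c : RatZOmega (3 ^ (h + 1))} (hc : IsAlgebraic ℚ c) :
    C c ∈ algebraicPolys h := by
  rw [mem_algebraicPolys_iff]
  intro k
  rw [coeff_C]
  split_ifs
  · exact hc
  · exact isAlgebraic_zero

theorem isAlgebraic_omega (h : ℕ) : IsAlgebraic ℚ (omega h) := by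
  refine ⟨X ^ (3 ^ (h + 1)) - 1, ?_, ?_⟩
  · exact X_pow_sub_C_ne_zero (by positivity) 1
  · simp [(isPrimitiveRoot_omega h).pow_eq_one]

/-- The indeterminate `z` as an element of `ℚ(z, ω)`. -/
def zElem (h : ℕ) : RatZOmega (3 ^ (h + 1)) := algebraMap RatZ _ RatFunc.X

theorem transcendental_zElem (h : ℕ) : Transcendental ℚ (zElem h) := by
  rw [zElem, transcendental_algebraMap_iff (R := ℚ) (S := RatZ) (A := RatZOmega (3 ^ (h + 1)))
    (algebraMap RatZ (RatZOmega (3 ^ (h + 1)))).injective]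
  convert! RatFunc.transcendental_X (K := ℚ)
  exact Subsingleton.elim _ _

/-- A transcendental over `ℚ` stays transcendental over the algebraic closure of `ℚ` in the field.
-/
theorem eq_zero_of_eval_zElem {h : ℕ} {p : (RatZOmega (3 ^ (h + 1)))[X]}
    (hp : p ∈ algebraicPolys h) (h0 : p.eval (zElem h) = 0) : p = 0 := by
  obtain ⟨q, rfl⟩ := (Polynomial.mem_lifts p).1 hp
  have ht := (transcendental_zElem h).algebraicClosure
  rw [transcendental_iff] at ht
  rw [ht q (by rwa [aeval_def, ← eval_map]), Polynomial.map_zero]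

/-- Automorphisms preserve algebraicity over `ℚ`. As `ω` is algebraic and generates the field as a
ring over `ℚ(z)`, denominators arise only from `ℚ[z]`, and no inverses have to be handled in the
induction. -/
theorem isPolynomialModel_algebraicPolys (h : ℕ) :
    IsPolynomialModel (sigma h) RatFunc.X (algebraicPolys h) where
  X_mem := Polynomial.X_mem_lifts _
  map_mem p hp := by
    rw [mem_algebraicPolys_iff] at hp ⊢
    intro k
    rw [coeff_map]
    exact IsAlgebraic.algHom
      ((sigma h : RatZOmega (3 ^ (h + 1)) →+* RatZOmega (3 ^ (h + 1))).toRatAlgHom) (hp k)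
  eq_zero p hp h0 := eq_zero_of_eval_zElem hp h0
  exists_eq b := by
    have hpoly : ∀ q : ℚ[X], q.map (algebraMap ℚ _) ∈ algebraicPolys h ∧
        (q.map (algebraMap ℚ _)).eval (zElem h) = algebraMap RatZ _ (algebraMap ℚ[X] RatZ q) := by
      intro q
      constructor
      · rw [mem_algebraicPolys_iff]
        intro k
        rw [coeff_map]
        exact isAlgebraic_algebraMap _
      · rw [zElem, ← RatFunc.algebraMap_X]
        rw [eval_map, ← aeval_def, aeval_algebraMap_apply, aeval_algebraMap_apply, aeval_X_left_apply]
    have hb : b ∈ Algebra.adjoin RatZ {omega h} := by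
      rw [IsCyclotomicExtension.adjoin_primitive_root_eq_top (isPrimitiveRoot_omega h)]
      trivial
    have hzne : ∀ q : (RatZOmega (3 ^ (h + 1)))[X], q ∈ algebraicPolys h → q ≠ 0 →
        q.eval (zElem h) ≠ 0 := fun q hq hq0 h0 => hq0 (eq_zero_of_eval_zElem hq h0)
    change ∃ q ∈ algebraicPolys h, q ≠ 0 ∧ ∃ p ∈ algebraicPolys h,
      q.eval (zElem h) * b = p.eval (zElem h)
    induction hb using Algebra.adjoin_induction with
    | mem x hx =>
      rw [Set.mem_singleton_iff.1 hx]
      exact ⟨1, one_mem _, one_ne_zero, C (omega h), C_mem_algebraicPolys (isAlgebraic_omega h),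
        by simp⟩
    | algebraMap r =>
      refine ⟨_, (hpoly r.denom).1, ?_, _, (hpoly r.num).1, ?_⟩
      · rw [Polynomial.map_ne_zero_iff (algebraMap ℚ _).injective]
        exact r.denom_ne_zero
      · rw [(hpoly _).2, (hpoly _).2, ← map_mul]
        congr 1
        have := RatFunc.num_div_denom r
        have hd : algebraMap ℚ[X] RatZ r.denom ≠ 0 := RatFunc.algebraMap_ne_zero r.denom_ne_zero
        nth_rewrite 2 [← this]
        field_simp
    | add x y _ _ hx hy =>
      obtain ⟨q, hq, hq0, p, hp, he⟩ := hx
      obtain ⟨q', hq', hq0', p', hp', he'⟩ := hy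
      refine ⟨q * q', mul_mem hq hq', mul_ne_zero hq0 hq0', p * q' + q * p',
        add_mem (mul_mem hp hq') (mul_mem hq hp'), ?_⟩
      simp only [eval_mul, eval_add, ← he, ← he']
      ring
    | mul x y _ _ hx hy =>
      obtain ⟨q, hq, hq0, p, hp, he⟩ := hx
      obtain ⟨q', hq', hq0', p', hp', he'⟩ := hy
      refine ⟨q * q', mul_mem hq hq', mul_ne_zero hq0 hq0', p * p', mul_mem hp hp', ?_⟩
      simp only [eval_mul, ← he, ← he']
      ring

theorem isCyclicDivisionAlgebra_sigma (h : ℕ) :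
    IsCyclicDivisionAlgebra (sigma h) (2 * 3 ^ h) (RatFunc.X : RatZ) :=
  (isPolynomialModel_algebraicPolys h).isCyclicDivisionAlgebra
    (by have : 0 < 3 ^ h := by positivity
        omega)
    (orderOf_sigma h) (finrank_ratZOmega h) (mem_zpowers_sigma h)

end Cyclotomic

end

noncomputable section

/-! ## Coefficients of polynomials computed by branching programs -/

section Words

variable {n : ℕ}

/-- The coefficients of a noncommutative polynomial, as a function of the word. -/
def wordCoeff (n : ℕ) : FreeAlgebra ℚ (Fin n) →ₗ[ℚ] (List (Fin n) → ℚ) where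
  toFun f w := (FreeAlgebra.equivMonoidAlgebraFreeMonoid f).coeff (FreeMonoid.ofList w)
  map_add' f g := by
    funext w
    simp
  map_smul' c f := by
    funext w
    simp

/-- The derivative of a function on words: strip a leading letter. -/
def wordDeriv (i : Fin n) : (List (Fin n) → ℚ) →ₗ[ℚ] (List (Fin n) → ℚ) :=
  LinearMap.funLeft ℚ ℚ (List.cons i)

theorem wordDeriv_apply (i : Fin n) (c : List (Fin n) → ℚ) (w : List (Fin n)) :
    wordDeriv i c w = c (i :: w) := rfl

theorem wordCoeff_one (w : List (Fin n)) : wordCoeff n 1 w = if w = [] then 1 else 0 := by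
  classical
  have h : (FreeMonoid.ofList w = 1) ↔ w = [] := Iff.rfl
  simp only [wordCoeff, LinearMap.coe_mk, AddHom.coe_mk, map_one, MonoidAlgebra.one_def,
    MonoidAlgebra.coeff_single, Finsupp.single_apply]
  simp only [eq_comm (a := (1 : FreeMonoid (Fin n))), h]

theorem wordCoeff_ι_mul_cons (i j : Fin n) (f : FreeAlgebra ℚ (Fin n)) (w : List (Fin n)) :
    wordCoeff n (FreeAlgebra.ι ℚ i * f) (j :: w) = if i = j then wordCoeff n f w else 0 := by
  simp only [wordCoeff, LinearMap.coe_mk, AddHom.coe_mk, map_mul,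
    FreeAlgebra.equivMonoidAlgebraFreeMonoid, AlgEquiv.ofAlgHom_apply, FreeAlgebra.lift_ι_apply,
    MonoidAlgebra.of_apply]
  have key : ∀ d : FreeMonoid (Fin n), FreeMonoid.of i * d = FreeMonoid.ofList (j :: w) ↔
      i = j ∧ d = FreeMonoid.ofList w := by
    intro d
    change (i :: FreeMonoid.toList d = j :: w) ↔ i = j ∧ FreeMonoid.toList d = w
    simp
  split_ifs with h
  · rw [MonoidAlgebra.coeff_single_mul_eq_mul_coeff (FreeMonoid.ofList w), one_mul]
    intro d _
    rw [key]
    simp [h]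
  · refine MonoidAlgebra.coeff_single_mul_of_forall_mul_ne _ _ fun d hd => ?_
    exact h ((key d).1 hd).1

theorem wordCoeff_toPoly_mul_cons (L : AffineForm n) (f : FreeAlgebra ℚ (Fin n)) (i : Fin n)
    (w : List (Fin n)) : wordCoeff n (L.toPoly * f) (i :: w) =
      L.const * wordCoeff n f (i :: w) + L.coeff i * wordCoeff n f w := by
  rw [AffineForm.toPoly, add_mul, ← Algebra.smul_def, Finset.sum_mul]
  simp [wordCoeff_ι_mul_cons]

/-- Only `f` and its derivative appear on the right, so derivatives of the functions of one layer
fall into the space built from the later layers. -/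
theorem wordDeriv_wordCoeff_toPoly_mul (L : AffineForm n) (f : FreeAlgebra ℚ (Fin n)) (i : Fin n) :
    wordDeriv i (wordCoeff n (L.toPoly * f)) =
      L.const • wordDeriv i (wordCoeff n f) + L.coeff i • wordCoeff n f := by
  funext w
  simp [wordDeriv_apply, wordCoeff_toPoly_mul_cons]

/-- Stripping all letters leaves the value at the empty word: coefficients are read off from a
product of linear maps, one per letter. -/
theorem wordCoeff_apply_eq_foldl (c : List (Fin n) → ℚ) (w : List (Fin n)) :
    c w = (w.foldl (fun c i => wordDeriv i c) c) [] := by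
  induction w generalizing c with
  | nil => rfl
  | cons i w ih => rw [List.foldl_cons, ← ih, wordDeriv_apply]

theorem eq_zero_of_wordCoeff {f : FreeAlgebra ℚ (Fin n)} (h : ∀ w, wordCoeff n f w = 0) :
    f = 0 := by
  apply FreeAlgebra.equivMonoidAlgebraFreeMonoid.injective
  rw [map_zero]
  apply MonoidAlgebra.coeff_injective
  ext w
  exact h (FreeMonoid.toList w)

/-- The words that occur in a noncommutative polynomial. -/
def wordSupport (f : FreeAlgebra ℚ (Fin n)) : Finset (List (Fin n)) :=
  (FreeAlgebra.equivMonoidAlgebraFreeMonoid f).coeff.support.map FreeMonoid.toList.toEmbedding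

theorem mem_wordSupport {f : FreeAlgebra ℚ (Fin n)} {w : List (Fin n)} :
    w ∈ wordSupport f ↔ wordCoeff n f w ≠ 0 := by
  simp only [wordSupport, Finset.mem_map_equiv, Finsupp.mem_support_iff]
  rfl

theorem lift_eq_sum_wordCoeff {A : Type*} [Ring A] [Algebra ℚ A] (q : Fin n → A)
    (f : FreeAlgebra ℚ (Fin n)) :
    FreeAlgebra.lift ℚ q f = ∑ w ∈ wordSupport f, wordCoeff n f w • (w.map q).prod := by
  have h1 : FreeAlgebra.lift ℚ q = (MonoidAlgebra.lift ℚ A (FreeMonoid (Fin n))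
      (FreeMonoid.lift q)).comp 
        (FreeAlgebra.equivMonoidAlgebraFreeMonoid (R := ℚ) (X := Fin n)).toAlgHom := by
    ext i
    simp [FreeAlgebra.equivMonoidAlgebraFreeMonoid]
  rw [h1, AlgHom.comp_apply, MonoidAlgebra.lift_apply, wordSupport, Finset.sum_map]
  refine Finset.sum_congr rfl fun w _ => ?_
  beta_reduce
  rw [FreeMonoid.lift_apply]
  rfl

end Words

/-! ### Coefficient functions of branching programs. -/

namespace ABP

variable {n d : ℕ}

/-- The program with another source. -/
def withSource (B : ABP n d) (v : Fin (B.card 0)) : ABP n d := { B with source := v }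

/-- The program without its first layer, started at a vertex of the second layer. -/
def tail (B : ABP n (d + 1)) (v : Fin (B.card (Fin.succ 0))) : ABP n d where
  card i := B.card i.succ
  source := v
  sink := B.sink
  label i := B.label i.succ

theorem poly_succ (B : ABP n (d + 1)) :
    B.poly = ∑ v : Fin (B.card (Fin.succ 0)), (B.label 0 B.source v).toPoly * (B.tail v).poly := by
  classical
  have h1 : B.poly = ∑ p : (∀ i : Fin (d + 1), Fin (B.card i.succ)) with p (Fin.last d) = B.sink,
      (B.label 0 B.source (p 0)).toPoly * (List.ofFn fun i : Fin d =>
        (B.label i.succ (p i.castSucc) (p i.succ)).toPoly).prod := by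
    unfold poly
    refine Finset.sum_nbij' (fun p i => p i.succ)
      (fun p => Fin.cons (α := fun i => Fin (B.card i)) B.source p) ?_ ?_ ?_ ?_ ?_
    · intro p hp
      simpa using (Finset.mem_filter.1 hp).2.2
    · intro p hp
      refine Finset.mem_filter.2 ⟨Finset.mem_univ _, rfl, ?_⟩
      exact (Finset.mem_filter.1 hp).2
    · intro p hp
      have h0 : p 0 = B.source := (Finset.mem_filter.1 hp).2.1
      funext i
      refine Fin.cases ?_ (fun i => ?_) i
      · exact h0.symm
      · rfl
    · intro p _
      rfl
    · intro p hp
      have h0 : p 0 = B.source := (Finset.mem_filter.1 hp).2.1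
      rw [List.ofFn_succ, List.prod_cons, ← h0]
      rfl
  rw [h1, ← Finset.sum_fiberwise _ (fun p => p 0)]
  refine Finset.sum_congr rfl fun v _ => ?_
  unfold poly
  rw [Finset.mul_sum, Finset.filter_filter]
  refine Finset.sum_congr (Finset.ext fun p => ?_) fun p hp => ?_
  · refine Finset.mem_filter.trans (Iff.trans ?_
      (@Finset.mem_filter _ (B.tail v).IsPath _ _ _).symm)
    exact and_congr_right fun _ => and_comm
  · have hv : p 0 = v := (@Finset.mem_filter _ (B.tail v).IsPath _ _ _).1 hp |>.2.1
    subst hv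
    rfl

theorem poly_zero (B : ABP n 0) : ∃ c : ℚ, B.poly = c • (1 : FreeAlgebra ℚ (Fin n)) := by
  classical
  unfold poly
  simp only [List.ofFn_zero, List.prod_nil, Finset.sum_const]
  exact ⟨_, (Nat.cast_smul_eq_nsmul ℚ _ _).symm⟩

theorem wordCoeff_poly_eq_zero (B : ABP n d) (w : List (Fin n)) (hw : d < w.length) :
    wordCoeff n B.poly w = 0 := by
  induction d generalizing w with
  | zero =>
    obtain ⟨c, hc⟩ := B.poly_zero
    have : w ≠ [] := by
      rintro rfl
      simp at hw
    rw [hc, map_smul, Pi.smul_apply, wordCoeff_one, if_neg this, smul_zero]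
  | succ d ih =>
    cases w with
    | nil => simp at hw
    | cons i w =>
      simp only [List.length_cons] at hw
      rw [poly_succ, map_sum, Finset.sum_apply]
      refine Finset.sum_eq_zero fun v _ => ?_
      rw [wordCoeff_toPoly_mul_cons, ih _ _ (by simp; omega), ih _ _ (by omega)]
      simp

/-- The coefficients of the polynomials computed from the vertices of a program lie in a
subspace that is stable under derivatives and whose dimension is at most the number of vertices. -/
theorem exists_stable (B : ABP n d) : ∃ S : Submodule ℚ (List (Fin n) → ℚ),
    FiniteDimensional ℚ S ∧ Module.finrank ℚ S ≤ ∑ i, B.card i ∧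
    (∀ i, ∀ c ∈ S, wordDeriv i c ∈ S) ∧ ∀ v, wordCoeff n (B.withSource v).poly ∈ S := by
  induction d with
  | zero =>
    refine ⟨Submodule.span ℚ (Set.range fun v => wordCoeff n (B.withSource v).poly),
      FiniteDimensional.span_of_finite ℚ (Set.finite_range _), ?_, ?_,
      fun v => Submodule.subset_span ⟨v, rfl⟩⟩
    · refine (finrank_range_le_card _).trans ?_
      simp
    · intro i c hc
      have hle : Submodule.span ℚ (Set.range fun v => wordCoeff n (B.withSource v).poly) ≤
          LinearMap.ker (wordDeriv i) := by
        rw [Submodule.span_le]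
        rintro _ ⟨v, rfl⟩
        rw [SetLike.mem_coe, LinearMap.mem_ker]
        funext w
        exact wordCoeff_poly_eq_zero _ _ (by simp)
      rw [LinearMap.mem_ker.1 (hle hc)]
      exact Submodule.zero_mem _
  | succ d ih =>
    by_cases hcard : Nonempty (Fin (B.card (Fin.succ 0)))
    · obtain ⟨v₀⟩ := hcard
      obtain ⟨S, hSfin, hSrank, hSder, hSmem⟩ := ih (B.tail v₀)
      -- The tails at different vertices differ only in their source, so one subspace serves them
      -- all.
      have hStail : ∀ v, wordCoeff n (B.tail v).poly ∈ S := fun v => hSmem v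
      set T := Submodule.span ℚ (Set.range fun v => wordCoeff n (B.withSource v).poly) with hT
      have hTfin : FiniteDimensional ℚ T :=
        FiniteDimensional.span_of_finite ℚ (Set.finite_range _)
      refine ⟨T ⊔ S, Submodule.finiteDimensional_sup T S, ?_, ?_, fun v =>
        Submodule.mem_sup_left (Submodule.subset_span ⟨v, rfl⟩)⟩
      · refine (Submodule.finrank_add_le_finrank_add_finrank T S).trans ?_
        rw [Fin.sum_univ_succ]
        refine Nat.add_le_add ((finrank_range_le_card _).trans (by simp)) hSrank
      · intro i c hc
        have hle : T ⊔ S ≤ Submodule.comap (wordDeriv i) S := by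
          rw [sup_le_iff]
          refine ⟨?_, fun c hc => hSder i c hc⟩
          rw [hT, Submodule.span_le]
          rintro _ ⟨v, rfl⟩
          change wordDeriv i (wordCoeff n (B.withSource v).poly) ∈ S
          rw [poly_succ, map_sum, map_sum]
          refine Submodule.sum_mem _ fun u _ => ?_
          rw [wordDeriv_wordCoeff_toPoly_mul]
          exact Submodule.add_mem _ (Submodule.smul_mem _ _ (hSder i _ (hStail u)))
            (Submodule.smul_mem _ _ (hStail u))
        exact Submodule.mem_sup_right (hle hc)
    -- With an empty second layer there are no paths, and every polynomial is zero.
    · refine ⟨⊥, inferInstance, by simp, fun i c hc => ?_, fun v => ?_⟩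
      · rw [(Submodule.mem_bot ℚ).1 hc, map_zero]
        exact Submodule.zero_mem _
      · rw [not_nonempty_iff] at hcard
        have : IsEmpty (Fin ((B.withSource v).card (Fin.succ 0))) := hcard
        rw [poly_succ, Finset.univ_eq_empty, Finset.sum_empty, map_zero]
        exact Submodule.zero_mem _

end ABP

end

noncomputable section

/-! ## Products over the positions of a word -/

section PosProd

variable {n : ℕ} {R S : Type*} [CommSemiring R] [CommSemiring S]

/-- The product of the values `y k i` of the letters `i` of a word, where `k` is the position
counted from `s`. -/
def posProd (y : ℕ → Fin n → R) : ℕ → List (Fin n) → R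
  | _, [] => 1
  | s, i :: w => y s i * posProd y (s + 1) w

/-- The word with its positions, counted from `s`. -/
def posWord : ℕ → List (Fin n) → FreeMonoid (ℕ × Fin n)
  | _, [] => 1
  | s, i :: w => FreeMonoid.of (s, i) * posWord (s + 1) w

theorem map_posProd (f : R →+* S) (y : ℕ → Fin n → R) (s : ℕ) (w : List (Fin n)) :
    f (posProd y s w) = posProd (fun k i => f (y k i)) s w := by
  induction w generalizing s with
  | nil => simp [posProd]
  | cons i w ih => simp [posProd, ih]

theorem posProd_congr {y y' : ℕ → Fin n → R} {s : ℕ} {w : List (Fin n)}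
    (h : ∀ k, s ≤ k → k < s + w.length → y k = y' k) : posProd y s w = posProd y' s w := by
  induction w generalizing s with
  | nil => rfl
  | cons i w ih =>
    simp only [List.length_cons] at h
    rw [posProd, posProd, h s le_rfl (by omega), ih fun k hk hk' => h k (by omega) (by omega)]

theorem posProd_shift (y : ℕ → Fin n → R) (s : ℕ) (w : List (Fin n)) :
    posProd (fun k => y (k + 1)) s w = posProd y (s + 1) w := by
  induction w generalizing s with
  | nil => rfl
  | cons i w ih => rw [posProd, posProd, ih]

theorem posProd_mul_pow (c t : R) (W : ℕ × Fin n → ℕ) (s : ℕ) (w : List (Fin n)) :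
    posProd (fun k i => c * t ^ W (k, i)) s w = c ^ w.length * t ^ letterSum W (posWord s w) := by
  induction w generalizing s with
  | nil => simp [posProd, posWord, letterSum_one]
  | cons i w ih =>
    rw [posProd, ih, posWord, letterSum_mul, letterSum_of, List.length_cons]
    ring

theorem posWord_append (s : ℕ) (w w' : List (Fin n)) :
    posWord s (w ++ w') = posWord s w * posWord (s + w.length) w' := by
  induction w generalizing s with
  | nil => simp [posWord]
  | cons i w ih =>
    rw [List.cons_append, posWord, ih, posWord, mul_assoc, List.length_cons]
    congr 3
    omega

theorem posWord_injective (s : ℕ) : Function.Injective (posWord s : List (Fin n) → _) := by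
  intro w w' h
  have key : ∀ (s : ℕ) (w : List (Fin n)), (posWord s w).toList.map Prod.snd = w := by
    intro s w
    induction w generalizing s with
    | nil => rfl
    | cons i w ih => simp [posWord, ih]
  rw [← key s w, h, key]

/-- Links the recursive blocks with ordinary words. The truncated difference is the number of
positions of the block below `e`, and is 0 for a block that starts at or after `e`. -/
theorem mem_block_iff {e j a : ℕ} {u : FreeMonoid (ℕ × Fin n)} :
    u ∈ block n e j a ↔ ∃ w : List (Fin n), w.length = min e ((a + 1) * 2 ^ j) - a * 2 ^ j ∧
      u = posWord (a * 2 ^ j) w := by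
  induction j generalizing a u with
  | zero =>
    simp only [block, pow_zero, mul_one]
    split_ifs with hae
    · rw [show min e (a + 1) - a = 1 by omega]
      constructor
      · rintro ⟨i, rfl⟩
        exact ⟨[i], rfl, by simp [posWord]⟩
      · rintro ⟨w, hw, rfl⟩
        obtain ⟨i, rfl⟩ := List.length_eq_one_iff.1 hw
        exact ⟨i, by simp [posWord]⟩
    · rw [show min e (a + 1) - a = 0 by omega]
      constructor
      · intro hu
        exact ⟨[], rfl, hu⟩
      · rintro ⟨w, hw, rfl⟩
        rw [List.length_eq_zero_iff.1 hw]
        rfl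
  | succ j ih =>
    have e1 : 2 * a * 2 ^ j = a * 2 ^ (j + 1) := by ring
    have e2 : (2 * a + 1) * 2 ^ j = a * 2 ^ (j + 1) + 2 ^ j := by ring
    have e3 : (2 * a + 1 + 1) * 2 ^ j = a * 2 ^ (j + 1) + 2 * 2 ^ j := by ring
    have e4 : (a + 1) * 2 ^ (j + 1) = a * 2 ^ (j + 1) + 2 * 2 ^ j := by ring
    constructor
    · rintro ⟨u₁, h₁, u₂, h₂, rfl⟩
      obtain ⟨w₁, hw₁, rfl⟩ := ih.1 h₁
      obtain ⟨w₂, hw₂, rfl⟩ := ih.1 h₂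
      simp only [e1, e2, e3] at hw₁ hw₂ ⊢
      refine ⟨w₁ ++ w₂, by rw [List.length_append, e4]; omega, ?_⟩
      rw [posWord_append]
      -- If the first half is not full, the second is empty and its starting position is irrelevant.
      by_cases hlen : w₁.length = 2 ^ j
      · rw [hlen]
      · have : w₂ = [] := List.length_eq_zero_iff.1 (by omega)
        simp [this, posWord]
    · rintro ⟨w, hw, rfl⟩
      rw [e4] at hw
      refine ⟨posWord (a * 2 ^ (j + 1)) (w.take (2 ^ j)), ih.2 ⟨w.take (2 ^ j), ?_, by rw [e1]⟩,
        posWord (a * 2 ^ (j + 1) + 2 ^ j) (w.drop (2 ^ j)), ih.2 ⟨w.drop (2 ^ j), ?_, by rw [e2]⟩,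
        ?_⟩
      · simp only [List.length_take, e1, e2, hw]
        omega
      · simp only [List.length_drop, e2, e3, hw]
        omega
      · simp only
        conv_rhs => rw [← List.take_append_drop (2 ^ j) w, posWord_append]
        by_cases hlen : (w.take (2 ^ j)).length = 2 ^ j
        · rw [hlen]
        · have : w.drop (2 ^ j) = [] := by
            rw [List.length_take] at hlen
            exact List.drop_eq_nil_of_le (by omega)
          simp [this, posWord]

theorem mem_block_zero_iff {e h : ℕ} (he : e ≤ 2 ^ h) {u : FreeMonoid (ℕ × Fin n)} :
    u ∈ block n e h 0 ↔ ∃ w : List (Fin n), w.length = e ∧ u = posWord 0 w := by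
  rw [mem_block_iff]
  simp [min_eq_left he]

end PosProd

/-! ## Kronecker substitution and interpolation at roots of unity -/

section Kronecker

open Polynomial

theorem natDegree_coeff_mul_le {R : Type*} [CommRing R] {p q : R[X][X]} {a b : ℕ}
    (hp : ∀ i, (p.coeff i).natDegree ≤ a) (hq : ∀ i, (q.coeff i).natDegree ≤ b) (i : ℕ) :
    ((p * q).coeff i).natDegree ≤ a + b := by
  rw [coeff_mul]
  refine natDegree_sum_le_of_forall_le _ _ fun x _ => ?_
  exact natDegree_mul_le.trans (Nat.add_le_add (hp _) (hq _))

theorem natDegree_coeff_posProd_le {R : Type*} [CommRing R] {n a : ℕ} {y : ℕ → Fin n → R[X][X]}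
    (hy : ∀ k i j, ((y k i).coeff j).natDegree ≤ a) (s : ℕ) (w : List (Fin n)) (i : ℕ) :
    ((posProd y s w).coeff i).natDegree ≤ w.length * a := by
  induction w generalizing s i with
  | nil =>
    rw [posProd, coeff_one]
    split_ifs <;> simp
  | cons j w ih =>
    rw [posProd]
    refine (natDegree_coeff_mul_le (hy s j) (ih (s + 1)) i).trans (le_of_eq ?_)
    rw [List.length_cons]
    ring

/-- Kronecker substitution: one more factor `X ^ E` outweighs every difference of inner degrees, so
the term of highest outer degree stays strictly dominant. -/
theorem eval_X_pow_ne_zero {R : Type*} [CommRing R] [IsDomain R] {p : R[X][X]} {E : ℕ} (hp : p ≠ 0)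
    (hE : ∀ i, (p.coeff i).natDegree < E) : p.eval (X ^ E) ≠ 0 := by
  rw [eval_eq_sum_range]
  have hdeg : ∀ i, p.coeff i ≠ 0 → (p.coeff i * (X ^ E) ^ i).natDegree =
      (p.coeff i).natDegree + E * i := by
    intro i hi
    rw [← pow_mul, natDegree_mul_X_pow _ hi]
  have hlead : p.coeff p.natDegree ≠ 0 := by simpa using hp
  refine sum_ne_zero_of_dominant _ _ p.natDegree (by simp) ?_ ?_
  · exact mul_ne_zero hlead (pow_ne_zero _ (pow_ne_zero _ X_ne_zero))
  · intro i hi hne hi0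
    rw [hdeg i (left_ne_zero_of_mul hi0), hdeg _ hlead]
    have h1 := hE i
    have h2 : i + 1 ≤ p.natDegree := by
      have := Finset.mem_range.1 hi
      omega
    have h3 := Nat.mul_le_mul_left E h2
    rw [mul_add, mul_one] at h3
    omega

/-- Orthogonality of characters; `m - g % m` represents `-g` by a natural number. -/
theorem sum_pow_mul_eq {K : Type*} [Field K] {ω : K} {m g : ℕ} (hω : IsPrimitiveRoot ω m)
    (hm : 0 < m) (s : ℕ) : ∑ c ∈ Finset.range m, (ω ^ s) ^ c * ω ^ (c * (m - g % m)) =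
      if s ≡ g [MOD m] then (m : K) else 0 := by
  have hgm : g % m < m := Nat.mod_lt _ hm
  have h1 : ∀ c ∈ Finset.range m, (ω ^ s) ^ c * ω ^ (c * (m - g % m)) =
      (ω ^ (s + (m - g % m))) ^ c := by
    intro c _
    rw [← pow_mul, ← pow_mul, ← pow_add]
    ring_nf
  rw [Finset.sum_congr rfl h1]
  have h2 : ω ^ (s + (m - g % m)) = 1 ↔ s ≡ g [MOD m] := by
    rw [hω.pow_eq_one_iff_dvd]
    constructor
    · intro h
      have h3 : s + (m - g % m) + g % m ≡ 0 + g % m [MOD m] :=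
        ((Nat.modEq_zero_iff_dvd.2 h).add_right _)
      rw [show s + (m - g % m) + g % m = s + m by omega, zero_add] at h3
      exact ((Nat.ModEq.add_right_cancel' 0 (by simpa using h3.trans (Nat.mod_modEq _ _))))
    · intro h
      have h3 : s + (m - g % m) ≡ g % m + (m - g % m) [MOD m] :=
        (h.trans (Nat.mod_modEq g m).symm).add_right _
      rw [show g % m + (m - g % m) = m by omega] at h3
      exact Nat.modEq_zero_iff_dvd.1 (h3.trans (by simp [Nat.ModEq]))
  split_ifs with h
  · rw [h2.2 h]
    simp
  · have hne : ω ^ (s + (m - g % m)) ≠ 1 := fun h' => h (h2.1 h')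
    have h4 := geom_sum_mul (ω ^ (s + (m - g % m))) m
    rw [← pow_mul, mul_comm _ m, pow_mul, hω.pow_eq_one, one_pow, sub_self] at h4
    exact (mul_eq_zero.1 h4).resolve_right (sub_ne_zero.2 hne)

end Kronecker

end

noncomputable section

/-! ## Values of noncommutative polynomials at points `(b i * x)` of the cyclic algebra -/

section Evaluation

open Polynomial

variable (h : ℕ) {n : ℕ} (d E : ℕ) (W : ℕ × Fin n → ℕ)

/-- The coefficient of `x` in the `i`-th coordinate of the point given by the letter weights `W`. -/
def pointCoeff (i : Fin n) : RatZOmega (3 ^ (h + 1)) :=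
  ∑ k ∈ Finset.range d, ∑ c ∈ Finset.range (3 ^ (h + 1)),
    zElem h ^ (E * W (k, i) + c * (3 ^ (h + 1) - 2 ^ k % 3 ^ (h + 1))) * omega h ^ c

/-- The `j`-th conjugate of `pointCoeff`, with `z` and `z ^ E` replaced by indeterminates. -/
def pointPoly (j : ℕ) (i : Fin n) : (RatZOmega (3 ^ (h + 1)))[X][X] :=
  ∑ k ∈ Finset.range d, ∑ c ∈ Finset.range (3 ^ (h + 1)),
    C (C ((omega h ^ 2 ^ j) ^ c) * X ^ (c * (3 ^ (h + 1) - 2 ^ k % 3 ^ (h + 1)))) * X ^ W (k, i)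

theorem eval_eval_pointPoly (j : ℕ) (i : Fin n) :
    ((pointPoly h d W j i).eval (X ^ E)).eval (zElem h) =
      (sigma h ^ j) (pointCoeff h d E W i) := by
  have hz : (sigma h ^ j) (zElem h) = zElem h := AlgEquiv.commutes _ _
  simp only [pointPoly, pointCoeff, eval_finsetSum, map_sum]
  refine Finset.sum_congr rfl fun k _ => Finset.sum_congr rfl fun c _ => ?_
  simp only [eval_mul, eval_C, eval_pow, eval_X, map_mul, map_pow, hz, sigma_pow_omega]
  rw [pow_add (zElem h), pow_mul (zElem h) E]
  ring

theorem eval_pointPoly_mem (j : ℕ) (i : Fin n) :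
    (pointPoly h d W j i).eval (X ^ E) ∈ algebraicPolys h := by
  have hX : (X : (RatZOmega (3 ^ (h + 1)))[X]) ∈ algebraicPolys h := X_mem_lifts _
  have hω : C (omega h) ∈ algebraicPolys h := C_mem_algebraicPolys (isAlgebraic_omega h)
  simp only [pointPoly, eval_finsetSum]
  refine Subsemiring.sum_mem _ fun k _ => Subsemiring.sum_mem _ fun c _ => ?_
  simp only [eval_mul, eval_C, eval_pow, eval_X, map_pow]
  exact mul_mem (mul_mem (pow_mem (pow_mem hω _) _) (pow_mem hX _)) (pow_mem (pow_mem hX _) _)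

theorem two_pow_modEq_iff {j k : ℕ} (hj : j < 2 * 3 ^ h) (hk : k < 2 * 3 ^ h) :
    2 ^ j ≡ 2 ^ k [MOD 3 ^ (h + 1)] ↔ j = k := by
  refine ⟨fun hjk => ?_, fun hjk => by rw [hjk]⟩
  rw [← ZMod.natCast_eq_natCast_iff] at hjk
  push_cast at hjk
  rw [← orderOf_two_zmod_three_pow] at hj hk
  exact pow_injOn_Iio_orderOf hj hk hjk

/-- At `ω` the inner sum becomes `∑ ω ^ (c * (2 ^ j - 2 ^ k))`, which vanishes unless `k = j`: the
`j`-th conjugate sees only position `j`. The bound on `d` keeps the powers of 2 distinct modulo `3 ^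
(h + 1)`. -/
theorem map_pointPoly (hd : d ≤ 2 * 3 ^ h) {j : ℕ} (hj : j < d) (i : Fin n) :
    (pointPoly h d W j i).map (evalRingHom (omega h)) =
      C ((3 ^ (h + 1) : ℕ) : RatZOmega (3 ^ (h + 1))) * X ^ W (j, i) := by
  simp only [pointPoly, Polynomial.map_sum, Polynomial.map_mul, Polynomial.map_pow, map_X, map_C,
    coe_evalRingHom, eval_mul, eval_C, eval_pow, eval_X]
  simp only [← Finset.sum_mul, ← map_sum]
  have h1 := fun k => sum_pow_mul_eq (g := 2 ^ k) (isPrimitiveRoot_omega h) (by positivity) (2 ^ j)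
  simp only [h1]
  rw [Finset.sum_eq_single j]
  · rw [if_pos (Nat.ModEq.refl _)]
  · intro k hk hkj
    have hk := Finset.mem_range.1 hk
    rw [if_neg, map_zero, zero_mul]
    rw [two_pow_modEq_iff h (by omega) (by omega)]
    exact fun h' => hkj h'.symm
  · intro h'
    exact absurd (Finset.mem_range.2 hj) h'

theorem natDegree_coeff_pointPoly_le (j : ℕ) (i : Fin n) (l : ℕ) :
    ((pointPoly h d W j i).coeff l).natDegree ≤ 3 ^ (h + 1) * 3 ^ (h + 1) := by
  simp only [pointPoly, finsetSum_coeff]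
  refine natDegree_sum_le_of_forall_le _ _ fun k _ => natDegree_sum_le_of_forall_le _ _ fun c hc => ?_
  rw [coeff_C_mul, coeff_X_pow]
  split_ifs
  · rw [mul_one]
    refine (natDegree_C_mul_X_pow_le _ _).trans ?_
    exact Nat.mul_le_mul (Finset.mem_range.1 hc).le (Nat.sub_le _ _)
  · simp

/-- If the words of some weight do not cancel, then neither do the values at the point. -/
theorem sum_posProd_pointCoeff_ne_zero {e : ℕ} (he : e ≤ d) (hd : d ≤ 2 * 3 ^ h)
    (hE : d * (3 ^ (h + 1) * 3 ^ (h + 1)) < E) (U : Finset (List (Fin n)))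
    (hU : ∀ w ∈ U, w.length = e) (coef : List (Fin n) → ℚ) (t : ℕ)
    (ht : ∑ w ∈ U with letterSum W (posWord 0 w) = t, coef w ≠ 0) :
    ∑ w ∈ U, (coef w : RatZOmega (3 ^ (h + 1))) *
      posProd (fun k i => (sigma h ^ k) (pointCoeff h d E W i)) 0 w ≠ 0 := by
  set P : (RatZOmega (3 ^ (h + 1)))[X][X] :=
    ∑ w ∈ U, C (C (coef w : RatZOmega (3 ^ (h + 1)))) * posProd (pointPoly h d W) 0 w with hP
  -- Putting `ω` for the inner variable turns each word into a monomial whose exponent is its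
  -- weight. The coefficient at `t` is then the sum in `ht` times a power of 3.
  have hP0 : P ≠ 0 := by
    intro h0
    have h1 := congrArg (fun Q => (mapRingHom (evalRingHom (omega h)) Q).coeff t) h0
    simp only [hP, map_sum, map_mul, map_posProd, map_zero, coeff_zero, finsetSum_coeff,
      coe_mapRingHom, map_C, coe_evalRingHom, eval_C] at h1
    have h2 : ∀ w ∈ U, (C (coef w : RatZOmega (3 ^ (h + 1))) * posProd (fun k i =>
        (pointPoly h d W k i).map (evalRingHom (omega h))) 0 w).coeff t =
        ((3 ^ (h + 1) : ℕ) : RatZOmega (3 ^ (h + 1))) ^ e *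
          (if letterSum W (posWord 0 w) = t then (coef w : RatZOmega (3 ^ (h + 1))) else 0) := by
      intro w hw
      rw [posProd_congr (y' := fun k i => C ((3 ^ (h + 1) : ℕ) : RatZOmega (3 ^ (h + 1))) *
        X ^ W (k, i)) (fun k _ hk => by
          funext i
          exact map_pointPoly h d W hd (by rw [hU w hw] at hk; omega) i)]
      rw [posProd_mul_pow, hU w hw, ← map_pow, coeff_C_mul, coeff_C_mul, coeff_X_pow]
      simp only [eq_comm (a := t)]
      split_ifs <;> ring
    rw [Finset.sum_congr rfl h2, ← Finset.mul_sum, ← Finset.sum_filter] at h1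
    rcases mul_eq_zero.1 h1 with h3 | h3
    · exact pow_ne_zero e (Nat.cast_ne_zero.2 (pow_ne_zero _ three_ne_zero)) h3
    · exact ht (by exact_mod_cast h3)
  have hdeg : ∀ i, (P.coeff i).natDegree < E := by
    intro i
    refine lt_of_le_of_lt ?_ hE
    simp only [hP, finsetSum_coeff, coeff_C_mul]
    refine natDegree_sum_le_of_forall_le _ _ fun w hw => ?_
    refine (natDegree_C_mul_le _ _).trans ((natDegree_coeff_posProd_le
      (natDegree_coeff_pointPoly_le h d W) 0 w i).trans ?_)
    rw [hU w hw]
    exact Nat.mul_le_mul_right _ he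
  have hne := eval_X_pow_ne_zero hP0 hdeg
  have hmem : P.eval (X ^ E) ∈ algebraicPolys h := by
    simp only [hP, eval_finsetSum, eval_mul, eval_C]
    refine Subsemiring.sum_mem _ fun w hw => mul_mem ?_ ?_
    · exact C_mem_algebraicPolys (isAlgebraic_algebraMap (R := ℚ) (coef w))
    · rw [← coe_evalRingHom, map_posProd]
      clear hw
      generalize (0 : ℕ) = s
      induction w generalizing s with
      | nil => exact one_mem _
      | cons i w ih => exact mul_mem (eval_pointPoly_mem h d E W s i) (ih (s + 1))
  -- Substituting `X ^ E` and then `z` gives back the original sum; the first substitution is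
  -- harmless by the degree bound, the second because `z` is transcendental over the coefficients.
  intro h0
  refine hne (eq_zero_of_eval_zElem hmem ?_)
  rw [← h0]
  simp only [hP, eval_finsetSum, eval_mul, eval_C]
  refine Finset.sum_congr rfl fun w _ => ?_
  congr 1
  rw [← coe_evalRingHom, ← coe_evalRingHom, map_posProd, map_posProd]
  refine posProd_congr fun k _ _ => ?_
  funext i
  exact eval_eval_pointPoly h d E W k i

end Evaluation

/-! ### Words evaluated inside a cyclic algebra. -/

section CyclicValues

variable {F K : Type*} [Field F] [Field K] [Algebra F K] (σ : K ≃ₐ[F] K) (ℓ : ℕ) (a : F)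

/-- The embedding of the field `K` into the cyclic algebra. -/
def cyclicAlgebra.ofKHom : K →+* cyclicAlgebra σ ℓ a where
  toFun := cyclicAlgebra.ofK σ ℓ a
  map_one' := by
    apply Subtype.ext
    simp [cyclicAlgebra.ofK, cyclicDiag]
  map_mul' b c := by
    apply Subtype.ext
    simp [cyclicAlgebra.ofK, cyclicDiag]
  map_zero' := by
    apply Subtype.ext
    simp [cyclicAlgebra.ofK, cyclicDiag]
  map_add' b c := by
    apply Subtype.ext
    simp [cyclicAlgebra.ofK, cyclicDiag, Matrix.diagonal_add]

theorem cyclicAlgebra.algebraMap_eq (r : F) :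
    algebraMap F (cyclicAlgebra σ ℓ a) r = cyclicAlgebra.ofKHom σ ℓ a (algebraMap F K r) := by
  apply Subtype.ext
  simp only [cyclicAlgebra.ofKHom, cyclicAlgebra.ofK, cyclicDiag, RingHom.coe_mk, MonoidHom.coe_mk,
    OneHom.coe_mk, Subalgebra.coe_algebraMap, Matrix.algebraMap_eq_diagonal, AlgEquiv.commutes]
  rfl

theorem cyclicDiag_mul_cyclicX_pow (hσ : σ ^ ℓ = 1) (hℓ : 0 < ℓ) (c : K) {k : ℕ} (hk : k < ℓ) :
    cyclicDiag σ ℓ c * cyclicX K ℓ a ^ k = cyclicMatrix σ ℓ a fun i => if i = k then c else 0 := by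
  rw [cyclicX_pow_eq σ ℓ a hσ hℓ k hk, cyclicDiag_mul_cyclicMatrix]
  simp

theorem cyclicAlgebra.x_mul_ofKHom (hσ : σ ^ ℓ = 1) (hℓ : 1 < ℓ) (c : K) :
    cyclicAlgebra.x σ ℓ a * cyclicAlgebra.ofKHom σ ℓ a c =
      cyclicAlgebra.ofKHom σ ℓ a (σ c) * cyclicAlgebra.x σ ℓ a := by
  apply Subtype.ext
  change cyclicX K ℓ a * cyclicDiag σ ℓ c = cyclicDiag σ ℓ (σ c) * cyclicX K ℓ a
  rw [← mul_one (cyclicDiag σ ℓ c), ← pow_zero (cyclicX K ℓ a),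
    cyclicDiag_mul_cyclicX_pow σ ℓ a hσ (by omega) c (by omega), cyclicX_mul_cyclicMatrix σ ℓ a hσ]
  nth_rewrite 1 [← pow_one (cyclicX K ℓ a)]
  rw [cyclicDiag_mul_cyclicX_pow σ ℓ a hσ (by omega) _ hℓ]
  refine cyclicMatrix_congr σ ℓ a fun i hi => ?_
  split_ifs <;> first | omega | simp

/-- A word evaluated at a point whose coordinates have the form `b i * x`. -/
theorem prod_map_ofKHom_mul_x (hσ : σ ^ ℓ = 1) (hℓ : 1 < ℓ) {n : ℕ} (b : Fin n → K)
    (w : List (Fin n)) :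
    (w.map fun i => cyclicAlgebra.ofKHom σ ℓ a (b i) * cyclicAlgebra.x σ ℓ a).prod =
      cyclicAlgebra.ofKHom σ ℓ a (posProd (fun k i => (σ ^ k) (b i)) 0 w) *
        cyclicAlgebra.x σ ℓ a ^ w.length := by
  induction w with
  | nil => simp [posProd]
  | cons i w ih =>
    have h1 : posProd (fun k i => (σ ^ k) (b i)) 1 w =
        σ (posProd (fun k i => (σ ^ k) (b i)) 0 w) := by
      have h2 := map_posProd (σ : K →+* K) (fun k i => (σ ^ k) (b i)) 0 w
      refine Eq.trans ?_ h2.symm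
      rw [← posProd_shift]
      refine posProd_congr fun k _ _ => ?_
      funext i
      rw [pow_succ', AlgEquiv.mul_apply]
      rfl
    rw [List.map_cons, List.prod_cons, ih, posProd, map_mul, List.length_cons, pow_succ', h1]
    simp only [pow_zero, AlgEquiv.one_apply]
    rw [mul_assoc, ← mul_assoc (cyclicAlgebra.x σ ℓ a), cyclicAlgebra.x_mul_ofKHom σ ℓ a hσ hℓ]
    simp only [mul_assoc]

end CyclicValues

end

noncomputable section

/-! ## The hitting set -/

section HittingSet

/-- The moduli encoded by the digits of a number in base `N`. -/
def digitModulus (N q j : ℕ) : ℕ := q / N ^ j % N + 1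

theorem exists_digitModulus_eq {N : ℕ} (p : ℕ → ℕ) (hp : ∀ i, 1 ≤ p i ∧ p i ≤ N) (h : ℕ) :
    ∃ q < N ^ h, ∀ j < h, digitModulus N q j = p j := by
  induction h with
  | zero => exact ⟨0, by simp, by simp⟩
  | succ h ih =>
    obtain ⟨q, hq, hqp⟩ := ih
    have hph := hp h
    have hN : 0 < N := by omega
    refine ⟨q + N ^ h * (p h - 1), ?_, fun j hj => ?_⟩
    · have : N ^ h * (p h - 1 + 1) ≤ N ^ h * N := Nat.mul_le_mul_left _ (by omega)
      rw [pow_succ]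
      linarith
    · unfold digitModulus
      rcases Nat.lt_succ_iff_lt_or_eq.1 hj with hj | rfl
      · rw [← hqp j hj, digitModulus]
        congr 1
        have h1 : N ^ h * (p h - 1) = N ^ j * (N * (N ^ (h - j - 1) * (p h - 1))) := by
          rw [← mul_assoc, ← mul_assoc, ← pow_succ, ← pow_add]
          congr 2
          omega
        rw [h1, Nat.add_mul_div_left _ _ (by positivity), Nat.add_mul_mod_self_left]
      · rw [Nat.add_mul_div_left _ _ (by positivity), Nat.div_eq_of_lt hq, zero_add,
          Nat.mod_eq_of_lt (by omega)]
        omega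

/-- The letter weights of the point with number `q`. -/
def pointWeight (n h N q : ℕ) : ℕ × Fin n → ℕ :=
  isoWeight n (2 ^ h * N + 1) (digitModulus N q) h

/-- The exponent that separates the two substitutions for `z`. -/
def pointScale (h d : ℕ) : ℕ := d * (3 ^ (h + 1) * 3 ^ (h + 1)) + 1

/-- The term of the `i`-th coordinate of the point with number `q` for position `k` and
power `c` of the root of unity. -/
def pointTerm (n h d N q : ℕ) (i : Fin n) (k c : ℕ) : DTerm where
  num := 1
  den := 1
  zExp := pointScale h d * pointWeight n h N q (k, i) +
    c * (3 ^ (h + 1) - 2 ^ k % 3 ^ (h + 1))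
  wExp := c
  xExp := 1

/-- The written form of the point with number `q`. -/
def pointTerms (n h d N q : ℕ) (i : Fin n) : List DTerm :=
  (List.range d).flatMap fun k => (List.range (3 ^ (h + 1))).map fun c =>
    pointTerm n h d N q i k c

theorem sum_map_range_eq {A : Type*} [AddCommMonoid A] (f : ℕ → A) (k : ℕ) :
    ((List.range k).map f).sum = ∑ i ∈ Finset.range k, f i := by
  rw [Finset.sum_range, ← Fin.sum_ofFn, List.ofFn_eq_map]
  rw [← List.map_coe_finRange_eq_range, List.map_map]
  rfl

theorem pointTerm_value (n h d N q : ℕ) (i : Fin n) (k c : ℕ) :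
    (pointTerm n h d N q i k c).value (sigma h) (2 * 3 ^ h) (omega h) =
      cyclicAlgebra.ofKHom (sigma h) (2 * 3 ^ h) RatFunc.X
        (zElem h ^ (pointScale h d * pointWeight n h N q (k, i) +
          c * (3 ^ (h + 1) - 2 ^ k % 3 ^ (h + 1))) * omega h ^ c) *
        cyclicAlgebra.x (sigma h) (2 * 3 ^ h) RatFunc.X := by
  have h1 : (((pointTerm n h d N q i k c).num : RatZ) / (((pointTerm n h d N q i k c).den : ℕ) : RatZ))
      * RatFunc.X ^ (pointTerm n h d N q i k c).zExp =
      RatFunc.X ^ (pointScale h d * pointWeight n h N q (k, i) +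
        c * (3 ^ (h + 1) - 2 ^ k % 3 ^ (h + 1))) := by
    simp [pointTerm]
  rw [DTerm.value, h1, cyclicAlgebra.algebraMap_eq, map_pow (algebraMap RatZ _), map_mul]
  simp only [pointTerm, pow_one]
  rfl

theorem pointValue_pointTerms (n h d N q : ℕ) (i : Fin n) :
    pointValue (sigma h) (2 * 3 ^ h) (omega h) (pointTerms n h d N q) i =
      cyclicAlgebra.ofKHom (sigma h) (2 * 3 ^ h) RatFunc.X
        (pointCoeff h d (pointScale h d) (pointWeight n h N q) i) *
        cyclicAlgebra.x (sigma h) (2 * 3 ^ h) RatFunc.X := by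
  have h1 : pointValue (sigma h) (2 * 3 ^ h) (omega h) (pointTerms n h d N q) i =
      ∑ k ∈ Finset.range d, ∑ c ∈ Finset.range (3 ^ (h + 1)),
        (pointTerm n h d N q i k c).value (sigma h) (2 * 3 ^ h) (omega h) := by
    rw [← sum_map_range_eq]
    simp only [← sum_map_range_eq]
    unfold pointValue pointTerms
    rw [List.flatMap_def, List.map_flatten, List.sum_flatten]
    simp only [List.map_map, Function.comp_def]
  rw [h1]
  simp only [pointTerm_value, ← Finset.sum_mul, ← map_sum]
  rfl

/-- The coefficient of `x ^ e` in a value. -/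
theorem lift_apply_zero (n h d N q : ℕ) (f : FreeAlgebra ℚ (Fin n))
    (hf : ∀ w, wordCoeff n f w ≠ 0 → w.length < 2 * 3 ^ h) (e : Fin (2 * 3 ^ h)) :
    (FreeAlgebra.lift ℚ (pointValue (sigma h) (2 * 3 ^ h) (omega h) (pointTerms n h d N q)) f :
      Matrix (Fin (2 * 3 ^ h)) (Fin (2 * 3 ^ h)) (RatZOmega (3 ^ (h + 1)))) ⟨0, e.pos⟩ e =
    ∑ w ∈ (wordSupport f).filter (fun w => w.length = (e : ℕ)),
      (wordCoeff n f w : RatZOmega (3 ^ (h + 1))) *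
      posProd (fun k i => (sigma h ^ k) (pointCoeff h d (pointScale h d)
        (pointWeight n h N q) i)) 0 w := by
  have hpos : 0 < 3 ^ h := by positivity
  have hσ : sigma h ^ (2 * 3 ^ h) = 1 := orderOf_sigma h ▸ pow_orderOf_eq_one (sigma h)
  rw [lift_eq_sum_wordCoeff, Finset.sum_filter]
  simp only [AddSubmonoidClass.coe_finsetSum, Matrix.sum_apply]
  refine Finset.sum_congr rfl fun w hw => ?_
  have hlen := hf w (mem_wordSupport.1 hw)
  have hpt : pointValue (sigma h) (2 * 3 ^ h) (omega h) (pointTerms n h d N q) =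
      fun i => cyclicAlgebra.ofKHom (sigma h) (2 * 3 ^ h) RatFunc.X
        (pointCoeff h d (pointScale h d) (pointWeight n h N q) i) *
        cyclicAlgebra.x (sigma h) (2 * 3 ^ h) RatFunc.X :=
    funext fun i => pointValue_pointTerms n h d N q i
  rw [hpt, prod_map_ofKHom_mul_x (sigma h) (2 * 3 ^ h) RatFunc.X hσ (by omega), Algebra.smul_def]
  have halg : algebraMap ℚ (CyclicD (sigma h) (2 * 3 ^ h)) (wordCoeff n f w) =
      cyclicAlgebra.ofKHom (sigma h) (2 * 3 ^ h) RatFunc.X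
        (wordCoeff n f w : RatZOmega (3 ^ (h + 1))) := by
    change algebraMap RatZ (CyclicD (sigma h) (2 * 3 ^ h)) (algebraMap ℚ RatZ _) = _
    rw [cyclicAlgebra.algebraMap_eq]
    simp
  rw [halg, ← mul_assoc, ← map_mul]
  change (cyclicDiag (sigma h) (2 * 3 ^ h) _ *
    cyclicX (RatZOmega (3 ^ (h + 1))) (2 * 3 ^ h) (RatFunc.X : RatZ) ^ w.length :
      Matrix (Fin (2 * 3 ^ h)) (Fin (2 * 3 ^ h)) (RatZOmega (3 ^ (h + 1)))) _ _ = _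
  -- Words are shorter than `ℓ`, so `x ^ w.length` does not wrap around and row 0 separates the
  -- lengths.
  rw [cyclicDiag_mul_cyclicX_pow (sigma h) (2 * 3 ^ h) RatFunc.X hσ (by omega) _ hlen,
    cyclicMatrix_zero_apply]
  simp only [eq_comm]

/-- The words of length `e` are evaluated by a linear representation of small dimension. -/
theorem exists_linear_representation {n r d : ℕ} {f : FreeAlgebra ℚ (Fin n)}
    (hf : f ∈ abpClass n r d) (hf0 : f ≠ 0) :
    ∃ (V : Type) (_ : AddCommGroup V) (_ : Module ℚ V) (_ : Module.Finite ℚ V)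
      (T : Fin n → Module.End ℚ V) (v : V) (φ : V →ₗ[ℚ] ℚ),
      1 ≤ Module.finrank ℚ V ∧ Module.finrank ℚ V ≤ r * (d + 1) ∧
      ∀ w, wordCoeff n f w = φ (w.foldl (fun u i => T i u) v) := by
  obtain ⟨B, hB, rfl⟩ := hf
  obtain ⟨S, hfin, hrank, hder, hmem⟩ := B.exists_stable
  have hv : wordCoeff n B.poly ∈ S := hmem B.source
  let T : Fin n → Module.End ℚ S := fun i => (wordDeriv i).restrict (hder i)
  let φ : S →ₗ[ℚ] ℚ := (LinearMap.proj []).comp S.subtype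
  refine ⟨S, inferInstance, inferInstance, hfin, T, ⟨wordCoeff n B.poly, hv⟩, φ, ?_, ?_, ?_⟩
  · have : Nontrivial S := by
      refine ⟨⟨⟨wordCoeff n B.poly, hv⟩, 0, fun h0 => hf0 ?_⟩⟩
      refine eq_zero_of_wordCoeff fun w => ?_
      exact congrFun (congrArg Subtype.val h0) w
    exact Module.finrank_pos
  · refine hrank.trans ((Finset.sum_le_card_nsmul _ _ r fun i _ =>
      (Finset.le_sup (Finset.mem_univ i)).trans hB).trans (le_of_eq ?_))
    simp [mul_comm]
  · intro w
    have key : ∀ (w : List (Fin n)) (c : S),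
        ((w.foldl (fun u i => T i u) c : S) : List (Fin n) → ℚ) =
          w.foldl (fun c i => wordDeriv i c) (c : List (Fin n) → ℚ) := by
      intro w
      induction w with
      | nil => intro c; rfl
      | cons i w ih => intro c; rw [List.foldl_cons, List.foldl_cons, ih]; rfl
    rw [wordCoeff_apply_eq_foldl (wordCoeff n B.poly) w]
    change _ = ((w.foldl (fun u i => T i u) ⟨wordCoeff n B.poly, hv⟩ : S) : List (Fin n) → ℚ) []
    rw [key]

theorem wordCoeff_length_le {n r d : ℕ} {f : FreeAlgebra ℚ (Fin n)} (hf : f ∈ abpClass n r d)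
    {w : List (Fin n)} (hw : wordCoeff n f w ≠ 0) : w.length ≤ d := by
  obtain ⟨B, -, rfl⟩ := hf
  by_contra hcon
  exact hw (B.wordCoeff_poly_eq_zero w (by omega))

theorem le_two_mul_three_pow {h d : ℕ} (hd : d ≤ 2 ^ h) : d < 2 * 3 ^ h := by
  have h1 : 2 ^ h ≤ 3 ^ h := Nat.pow_le_pow_left (by norm_num) h
  have h2 : 0 < 3 ^ h := by positivity
  omega

/-- Every nonzero polynomial of the class is nonzero at one of the points. -/
theorem exists_lift_ne_zero {n r d h N : ℕ} (hd : d ≤ 2 ^ h)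
    (hN : 2 * (n * 2 ^ h * (r * (d + 1)) ^ 8 * 2 ^ h + 1) ≤ N)
    {f : FreeAlgebra ℚ (Fin n)} (hf : f ∈ abpClass n r d) (hf0 : f ≠ 0) :
    ∃ q < N ^ h, FreeAlgebra.lift ℚ
      (pointValue (sigma h) (2 * 3 ^ h) (omega h) (pointTerms n h d N q)) f ≠ 0 := by
  classical
  obtain ⟨V, _, _, _, T, v, φ, hV1, hV, hT⟩ := exists_linear_representation hf hf0
  obtain ⟨w₀, hw₀⟩ : ∃ w, wordCoeff n f w ≠ 0 := by
    by_contra hcon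
    push Not at hcon
    exact hf0 (eq_zero_of_wordCoeff hcon)
  have he := wordCoeff_length_le hf hw₀
  -- It is enough to treat one length that occurs in `f`: its words make up the coefficient of `x ^
  -- e`.
  set e := w₀.length with he_def
  -- In the opposite algebra the first letter of a word acts first, as the derivatives do. Its
  -- dimension is at most `(r * (d + 1)) ^ 2`, whose fourth power is the eighth power in `hN`.
  have hfin : Module.finrank ℚ (Module.End ℚ V)ᵐᵒᵖ = Module.finrank ℚ V * Module.finrank ℚ V := by
    rw [← (MulOpposite.opLinearEquiv ℚ (M := Module.End ℚ V)).finrank_eq, Module.finrank_linearMap]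
  have hfinite : Module.Finite ℚ (Module.End ℚ V)ᵐᵒᵖ :=
    Module.Finite.equiv (MulOpposite.opLinearEquiv ℚ (M := Module.End ℚ V))
  let val : FreeMonoid (ℕ × Fin n) →* (Module.End ℚ V)ᵐᵒᵖ :=
    FreeMonoid.lift fun x => MulOpposite.op (T x.2)
  let Φ : (Module.End ℚ V)ᵐᵒᵖ →ₗ[ℚ] ℚ :=
    (φ.comp (LinearMap.applyₗ v)).comp
      (MulOpposite.opLinearEquiv ℚ (M := Module.End ℚ V)).symm.toLinearMap
  have hval : ∀ (w : List (Fin n)) (s : ℕ) (u : V),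
      (val (posWord s w)).unop u = w.foldl (fun u i => T i u) u := by
    intro w
    induction w with
    | nil => intro s u; simp [posWord]
    | cons i w ih =>
      intro s u
      rw [posWord, map_mul, List.foldl_cons, MulOpposite.unop_mul, Module.End.mul_apply, ih]
      simp [val]
  have hΦ : ∀ w, Φ (val (posWord 0 w)) = wordCoeff n f w := by
    intro w
    rw [hT, ← hval w 0]
    rfl
  obtain ⟨p, hp, hS⟩ := exists_moduli (D := (r * (d + 1)) ^ 2) (h := h) (N := N)
    (B := 2 ^ h * N + 1) (by rw [hfin]; exact Nat.mul_pos hV1 hV1) val e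
    (by rw [hfin, pow_two]; exact Nat.mul_le_mul hV hV)
    (by rw [← pow_mul]; exact hN) rfl h le_rfl
  obtain ⟨S, hS⟩ := hS 0 (by simp)
  obtain ⟨q, hq, hqp⟩ := exists_digitModulus_eq p hp h
  rw [← isoWeight_congr n (2 ^ h * N + 1) hqp] at hS
  change IsIsolatingBasis val (letterSum (pointWeight n h N q)) _ _ S at hS
  have heh : e ≤ 2 ^ h := he.trans hd
  set U := (wordSupport f).filter (fun w => w.length = e) with hU
  obtain ⟨t, ht⟩ := hS.exists_sum_ne_zero Φ (U.map ⟨posWord 0, posWord_injective 0⟩)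
    (by
      intro a ha
      rw [Finset.mem_coe, Finset.mem_map] at ha
      obtain ⟨w, hw, rfl⟩ := ha
      exact (mem_block_zero_iff heh).2 ⟨w, (Finset.mem_filter.1 hw).2, rfl⟩)
    (by
      intro a ha haU
      obtain ⟨w, hw, rfl⟩ := (mem_block_zero_iff heh).1 ha
      rw [hΦ]
      by_contra hne
      refine haU (Finset.mem_map.2 ⟨w, Finset.mem_filter.2 ⟨mem_wordSupport.2 hne, hw⟩, rfl⟩))
    ⟨posWord 0 w₀, (mem_block_zero_iff heh).2 ⟨w₀, rfl, rfl⟩, by rwa [hΦ]⟩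
  have hdℓ := le_two_mul_three_pow hd
  refine ⟨q, hq, fun h0 => ?_⟩
  have h1 := lift_apply_zero n h d N q f
    (fun w hw => (wordCoeff_length_le hf hw).trans_lt hdℓ) ⟨e, he.trans_lt hdℓ⟩
  rw [h0] at h1
  refine sum_posProd_pointCoeff_ne_zero h d (pointScale h d) (pointWeight n h N q) he hdℓ.le
    (Nat.lt_succ_self _) U (fun w hw => (Finset.mem_filter.1 hw).2) (wordCoeff n f) t ?_ h1.symm
  rw [Finset.filter_map, Finset.sum_map] at ht
  simpa only [Function.Embedding.coeFn_mk, hΦ, Function.comp_def] using ht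

end HittingSet

end

noncomputable section

/-! ## Verifying programs of the random access machine -/

namespace RAM

/-- Arithmetic expressions over registers. -/
inductive RegExpr : Type
  | var (r : ℕ)
  | lit (k : ℕ)
  | add (a b : RegExpr)
  | sub (a b : RegExpr)
  | mul (a b : RegExpr)
  | div (a b : RegExpr)

namespace RegExpr

/-- The value of an expression, given the contents of the first registers. -/
def eval (l : List ℕ) : RegExpr → ℕ
  | var r => l.getD r 0
  | lit k => k
  | add a b => a.eval l + b.eval l
  | sub a b => a.eval l - b.eval l
  | mul a b => a.eval l * b.eval l
  | div a b => a.eval l / b.eval l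

/-- The program that computes an expression into register `t`, with scratch registers above `t`. -/
def compile : RegExpr → ℕ → Prog
  | var r, t => .seq (.const t 0) (.add t r t)
  | lit k, t => .const t k
  | add a b, t => .seq (a.compile t) (.seq (b.compile (t + 1)) (.add t t (t + 1)))
  | sub a b, t => .seq (a.compile t) (.seq (b.compile (t + 1)) (.sub t t (t + 1)))
  | mul a b, t => .seq (a.compile t) (.seq (b.compile (t + 1)) (.mul t t (t + 1)))
  | div a b, t => .seq (a.compile t) (.seq (b.compile (t + 1)) (.div t t (t + 1)))

/-- All registers of the expression lie below `k`. -/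
def varsLt (k : ℕ) : RegExpr → Bool
  | var r => decide (r < k)
  | lit _ => true
  | add a b => a.varsLt k && b.varsLt k
  | sub a b => a.varsLt k && b.varsLt k
  | mul a b => a.varsLt k && b.varsLt k
  | div a b => a.varsLt k && b.varsLt k

/-- A bound for the bit length of the value, in units of the bit lengths of the registers. -/
def width : RegExpr → ℕ
  | var _ => 1
  | lit k => k + 1
  | add a b => a.width + b.width
  | sub a b => a.width + b.width
  | mul a b => a.width + b.width
  | div a b => a.width + b.width

/-- A bound for the cost of the evaluation, in units of the bit lengths of the registers. -/
def cost : RegExpr → ℕ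
  | var _ => 3
  | lit k => k + 1
  | add a b => a.cost + b.cost + a.width + b.width + 1
  | sub a b => a.cost + b.cost + a.width + b.width + 1
  | mul a b => a.cost + b.cost + a.width + b.width + 1
  | div a b => a.cost + b.cost + a.width + b.width + 1

theorem one_le_width (e : RegExpr) : 1 ≤ e.width := by
  induction e with
  | var r => exact le_rfl
  | lit k => exact Nat.succ_le_succ (Nat.zero_le k)
  | add a b ha hb => exact ha.trans (Nat.le_add_right _ _)
  | sub a b ha hb => exact ha.trans (Nat.le_add_right _ _)
  | mul a b ha hb => exact ha.trans (Nat.le_add_right _ _)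
  | div a b ha hb => exact ha.trans (Nat.le_add_right _ _)

end RegExpr

theorem size_le_self (k : ℕ) : k.size ≤ k := Nat.size_le.2 Nat.lt_two_pow_self

theorem size_add_le {a b x y : ℕ} (ha : a.size ≤ x) (hb : b.size ≤ y) (hx : 1 ≤ x) (hy : 1 ≤ y) :
    (a + b).size ≤ x + y := by
  rw [Nat.size_le] at *
  have h1 : 2 ^ x ≤ 2 ^ (x + y - 1) := Nat.pow_le_pow_right (by norm_num) (by omega)
  have h2 : 2 ^ y ≤ 2 ^ (x + y - 1) := Nat.pow_le_pow_right (by norm_num) (by omega)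
  have h3 : 2 ^ (x + y) = 2 * 2 ^ (x + y - 1) := by
    rw [← pow_succ']
    congr 1
    omega
  omega

theorem size_mul_le {a b x y : ℕ} (ha : a.size ≤ x) (hb : b.size ≤ y) :
    (a * b).size ≤ x + y := by
  rw [Nat.size_le] at *
  rw [pow_add]
  exact Nat.mul_lt_mul'' ha hb

/-- Sums and products at most add the bit lengths of their operands; truncated subtraction and
division do not exceed the first operand. -/
theorem RegExpr.size_eval_le (e : RegExpr) {l : List ℕ} {u : ℕ} (hl : ∀ a ∈ l, a.size + 1 ≤ u)
    (hu : 1 ≤ u) : (e.eval l).size ≤ e.width * u := by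
  have hw : ∀ a : RegExpr, 1 ≤ a.width * u := fun a => Nat.mul_pos a.one_le_width hu
  induction e with
  | var r =>
    simp only [eval, width, one_mul]
    by_cases hr : r < l.length
    · rw [List.getD_eq_getElem _ _ hr]
      have := hl _ (List.getElem_mem hr)
      omega
    · rw [List.getD_eq_default _ _ (by omega)]
      simp
  | lit k =>
    simp only [eval, width]
    have := size_le_self k
    nlinarith
  | add a b ha hb =>
    rw [eval, width, add_mul]
    exact size_add_le ha hb (hw a) (hw b)
  | sub a b ha hb =>
    rw [eval, width, add_mul]
    exact (Nat.size_le_size (Nat.sub_le _ _)).trans (ha.trans (Nat.le_add_right _ _))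
  | mul a b ha hb =>
    rw [eval, width, add_mul]
    exact size_mul_le ha hb
  | div a b ha hb =>
    rw [eval, width, add_mul]
    exact (Nat.size_le_size (Nat.div_le_self _ _)).trans (ha.trans (Nat.le_add_right _ _))

/-- The first registers of the state hold the entries of the list. -/
def Agrees (l : List ℕ) (s : State) : Prop := ∀ i < l.length, s.reg i = l.getD i 0

theorem Agrees.of_eq {l : List ℕ} {s s' : State} (h : Agrees l s) {t : ℕ} (ht : l.length ≤ t)
    (hs : ∀ r < t, s'.reg r = s.reg r) : Agrees l s' :=
  fun i hi => (hs i (by omega)).trans (h i hi)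

/-- One binary operation, after its operands have been computed. -/
theorem exec_compile_binary {l : List ℕ} {u : ℕ} {a b : RegExpr}
    {op : ℕ → ℕ → ℕ} {instr : ℕ → ℕ → ℕ → Prog}
    (hinstr : ∀ (s : State) (t x y : ℕ), Exec (instr t x y) s
      (1 + (s.reg x).size + (s.reg y).size) (s.set t (op (s.reg x) (s.reg y))))
    (hl : ∀ x ∈ l, x.size + 1 ≤ u) (hu : 1 ≤ u)
    (ha : ∀ (t : ℕ) (s : State), l.length ≤ t → Agrees l s → ∃ c s', Exec (a.compile t) s c s' ∧
      c ≤ a.cost * u ∧ s'.reg t = a.eval l ∧ (∀ r < t, s'.reg r = s.reg r) ∧ s'.out = s.out)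
    (hb : ∀ (t : ℕ) (s : State), l.length ≤ t → Agrees l s → ∃ c s', Exec (b.compile t) s c s' ∧
      c ≤ b.cost * u ∧ s'.reg t = b.eval l ∧ (∀ r < t, s'.reg r = s.reg r) ∧ s'.out = s.out)
    (t : ℕ) (s : State) (ht : l.length ≤ t) (hs : Agrees l s) :
    ∃ c s', Exec (.seq (a.compile t) (.seq (b.compile (t + 1)) (instr t t (t + 1)))) s c s' ∧
      c ≤ (a.cost + b.cost + a.width + b.width + 1) * u ∧
      s'.reg t = op (a.eval l) (b.eval l) ∧ (∀ r < t, s'.reg r = s.reg r) ∧ s'.out = s.out := by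
  obtain ⟨c₁, s₁, e₁, hc₁, v₁, r₁, o₁⟩ := ha t s ht hs
  obtain ⟨c₂, s₂, e₂, hc₂, v₂, r₂, o₂⟩ := hb (t + 1) s₁ (by omega) (hs.of_eq ht r₁)
  have hv : s₂.reg t = a.eval l := (r₂ t (by omega)).trans v₁
  refine ⟨_, _, .seq e₁ (.seq e₂ (hinstr s₂ t t (t + 1))), ?_, ?_, fun r hr => ?_, ?_⟩
  · rw [hv, v₂]
    have h1 := a.size_eval_le hl hu
    have h2 := b.size_eval_le hl hu
    simp only [add_mul, one_mul]
    omega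
  · simp [State.set, hv, v₂]
  · simp only [State.set]
    rw [Function.update_of_ne (by omega), r₂ r (by omega), r₁ r hr]
  · exact o₂.trans o₁

theorem RegExpr.exec_compile (e : RegExpr) {l : List ℕ} {u : ℕ} (hl : ∀ x ∈ l, x.size + 1 ≤ u)
    (hu : 1 ≤ u) (he : e.varsLt l.length = true) (t : ℕ) (s : State) (ht : l.length ≤ t)
    (hs : Agrees l s) : ∃ c s', Exec (e.compile t) s c s' ∧ c ≤ e.cost * u ∧
      s'.reg t = e.eval l ∧ (∀ r < t, s'.reg r = s.reg r) ∧ s'.out = s.out := by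
  induction e generalizing t s with
  | var r =>
    have hr : r < l.length := by simpa [varsLt] using he
    have hrt : r ≠ t := by omega
    refine ⟨_, _, .seq (.const s t 0) (.add _ t r t), ?_, ?_, fun r' hr' => ?_, rfl⟩
    · have h1 := (RegExpr.var r).size_eval_le hl hu
      simp only [State.set, Function.update_self, Function.update_of_ne hrt, hs r hr, cost]
      simp only [eval, width] at h1
      simp only [Nat.size_zero]
      omega
    · simp [State.set, hrt, hs r hr, eval]
    · simp only [State.set]
      rw [Function.update_of_ne (by omega), Function.update_of_ne (by omega)]
  | lit k =>
    refine ⟨_, _, .const s t k, ?_, ?_, fun r hr => ?_, rfl⟩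
    · have := size_le_self k
      simp only [cost]
      nlinarith
    · simp [State.set, eval]
    · simp only [State.set]
      rw [Function.update_of_ne (by omega)]
  | add a b ha hb =>
    simp only [varsLt, Bool.and_eq_true] at he
    exact exec_compile_binary (op := (· + ·)) Exec.add hl hu (ha he.1) (hb he.2) t s ht hs
  | sub a b ha hb =>
    simp only [varsLt, Bool.and_eq_true] at he
    exact exec_compile_binary (op := (· - ·)) Exec.sub hl hu (ha he.1) (hb he.2) t s ht hs
  | mul a b ha hb =>
    simp only [varsLt, Bool.and_eq_true] at he
    exact exec_compile_binary (op := (· * ·)) Exec.mul hl hu (ha he.1) (hb he.2) t s ht hs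
  | div a b ha hb =>
    simp only [varsLt, Bool.and_eq_true] at he
    exact exec_compile_binary (op := (· / ·)) Exec.div hl hu (ha he.1) (hb he.2) t s ht hs

/-- The first scratch register. -/
def scratch : ℕ := 40

/-- `R x := e` -/
def assign (x : ℕ) (e : RegExpr) : Prog :=
  .seq (e.compile scratch) (.seq (.const (scratch + 1) 0) (.add x scratch (scratch + 1)))

/-- append the value of `e` to the output -/
def write (e : RegExpr) : Prog := .seq (e.compile scratch) (.emit scratch)

/-- Started with registers `l`, all bounded by `V`, and output `o`, the program halts with
registers `l'`, bounded by `V`, and output `o'`, at a cost of at most `t` times one plus the bit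
length of `V`. -/
def Runs (V : ℕ) (P : Prog) (l o : List ℕ) (t : ℕ) (l' o' : List ℕ) : Prop :=
  (∀ a ∈ l, a ≤ V) → (∀ a ∈ l', a ≤ V) ∧ ∀ s : State, Agrees l s → s.out = o →
    ∃ c s', Exec P s c s' ∧ c ≤ t * (V.size + 1) ∧ Agrees l' s' ∧ s'.out = o'

theorem Runs.seq {V : ℕ} {P Q : Prog} {l o l' o' l'' o'' : List ℕ} {t t' : ℕ}
    (hP : Runs V P l o t l' o') (hQ : Runs V Q l' o' t' l'' o'') :
    Runs V (.seq P Q) l o (t + t') l'' o'' := by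
  intro hl
  obtain ⟨hl', hP⟩ := hP hl
  obtain ⟨hl'', hQ⟩ := hQ hl'
  refine ⟨hl'', fun s hs ho => ?_⟩
  obtain ⟨c, s', e, hc, hs', ho'⟩ := hP s hs ho
  obtain ⟨c', s'', e', hc', hs'', ho''⟩ := hQ s' hs' ho'
  exact ⟨_, s'', .seq e e', by rw [add_mul]; omega, hs'', ho''⟩

theorem Runs.cast {V : ℕ} {P : Prog} {l o l' o' l'' o'' : List ℕ} {t t' : ℕ}
    (h : Runs V P l o t l' o') (ht : t ≤ t') (hl : l' = l'') (ho : o' = o'') :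
    Runs V P l o t' l'' o'' := by
  subst hl ho
  intro hb
  obtain ⟨hl', h⟩ := h hb
  refine ⟨hl', fun s hs hso => ?_⟩
  obtain ⟨c, s', e, hc, hagree, hout⟩ := h s hs hso
  exact ⟨c, s', e, hc.trans (Nat.mul_le_mul_right _ ht), hagree, hout⟩

/-- Forget registers. -/
theorem Runs.forget {V : ℕ} {P : Prog} {l o l' o' : List ℕ} {t : ℕ} (m : List ℕ)
    (h : Runs V P l o t (l' ++ m) o') : Runs V P l o t l' o' := by
  intro hl
  obtain ⟨hl', h⟩ := h hl
  refine ⟨fun a ha => hl' a (List.mem_append_left _ ha), fun s hs ho => ?_⟩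
  obtain ⟨c, s', e, hc, hs', ho'⟩ := h s hs ho
  refine ⟨c, s', e, hc, fun i hi => ?_, ho'⟩
  rw [hs' i (by rw [List.length_append]; omega), List.getD_append _ _ _ _ hi]

theorem size_add_one_le_of_le {V : ℕ} {l : List ℕ} (hl : ∀ a ∈ l, a ≤ V) :
    ∀ a ∈ l, a.size + 1 ≤ V.size + 1 :=
  fun a ha => Nat.succ_le_succ (Nat.size_le_size (hl a ha))

/-- The constant 100 covers every expression of the program, including the copy out of the scratch
register, so costs reduce to counting instructions. -/
theorem exec_assign {V : ℕ} {x : ℕ} {e : RegExpr} {l : List ℕ} (hl : ∀ a ∈ l, a ≤ V)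
    (hlen : l.length ≤ scratch) (he : e.varsLt l.length = true)
    (hcost : e.cost + e.width + 2 ≤ 100) (s : State) (hs : Agrees l s) :
    ∃ c s', Exec (assign x e) s c s' ∧ c ≤ 100 * (V.size + 1) ∧ s'.reg x = e.eval l ∧
      (∀ r < scratch, r ≠ x → s'.reg r = s.reg r) ∧ s'.out = s.out := by
  have hl' := size_add_one_le_of_le hl
  obtain ⟨c, s', ex, hc, hv, hr, ho⟩ := e.exec_compile hl' (by omega) he scratch s hlen hs
  refine ⟨_, _, .seq ex (.seq (.const s' (scratch + 1) 0) (.add _ x scratch (scratch + 1))),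
    ?_, ?_, fun r hr1 hr2 => ?_, ho⟩
  · have h1 := e.size_eval_le hl' (by omega)
    have h2 : (e.cost + e.width + 2) * (V.size + 1) ≤ 100 * (V.size + 1) :=
      Nat.mul_le_mul_right _ hcost
    simp only [add_mul] at h2
    simp only [State.set, Function.update_self,
      Function.update_of_ne (show scratch ≠ scratch + 1 by omega), hv, Nat.size_zero]
    omega
  · simp [State.set, hv]
  · simp only [State.set]
    rw [Function.update_of_ne hr2, Function.update_of_ne (by omega), hr r hr1]

/-- An assignment of `e` to register `x` is admissible if the first `k` registers are known. -/
def admissible (x k : ℕ) (e : RegExpr) : Bool :=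
  decide (x ≤ k ∧ x < scratch ∧ k ≤ scratch ∧ e.cost + e.width + 2 ≤ 100) && e.varsLt k

theorem admissible_iff {x k : ℕ} {e : RegExpr} : admissible x k e = true ↔
    (x ≤ k ∧ x < scratch ∧ k ≤ scratch ∧ e.cost + e.width + 2 ≤ 100) ∧ e.varsLt k = true := by
  simp [admissible]

/-- Assignment to a known register. -/
theorem Runs.assign_set {V : ℕ} {l o : List ℕ} (x : ℕ) (e : RegExpr) (v : ℕ) (hv : e.eval l = v)
    (hvV : v ≤ V) (hx : x < l.length) (hok : admissible x l.length e = true) :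
    Runs V (assign x e) l o 100 (l.set x v) o := by
  obtain ⟨⟨-, -, hlen, hcost⟩, he⟩ := admissible_iff.1 hok
  intro hl
  refine ⟨fun a ha => ?_, fun s hs ho => ?_⟩
  · rcases List.mem_or_eq_of_mem_set ha with ha | rfl
    · exact hl a ha
    · exact hvV
  · obtain ⟨c, s', ex, hc, hv', hr, ho'⟩ := exec_assign hl (x := x) hlen he hcost s hs
    refine ⟨c, s', ex, hc, fun i hi => ?_, ho'.trans ho⟩
    rw [List.length_set] at hi
    by_cases hix : i = x
    · subst hix
      rw [hv', hv, List.getD_eq_getElem _ _ (by simpa using hx)]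
      simp
    · rw [hr i (by omega) hix, hs i hi, List.getD_eq_getElem _ _ hi,
        List.getD_eq_getElem _ _ (by simpa using hi), List.getElem_set_ne (Ne.symm hix)]

/-- Assignment to the first unknown register. -/
theorem Runs.assign_push {V : ℕ} {l o : List ℕ} (x : ℕ) (e : RegExpr) (v : ℕ) (hv : e.eval l = v)
    (hvV : v ≤ V) (hx : x = l.length) (hok : admissible x l.length e = true) :
    Runs V (assign x e) l o 100 (l ++ [v]) o := by
  obtain ⟨⟨-, hlen, -, hcost⟩, he⟩ := admissible_iff.1 hok
  intro hl
  refine ⟨fun a ha => ?_, fun s hs ho => ?_⟩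
  · rcases List.mem_append.1 ha with ha | ha
    · exact hl a ha
    · rw [List.mem_singleton.1 ha]
      exact hvV
  · obtain ⟨c, s', ex, hc, hv', hr, ho'⟩ := exec_assign hl (x := x) (by omega) he hcost s hs
    refine ⟨c, s', ex, hc, fun i hi => ?_, ho'.trans ho⟩
    rw [List.length_append, List.length_singleton] at hi
    by_cases hix : i = x
    · rw [hix, hv', hv, hx]
      simp
    · rw [hr i (by omega) hix, hs i (by omega), List.getD_append _ _ _ _ (by omega)]

/-- A written value may exceed `V`: its cost is bounded through the width of the expression, so the
exponents in the output impose no condition on `V`. -/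
theorem Runs.write {V : ℕ} {l o : List ℕ} (e : RegExpr) (v : ℕ) (hv : e.eval l = v)
    (hok : admissible 0 l.length e = true) : Runs V (write e) l o 100 l (o ++ [v]) := by
  obtain ⟨⟨-, -, hlen, hcost⟩, he⟩ := admissible_iff.1 hok
  intro hl
  refine ⟨hl, fun s hs ho => ?_⟩
  have hl' := size_add_one_le_of_le hl
  obtain ⟨c, s', ex, hc, hv', hr, ho'⟩ := e.exec_compile hl' (by omega) he scratch s hlen hs
  refine ⟨_, _, .seq ex (.emit s' scratch), ?_, hs.of_eq hlen hr, ?_⟩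
  · have h1 := e.size_eval_le hl' (by omega)
    have h2 : (e.cost + e.width + 2) * (V.size + 1) ≤ 100 * (V.size + 1) :=
      Nat.mul_le_mul_right _ hcost
    simp only [add_mul] at h2
    rw [hv']
    omega
  · simp [ho', ho, hv', hv]

/-- A loop with invariant `inv`, which is left after `k` rounds. -/
theorem Runs.loop {V x t : ℕ} {P : Prog} (k : ℕ) (inv g : ℕ → List ℕ) (o : List ℕ)
    (hx : ∀ j ≤ k, x < (inv j).length) (hne : ∀ j < k, (inv j).getD x 0 ≠ 0)
    (h0 : (inv k).getD x 0 = 0)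
    (hbody : ∀ j < k, ∀ o, Runs V P (inv j) o t (inv (j + 1)) (o ++ g j)) :
    Runs V (.loop x P) (inv 0) o (k * (t + 1) + 1) (inv k) (o ++ (List.range k).flatMap g) := by
  induction k generalizing inv g o with
  | zero =>
    intro hl
    refine ⟨hl, fun s hs ho => ⟨1, s, .loop_done ?_, by omega, hs, by simpa using ho⟩⟩
    rw [hs x (hx 0 le_rfl), h0]
  | succ k ih =>
    intro hl
    obtain ⟨hl₁, hb⟩ := hbody 0 (by omega) o hl
    obtain ⟨hl', hloop⟩ := ih (fun j => inv (j + 1)) (fun j => g (j + 1)) (o ++ g 0)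
      (fun j hj => hx (j + 1) (by omega)) (fun j hj => hne (j + 1) (by omega)) h0
      (fun j hj => hbody (j + 1) (by omega)) hl₁
    refine ⟨hl', fun s hs ho => ?_⟩
    obtain ⟨c, s', e, hc, hs', ho'⟩ := hb s hs ho
    obtain ⟨c', s'', e', hc', hs'', ho''⟩ := hloop s' hs' ho'
    have hreg : s.reg x = (inv 0).getD x 0 := hs x (hx 0 (by omega))
    refine ⟨_, s'', .loop_step (by rw [hreg]; exact hne 0 (by omega)) e e', ?_, hs'', ?_⟩
    · have h1 : (s.reg x).size ≤ V.size := by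
        rw [hreg]
        refine Nat.size_le_size (hl _ ?_)
        rw [List.getD_eq_getElem _ _ (hx 0 (by omega))]
        exact List.getElem_mem _
      have h2 : ((k + 1) * (t + 1) + 1) * (V.size + 1) =
          (V.size + 1) + t * (V.size + 1) + (k * (t + 1) + 1) * (V.size + 1) := by ring
      omega
    · rw [ho'', List.range_succ_eq_map, List.flatMap_cons, List.flatMap_map, List.append_assoc]

end RAM

end

noncomputable section

/-! ## The program that writes down the algebra and the hitting set -/

namespace RAM

open RAM.RegExpr

/-- `a mod b` -/
def RegExpr.mod (a b : RegExpr) : RegExpr := .sub a (.mul (.div a b) b)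

theorem RegExpr.eval_mod (l : List ℕ) (a b : RegExpr) :
    (a.mod b).eval l = a.eval l % b.eval l := by
  simp only [RegExpr.mod, RegExpr.eval]
  rw [Nat.mod_eq_sub_div_mul]

/-- One round of the computation of a weight. The registers hold `n`, `r`, `d`, `2 ^ h`, `3 ^ h`,
`h`, `(r * (d + 1)) ^ 8`, the bound `N` for the moduli, the order of the root of unity, the base of
the weights, the scale, the number of points, two registers for each of the loops over the points
and the coordinates, the code of a position, a power of `2`, a counter for positions,
the weight, the remaining digits and a counter for rounds. -/
def weightRound : Prog :=
  .seq (assign 22 (.add ((var 20).mod (var 7)) (lit 1)))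
  (.seq (assign 19 (.add (.mul (var 9) (var 19))
    (RegExpr.mod (.mul (.add (var 15) (lit 1)) (var 16)) (var 22))))
  (.seq (assign 20 (.div (var 20) (var 7)))
  (assign 21 (.sub (var 21) (lit 1)))))

/-- Computes the weight of a letter. -/
def weightProg : Prog :=
  .seq (assign 19 (.add (var 15) (lit 1)))
  (.seq (assign 20 (var 13))
  (.seq (assign 21 (var 5))
  (.loop 21 weightRound)))

/-- Writes one term. -/
def termRound : Prog :=
  .seq (write (lit 1))
  (.seq (write (lit 0))
  (.seq (write (lit 1))
  (.seq (write (.add (.mul (var 10) (var 19))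
    (.mul (var 20) (.sub (var 8) ((var 17).mod (var 8))))))
  (.seq (write (var 20))
  (.seq (write (lit 1))
  (.seq (assign 20 (.add (var 20) (lit 1)))
  (assign 21 (.sub (var 21) (lit 1)))))))))

/-- Writes the terms for one position. -/
def positionRound : Prog :=
  .seq weightProg
  (.seq (assign 20 (lit 0))
  (.seq (assign 21 (var 8))
  (.seq (.loop 21 termRound)
  (.seq (assign 16 (.mul (var 16) (.add (var 0) (lit 1))))
  (.seq (assign 17 (.mul (lit 2) (var 17)))
  (assign 18 (.sub (var 18) (lit 1))))))))

/-- Writes one coordinate of a point. -/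
def coordinateRound : Prog :=
  .seq (write (.mul (var 2) (var 8)))
  (.seq (assign 16 (lit 1))
  (.seq (assign 17 (lit 1))
  (.seq (assign 18 (var 2))
  (.seq (.loop 18 positionRound)
  (.seq (assign 15 (.add (var 15) (lit 1)))
  (assign 14 (.sub (var 14) (lit 1))))))))

/-- Writes one point. -/
def pointRound : Prog :=
  .seq (assign 14 (var 0))
  (.seq (assign 15 (lit 0))
  (.seq (.loop 14 coordinateRound)
  (.seq (assign 13 (.add (var 13) (lit 1)))
  (assign 12 (.sub (var 12) (lit 1))))))

variable {V n r d Y L h u N m B E Q : ℕ}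

/-- Four assignments and a test per round give 401; the three initial assignments and the last test
give 301. -/
theorem runs_weightProg {cq q ci i kp gp ck : ℕ} (wt : ℕ → ℕ) (h0 : wt 0 = i + 1)
    (hs : ∀ j < h, wt (j + 1) = B * wt j + (i + 1) * kp % (q / N ^ j % N + 1))
    (hwt : ∀ j ≤ h, wt j ≤ V) (hq : q ≤ V) (hh : h ≤ V) (hN : N < V) (hN0 : 0 < N) (o : List ℕ) :
    Runs V weightProg [n, r, d, Y, L, h, u, N, m, B, E, Q, cq, q, ci, i, kp, gp, ck] o
      (401 * h + 301)
      [n, r, d, Y, L, h, u, N, m, B, E, Q, cq, q, ci, i, kp, gp, ck, wt h] o := by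
  have hloop := Runs.loop (V := V) (x := 21) (t := 400) (P := weightRound) h
    (fun j => [n, r, d, Y, L, h, u, N, m, B, E, Q, cq, q, ci, i, kp, gp, ck, wt j, q / N ^ j,
      h - j]) (fun _ => []) o (fun j _ => by simp) (fun j hj => by simp; omega) (by simp)
    (fun j hj o => by
      -- Register 22 holds the modulus only during a round and is dropped to restore the invariant.
      refine Runs.forget [q / N ^ j % N + 1] ?_
      refine Runs.cast (Runs.seq (Runs.assign_push 22 _ (q / N ^ j % N + 1) ?_ ?_ rfl rfl)
        (Runs.seq (Runs.assign_set 19 _ (wt (j + 1)) ?_ (hwt _ (by omega)) (by simp) rfl)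
        (Runs.seq (Runs.assign_set 20 _ (q / N ^ (j + 1)) ?_
          ((Nat.div_le_self _ _).trans hq) (by simp) rfl)
        (Runs.assign_set 21 _ (h - (j + 1)) ?_ ((Nat.sub_le _ _).trans hh) (by simp) rfl))))
        (by norm_num) rfl (by simp)
      · simp [RegExpr.eval, RegExpr.eval_mod]
      · have := Nat.mod_lt (q / N ^ j) hN0
        omega
      · simp [RegExpr.eval, RegExpr.eval_mod, hs j hj]
      · simp [RegExpr.eval, Nat.div_div_eq_div_mul, pow_succ]
      · simp [RegExpr.eval]
        omega)
  refine Runs.forget [q / N ^ h, h - h] ?_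
  refine Runs.cast (Runs.seq (Runs.assign_push 19 _ (wt 0) ?_ (hwt 0 (by omega)) rfl rfl)
    (Runs.seq (Runs.assign_push 20 _ (q / N ^ 0) ?_ ?_ rfl rfl)
    (Runs.seq (Runs.assign_push 21 _ (h - 0) ?_ hh rfl rfl) hloop))) (by omega) rfl (by simp)
  · simp [RegExpr.eval, h0]
  · simp [RegExpr.eval]
  · simpa using hq
  · simp [RegExpr.eval]

/-- The six numbers that stand for a term. -/
def termCode (E m g W c : ℕ) : List ℕ := [1, 0, 1, E * W + c * (m - g % m), c, 1]

/-- For position `k`, `kp` and `gp` stand for `(n + 1) ^ k` and `2 ^ k`, updated by one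
multiplication each. Registers 20 and 21 are reused for the loop over the terms once the weight is
known. -/
theorem runs_positionRound {cq q ci i kp gp ck : ℕ} (wt : ℕ → ℕ) (h0 : wt 0 = i + 1)
    (hs : ∀ j < h, wt (j + 1) = B * wt j + (i + 1) * kp % (q / N ^ j % N + 1))
    (hwt : ∀ j ≤ h, wt j ≤ V) (hq : q ≤ V) (hh : h ≤ V) (hN : N < V) (hN0 : 0 < N) (hm : m ≤ V)
    (hkp : kp * (n + 1) ≤ V) (hgp : 2 * gp ≤ V) (hck : ck ≤ V) (o : List ℕ) :
    Runs V positionRound [n, r, d, Y, L, h, u, N, m, B, E, Q, cq, q, ci, i, kp, gp, ck] o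
      (401 * h + 801 * m + 802)
      [n, r, d, Y, L, h, u, N, m, B, E, Q, cq, q, ci, i, kp * (n + 1), 2 * gp, ck - 1]
      (o ++ (List.range m).flatMap (termCode E m gp (wt h))) := by
  have hloop := Runs.loop (V := V) (x := 21) (t := 800) (P := termRound) m
    (fun j => [n, r, d, Y, L, h, u, N, m, B, E, Q, cq, q, ci, i, kp, gp, ck, wt h, j, m - j])
    (termCode E m gp (wt h)) o (fun j _ => by simp) (fun j hj => by simp; omega) (by simp)
    (fun j hj o => by
      refine Runs.cast (Runs.seq (Runs.write _ 1 rfl rfl) (Runs.seq (Runs.write _ 0 rfl rfl)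
        (Runs.seq (Runs.write _ 1 rfl rfl) (Runs.seq
          (Runs.write _ (E * wt h + j * (m - gp % m)) ?_ rfl)
        (Runs.seq (Runs.write _ j rfl rfl) (Runs.seq (Runs.write _ 1 rfl rfl)
        (Runs.seq (Runs.assign_set 20 _ (j + 1) rfl (by omega) (by simp) rfl)
        (Runs.assign_set 21 _ (m - (j + 1)) ?_ ((Nat.sub_le _ _).trans hm) (by simp) rfl))))))))
        (by norm_num) rfl (by simp [termCode])
      · simp [RegExpr.eval, RegExpr.eval_mod]
      · simp [RegExpr.eval]
        omega)
  refine Runs.forget [wt h, m, m - m] ?_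
  refine Runs.cast (Runs.seq (runs_weightProg wt h0 hs hwt hq hh hN hN0 o)
    (Runs.seq (Runs.assign_push 20 _ 0 rfl (Nat.zero_le _) rfl rfl)
    (Runs.seq (Runs.assign_push 21 _ m rfl hm rfl rfl)
    (Runs.seq hloop
    (Runs.seq (Runs.assign_set 16 _ (kp * (n + 1)) rfl hkp (by simp) rfl)
    (Runs.seq (Runs.assign_set 17 _ (2 * gp) rfl hgp (by simp) rfl)
    (Runs.assign_set 18 _ (ck - 1) rfl ((Nat.sub_le _ _).trans hck) (by simp) rfl)))))))
    (by omega) rfl rfl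

/-- After the last position the registers hold `(n + 1) ^ d` and `2 ^ d`. This makes `V` exponential
in `d`, which is harmless since only its bit length is charged. -/
theorem runs_coordinateRound {cq q ci i : ℕ} (wt : ℕ → ℕ → ℕ) (h0 : ∀ k < d, wt k 0 = i + 1)
    (hs : ∀ k < d, ∀ j < h, wt k (j + 1) =
      B * wt k j + (i + 1) * (n + 1) ^ k % (q / N ^ j % N + 1))
    (hwt : ∀ k < d, ∀ j ≤ h, wt k j ≤ V) (hq : q ≤ V) (hh : h ≤ V) (hN : N < V) (hN0 : 0 < N)
    (hm : m ≤ V) (hd : d ≤ V) (hkp : (n + 1) ^ d ≤ V) (hgp : 2 ^ d ≤ V) (hi : i < V)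
    (hci : ci ≤ V) (o : List ℕ) :
    Runs V coordinateRound [n, r, d, Y, L, h, u, N, m, B, E, Q, cq, q, ci, i] o
      (d * (401 * h + 801 * m + 803) + 601)
      [n, r, d, Y, L, h, u, N, m, B, E, Q, cq, q, ci - 1, i + 1]
      (o ++ ([d * m] ++ (List.range d).flatMap fun k =>
        (List.range m).flatMap (termCode E m (2 ^ k) (wt k h)))) := by
  have hV : 1 ≤ V := by omega
  have hloop := Runs.loop (V := V) (x := 18) (t := 401 * h + 801 * m + 802) (P := positionRound) d
    (fun k => [n, r, d, Y, L, h, u, N, m, B, E, Q, cq, q, ci, i, (n + 1) ^ k, 2 ^ k, d - k])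
    (fun k => (List.range m).flatMap (termCode E m (2 ^ k) (wt k h))) (o ++ [d * m])
    (fun j _ => by simp) (fun j hj => by simp; omega) (by simp)
    (fun k hk o => by
      refine Runs.cast (runs_positionRound (wt k) (h0 k hk) (hs k hk) (hwt k hk) hq hh hN hN0 hm
        ?_ ?_ ((Nat.sub_le _ _).trans hd) o) le_rfl ?_ rfl
      · rw [← pow_succ]
        exact (Nat.pow_le_pow_right (by omega) hk).trans hkp
      · rw [← pow_succ']
        exact (Nat.pow_le_pow_right (by omega) hk).trans hgp
      · rw [pow_succ, pow_succ', Nat.sub_sub])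
  refine Runs.forget [(n + 1) ^ d, 2 ^ d, d - d] ?_
  refine Runs.cast (Runs.seq (Runs.write _ (d * m) rfl rfl)
    (Runs.seq (Runs.assign_push 16 _ ((n + 1) ^ 0) rfl hV rfl rfl)
    (Runs.seq (Runs.assign_push 17 _ (2 ^ 0) rfl hV rfl rfl)
    (Runs.seq (Runs.assign_push 18 _ (d - 0) rfl hd rfl rfl)
    (Runs.seq hloop
    (Runs.seq (Runs.assign_set 15 _ (i + 1) rfl hi (by simp) rfl)
    (Runs.assign_set 14 _ (ci - 1) rfl ((Nat.sub_le _ _).trans hci) (by simp) rfl)))))))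
    (by linarith) rfl (by simp)

/-- The numbers that stand for the coordinate `i` of the point `q`. -/
def coordCode (d h m E : ℕ) (wt : ℕ → ℕ → ℕ → ℕ → ℕ) (q i : ℕ) : List ℕ :=
  [d * m] ++ (List.range d).flatMap fun k =>
    (List.range m).flatMap (termCode E m (2 ^ k) (wt q i k h))

theorem runs_pointRound {cq q : ℕ} (wt : ℕ → ℕ → ℕ → ℕ → ℕ)
    (h0 : ∀ i < n, ∀ k < d, wt q i k 0 = i + 1)
    (hs : ∀ i < n, ∀ k < d, ∀ j < h, wt q i k (j + 1) =
      B * wt q i k j + (i + 1) * (n + 1) ^ k % (q / N ^ j % N + 1))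
    (hwt : ∀ i < n, ∀ k < d, ∀ j ≤ h, wt q i k j ≤ V) (hq : q < V) (hh : h ≤ V) (hN : N < V)
    (hN0 : 0 < N) (hm : m ≤ V) (hd : d ≤ V) (hkp : (n + 1) ^ d ≤ V) (hgp : 2 ^ d ≤ V) (hn : n ≤ V)
    (hcq : cq ≤ V) (o : List ℕ) :
    Runs V pointRound [n, r, d, Y, L, h, u, N, m, B, E, Q, cq, q] o
      (n * (d * (401 * h + 801 * m + 803) + 602) + 401)
      [n, r, d, Y, L, h, u, N, m, B, E, Q, cq - 1, q + 1]
      (o ++ (List.range n).flatMap (coordCode d h m E wt q)) := by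
  have hloop := Runs.loop (V := V) (x := 14) (t := d * (401 * h + 801 * m + 803) + 601)
    (P := coordinateRound) n
    (fun i => [n, r, d, Y, L, h, u, N, m, B, E, Q, cq, q, n - i, i])
    (coordCode d h m E wt q) o
    (fun j _ => by simp) (fun j hj => by simp; omega) (by simp)
    (fun i hi o => Runs.cast (runs_coordinateRound (wt q i) (h0 i hi) (hs i hi) (hwt i hi) hq.le hh
        hN hN0 hm hd hkp hgp (by omega) ((Nat.sub_le _ _).trans hn) o) le_rfl
        (by rw [Nat.sub_sub]) rfl)
  refine Runs.forget [n - n, n] ?_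
  exact Runs.cast (Runs.seq (Runs.assign_push 14 _ (n - 0) rfl hn rfl rfl)
    (Runs.seq (Runs.assign_push 15 _ 0 rfl (Nat.zero_le _) rfl rfl)
    (Runs.seq hloop
    (Runs.seq (Runs.assign_set 13 _ (q + 1) rfl hq (by simp) rfl)
    (Runs.assign_set 12 _ (cq - 1) rfl ((Nat.sub_le _ _).trans hcq) (by simp) rfl)))))
    (by linarith) rfl rfl

end RAM

end

/-! ### The complete program and its cost. -/

noncomputable section

namespace RAM

open RAM.RegExpr

/-- One round of the computation of `2 ^ h`, `3 ^ h` and `h`. -/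
def heightRound : Prog :=
  .seq (assign 3 (.mul (lit 2) (var 3)))
  (.seq (assign 4 (.mul (lit 3) (var 4)))
  (.seq (assign 5 (.add (var 5) (lit 1)))
  (assign 6 (.sub (var 2) (var 3)))))

/-- Computes `2 ^ h`, `3 ^ h` and `h`, where `h` is minimal with `d ≤ 2 ^ h`. -/
def heightProg : Prog :=
  .seq (assign 3 (lit 1))
  (.seq (assign 4 (lit 1))
  (.seq (assign 5 (lit 0))
  (.seq (assign 6 (.sub (var 2) (var 3)))
  (.loop 6 heightRound))))

/-- Computes the parameters of the hitting set. -/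
def parameterProg : Prog :=
  .seq (assign 6 (.mul (var 1) (.add (var 2) (lit 1))))
  (.seq (assign 6 (.mul (var 6) (var 6)))
  (.seq (assign 6 (.mul (var 6) (var 6)))
  (.seq (assign 6 (.mul (var 6) (var 6)))
  (.seq (assign 7 (.mul (lit 2) (.add (.mul (.mul (.mul (var 0) (var 3)) (var 6)) (var 3)) (lit 1))))
  (.seq (assign 8 (.mul (lit 3) (var 4)))
  (.seq (assign 9 (.add (.mul (var 3) (var 7)) (lit 1)))
  (assign 10 (.add (.mul (var 2) (.mul (var 8) (var 8))) (lit 1)))))))))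

/-- Computes the number of points. -/
def countProg : Prog :=
  .seq (assign 11 (lit 1))
  (.seq (assign 12 (var 5))
  (.loop 12 (.seq (assign 11 (.mul (var 11) (var 7))) (assign 12 (.sub (var 12) (lit 1))))))

/-- Writes down the algebra and the hitting set. -/
def hittingProg : Prog :=
  .seq heightProg
  (.seq parameterProg
  (.seq countProg
  (.seq (write (.mul (lit 2) (var 4)))
  (.seq (write (var 8))
  (.seq (write (lit 2))
  (.seq (write (var 11))
  (.seq (assign 12 (var 11))
  (.seq (assign 13 (lit 0))
  (.loop 12 pointRound)))))))))

theorem runs_heightProg {V n r d h : ℕ} (hh : h = Nat.clog 2 d) (hd : d ≤ V) (h3 : 3 ^ h ≤ V)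
    (o : List ℕ) :
    Runs V heightProg [n, r, d] o (401 * h + 401) [n, r, d, 2 ^ h, 3 ^ h, h] o := by
  have hV : 1 ≤ V := (Nat.one_le_pow _ _ (by norm_num)).trans h3
  have hd2 : d ≤ 2 ^ h := hh ▸ Nat.le_pow_clog (by norm_num) d
  have h3' : ∀ j ≤ h, 3 ^ j ≤ V := fun j hj => (Nat.pow_le_pow_right (by norm_num) hj).trans h3
  have h2' : ∀ j ≤ h, 2 ^ j ≤ V := fun j hj => (Nat.pow_le_pow_left (by norm_num) j).trans (h3' j hj)
  have hloop := Runs.loop (V := V) (x := 6) (t := 400) (P := heightRound) h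
    (fun j => [n, r, d, 2 ^ j, 3 ^ j, j, d - 2 ^ j]) (fun _ => []) o (fun j _ => by simp)
    -- The truncated difference `d - 2 ^ j` is nonzero precisely while `j < Nat.clog 2 d`.
    (fun j hj => by
      have : 2 ^ j < d := by
        by_contra hc
        exact absurd (Nat.clog_le_of_le_pow (not_lt.1 hc)) (by omega)
      simp
      omega) (Nat.sub_eq_zero_of_le hd2)
    (fun j hj o => by
      refine Runs.cast (Runs.seq (Runs.assign_set 3 _ (2 ^ (j + 1)) (pow_succ' 2 j).symm
          (h2' _ hj) (by simp) rfl)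
        (Runs.seq (Runs.assign_set 4 _ (3 ^ (j + 1)) (pow_succ' 3 j).symm
          (h3' _ hj) (by simp) rfl)
        (Runs.seq (Runs.assign_set 5 _ (j + 1) rfl
          (Nat.lt_two_pow_self.le.trans (h2' _ hj)) (by simp) rfl)
        (Runs.assign_set 6 _ (d - 2 ^ (j + 1)) rfl ((Nat.sub_le _ _).trans hd) (by simp) rfl))))
        (by norm_num) rfl (by simp))
  refine Runs.forget [d - 2 ^ h] ?_
  exact Runs.cast (Runs.seq (Runs.assign_push 3 _ (2 ^ 0) rfl hV rfl rfl)
    (Runs.seq (Runs.assign_push 4 _ (3 ^ 0) rfl hV rfl rfl)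
    (Runs.seq (Runs.assign_push 5 _ 0 rfl (Nat.zero_le _) rfl rfl)
    (Runs.seq (Runs.assign_push 6 _ (d - 2 ^ 0) rfl ((Nat.sub_le _ _).trans hd) rfl rfl) hloop))))
    (by omega) rfl (by simp)

theorem runs_parameterProg {V n r d Y L h u N m B E : ℕ} (hu : u = (r * (d + 1)) ^ 8)
    (hN : N = 2 * (n * Y * u * Y + 1)) (hm : m = 3 * L) (hB : B = Y * N + 1)
    (hE : E = d * (m * m) + 1) (huV : u ≤ V) (hNV : N ≤ V) (hmV : m ≤ V) (hBV : B ≤ V)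
    (hEV : E ≤ V) (o : List ℕ) :
    Runs V parameterProg [n, r, d, Y, L, h] o 800 [n, r, d, Y, L, h, u, N, m, B, E] o := by
  set b := r * (d + 1) with hb
  -- The eighth power is reached by three squarings, so the intermediate powers need a bound too.
  have hbV : ∀ k ≤ 8, k ≠ 0 → b ^ k ≤ V := by
    intro k hk hk0
    rcases Nat.eq_zero_or_pos b with h0 | h0
    · rw [h0, zero_pow hk0]
      exact Nat.zero_le _
    · exact (Nat.pow_le_pow_right h0 hk).trans (hu ▸ huV)
  refine Runs.cast (Runs.seq (Runs.assign_push 6 _ (b ^ 1) (pow_one b).symm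
      (hbV 1 (by norm_num) (by norm_num)) rfl rfl)
    (Runs.seq (Runs.assign_set 6 _ (b ^ 2) ?_ (hbV 2 (by norm_num) (by norm_num)) (by simp) rfl)
    (Runs.seq (Runs.assign_set 6 _ (b ^ 4) ?_ (hbV 4 (by norm_num) (by norm_num)) (by simp) rfl)
    (Runs.seq (Runs.assign_set 6 _ u ?_ huV (by simp) rfl)
    (Runs.seq (Runs.assign_push 7 _ N hN.symm hNV rfl rfl)
    (Runs.seq (Runs.assign_push 8 _ m hm.symm hmV rfl rfl)
    (Runs.seq (Runs.assign_push 9 _ B hB.symm hBV rfl rfl)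
    (Runs.assign_push 10 _ E hE.symm hEV rfl rfl))))))))
    (by norm_num) rfl rfl
  · simp [RegExpr.eval]
    ring
  · simp [RegExpr.eval]
    ring
  · simp [RegExpr.eval, hu]
    ring

theorem runs_countProg {V n r d Y L h u N m B E : ℕ} (hN : 0 < N) (hV : N ^ h ≤ V) (hh : h ≤ V)
    (o : List ℕ) :
    Runs V countProg [n, r, d, Y, L, h, u, N, m, B, E] o (201 * h + 201)
      [n, r, d, Y, L, h, u, N, m, B, E, N ^ h] o := by
  have hNV : ∀ j ≤ h, N ^ j ≤ V := fun j hj => (Nat.pow_le_pow_right hN hj).trans hV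
  have hloop := Runs.loop (V := V) (x := 12) (t := 200)
    (P := .seq (assign 11 (.mul (var 11) (var 7))) (assign 12 (.sub (var 12) (lit 1)))) h
    (fun j => [n, r, d, Y, L, h, u, N, m, B, E, N ^ j, h - j]) (fun _ => []) o
    (fun j _ => by simp) (fun j hj => by simp; omega) (by simp)
    (fun j hj o => by
      refine Runs.cast (Runs.seq (Runs.assign_set 11 _ (N ^ (j + 1)) (pow_succ N j).symm
          (hNV _ hj) (by simp) rfl)
        (Runs.assign_set 12 _ (h - (j + 1)) ?_ ((Nat.sub_le _ _).trans hh) (by simp) rfl))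
        (by norm_num) rfl (by simp)
      simp [RegExpr.eval]
      omega)
  refine Runs.forget [h - h] ?_
  exact Runs.cast (Runs.seq (Runs.assign_push 11 _ (N ^ 0) rfl (hNV 0 (by omega)) rfl rfl)
    (Runs.seq (Runs.assign_push 12 _ (h - 0) rfl hh rfl rfl) hloop))
    (by omega) rfl (by simp)

/-- The weight of the letter `i` at position `k`, after `j` rounds. -/
def letterWeight (n B N q i k : ℕ) : ℕ → ℕ
  | 0 => i + 1
  | j + 1 => B * letterWeight n B N q i k j + (i + 1) * (n + 1) ^ k % (q / N ^ j % N + 1)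

/-- The remainder added in a round is below `B`, so the extra 1 absorbs it and the bound grows by a
factor `B` per round. -/
theorem letterWeight_succ_le {n B N q i k : ℕ} (hN : 0 < N) (hB : N ≤ B) (j : ℕ) :
    letterWeight n B N q i k j + 1 ≤ (i + 2) * B ^ j := by
  induction j with
  | zero => simp [letterWeight]
  | succ j ih =>
    have h1 := Nat.mod_lt (q / N ^ j) hN
    have h2 : (i + 1) * (n + 1) ^ k % (q / N ^ j % N + 1) < q / N ^ j % N + 1 :=
      Nat.mod_lt _ (Nat.succ_pos _)
    have h3 : B * (letterWeight n B N q i k j + 1) ≤ B * ((i + 2) * B ^ j) :=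
      Nat.mul_le_mul_left _ ih
    have h4 : (i + 2) * B ^ (j + 1) = B * ((i + 2) * B ^ j) := by ring
    rw [letterWeight, h4]
    refine le_trans ?_ h3
    rw [mul_add]
    omega

/-- The height and counting loops give `401 * h + 201 * h`, the instructions outside loops and the
final tests give 2003, and each point adds one test to its round. -/
theorem outputsWithin_hittingProg {V n r d h u N m B E : ℕ} (hh : h = Nat.clog 2 d)
    (hu : u = (r * (d + 1)) ^ 8) (hN : N = 2 * (n * 2 ^ h * u * 2 ^ h + 1)) (hm : m = 3 * 3 ^ h)
    (hB : B = 2 ^ h * N + 1) (hE : E = d * (m * m) + 1) (hnV : n ≤ V) (hrV : r ≤ V) (hdV : d ≤ V)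
    (hhV : h ≤ V) (huV : u ≤ V) (hNV : N < V) (hmV : m ≤ V) (hBV : B ≤ V) (hEV : E ≤ V)
    (hQV : N ^ h ≤ V) (hkp : (n + 1) ^ d ≤ V) (hgp : 2 ^ d ≤ V) (hwV : (n + 1) * B ^ h ≤ V) :
    OutputsWithin hittingProg [n, r, d] ([2 * 3 ^ h, m, 2, N ^ h] ++
        (List.range (N ^ h)).flatMap fun q => (List.range n).flatMap
          (coordCode d h m E (letterWeight n B N) q))
      ((602 * h + 2003 + N ^ h * (n * (d * (401 * h + 801 * m + 803) + 602) + 402)) *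
        (V.size + 1)) := by
  have hN0 : 0 < N := by omega
  have hY : 1 ≤ 2 ^ h := Nat.one_le_two_pow
  have hNB : N ≤ B := by
    rw [hB]
    nlinarith
  have hB0 : 0 < B := by omega
  have hloop := fun o => Runs.loop (V := V) (x := 12)
    (t := n * (d * (401 * h + 801 * m + 803) + 602) + 401) (P := pointRound) (N ^ h)
    (fun q => [n, r, d, 2 ^ h, 3 ^ h, h, u, N, m, B, E, N ^ h, N ^ h - q, q])
    (fun q => (List.range n).flatMap (coordCode d h m E (letterWeight n B N) q)) o
    (fun j _ => by simp) (fun j hj => by simp; omega) (by simp)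
    (fun q hq o => Runs.cast (runs_pointRound (letterWeight n B N) (fun _ _ _ _ => rfl)
      (fun _ _ _ _ _ _ => rfl) (fun i hi k _ j hj => by
        have h1 := letterWeight_succ_le (n := n) (q := q) (i := i) (k := k) hN0 hNB j
        have h2 : (i + 2) * B ^ j ≤ (n + 1) * B ^ h :=
          Nat.mul_le_mul (by omega) (Nat.pow_le_pow_right hB0 hj)
        omega) (by omega) hhV hNV hN0 hmV hdV hkp hgp hnV ((Nat.sub_le _ _).trans hQV) o)
      le_rfl (by rw [Nat.sub_sub]) rfl)
  have h3V : 3 ^ h ≤ V := by omega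
  have hrun := Runs.seq (runs_heightProg (n := n) (r := r) hh hdV h3V [])
    (Runs.seq (runs_parameterProg hu hN hm hB hE huV hNV.le hmV hBV hEV [])
    (Runs.seq (runs_countProg hN0 hQV hhV [])
    (Runs.seq (Runs.write (.mul (lit 2) (var 4)) (2 * 3 ^ h) rfl rfl)
    (Runs.seq (Runs.write (var 8) m rfl rfl)
    (Runs.seq (Runs.write (lit 2) 2 rfl rfl)
    (Runs.seq (Runs.write (var 11) (N ^ h) rfl rfl)
    (Runs.seq (Runs.assign_push 12 (var 11) (N ^ h - 0) rfl hQV rfl rfl)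
    (Runs.seq (Runs.assign_push 13 (lit 0) 0 rfl (Nat.zero_le _) rfl rfl)
    (hloop _)))))))))
  obtain ⟨-, hex⟩ := hrun (by simp [hnV, hrV, hdV])
  obtain ⟨c, s, ex, hc, -, ho⟩ := hex (init [n, r, d]) (fun i hi => rfl) rfl
  refine ⟨c, s, ex, ?_, hc.trans (Nat.mul_le_mul_right _ ?_)⟩
  · rw [ho]
    rfl
  · generalize N ^ h * _ = x
    omega

end RAM

end

noncomputable section

/-! ## The output and the running time -/

theorem isoWeight_eq_letterWeight (n B N q : ℕ) (i : Fin n) (k j : ℕ) :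
    isoWeight n B (digitModulus N q) j (k, i) = RAM.letterWeight n B N q i k j := by
  induction j with
  | zero => rfl
  | succ j ih =>
    rw [isoWeight, ih]
    rfl

theorem encode_pointTerm (n h d N q : ℕ) (i : Fin n) (k c : ℕ) :
    (pointTerm n h d N q i k c).encode = RAM.termCode (pointScale h d) (3 ^ (h + 1)) (2 ^ k)
      (RAM.letterWeight n (2 ^ h * N + 1) N q i k h) c := by
  rw [← isoWeight_eq_letterWeight]
  rfl

theorem encodeElem_pointTerms (n h d N q : ℕ) (i : Fin n) :
    encodeElem (pointTerms n h d N q i) = RAM.coordCode d h (3 ^ (h + 1)) (pointScale h d)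
      (RAM.letterWeight n (2 ^ h * N + 1) N) q i := by
  rw [encodeElem, RAM.coordCode, List.singleton_append]
  congr 1
  · simp [pointTerms, List.length_flatMap]
  · simp only [pointTerms, List.flatMap_assoc, List.flatMap_map, encode_pointTerm]

theorem flatMap_ofFn_encodeElem (n h d N q : ℕ) :
    (List.ofFn (pointTerms n h d N q)).flatMap encodeElem =
      (List.range n).flatMap (RAM.coordCode d h (3 ^ (h + 1)) (pointScale h d)
        (RAM.letterWeight n (2 ^ h * N + 1) N) q) := by
  rw [List.ofFn_eq_map, List.flatMap_map, ← List.map_coe_finRange_eq_range, List.flatMap_map]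
  simp only [encodeElem_pointTerms]

/-- The written points of the hitting set. -/
def hittingPoints (n h d N : ℕ) : List (Fin n → List DTerm) :=
  (List.range (N ^ h)).map (pointTerms n h d N)

theorem encodeOutput_hittingPoints (n h d N : ℕ) :
    encodeOutput (2 * 3 ^ h) (3 ^ (h + 1)) 2 (hittingPoints n h d N) =
      [2 * 3 ^ h, 3 ^ (h + 1), 2, N ^ h] ++ (List.range (N ^ h)).flatMap fun q =>
        (List.range n).flatMap (RAM.coordCode d h (3 ^ (h + 1)) (pointScale h d)
          (RAM.letterWeight n (2 ^ h * N + 1) N) q) := by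
  simp [encodeOutput, hittingPoints, List.flatMap_map, flatMap_ofFn_encodeElem]

/-- The bound for the moduli. -/
def modulusBound (n r d : ℕ) : ℕ :=
  2 * (n * 2 ^ Nat.clog 2 d * (r * (d + 1)) ^ 8 * 2 ^ Nat.clog 2 d + 1)

theorem clog_le_log_add_one (d : ℕ) : Nat.clog 2 d ≤ Nat.log 2 d + 1 :=
  Nat.clog_le_of_le_pow (Nat.lt_pow_succ_log_self (by norm_num) d).le

theorem two_pow_clog_le {d : ℕ} (hd : 1 ≤ d) : 2 ^ Nat.clog 2 d ≤ 2 * d := by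
  refine (Nat.pow_le_pow_right (by norm_num) (clog_le_log_add_one d)).trans ?_
  rw [pow_succ']
  exact Nat.mul_le_mul_left _ (Nat.pow_log_le_self 2 (by omega))

theorem clog_le_two_mul_log_succ {d : ℕ} (hd : 1 ≤ d) :
    Nat.clog 2 d ≤ 2 * Nat.log 2 (d + 1) := by
  have h1 : 1 ≤ Nat.log 2 (d + 1) := Nat.log_pos (by norm_num) (by omega)
  refine Nat.clog_le_of_le_pow ?_
  have h2 : d + 1 < 2 ^ (Nat.log 2 (d + 1) + 1) := Nat.lt_pow_succ_log_self (by norm_num) _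
  have h3 : 2 ^ (Nat.log 2 (d + 1) + 1) ≤ 2 ^ (2 * Nat.log 2 (d + 1)) :=
    Nat.pow_le_pow_right (by norm_num) (by omega)
  omega

theorem three_pow_le (h : ℕ) : 3 ^ h ≤ (2 ^ h) ^ 2 := by
  rw [← pow_mul, mul_comm, pow_mul]
  exact Nat.pow_le_pow_left (by norm_num) h

theorem index_le {n r d : ℕ} (hn : 1 ≤ n) (hr : 1 ≤ r) (hd : 1 ≤ d) :
    2 * 3 ^ Nat.clog 2 d ≤ (n * r * d + 1) ^ 5 := by
  set x := n * r * d + 1 with hx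
  have hdx : d + 1 ≤ x := Nat.succ_le_succ (Nat.le_mul_of_pos_left d (Nat.mul_pos hn hr))
  have h1 : 2 ^ Nat.clog 2 d ≤ x ^ 2 := (two_pow_clog_le hd).trans (by nlinarith)
  calc 2 * 3 ^ Nat.clog 2 d ≤ x * (x ^ 2) ^ 2 :=
        Nat.mul_le_mul (by omega) ((three_pow_le _).trans (Nat.pow_le_pow_left h1 2))
    _ = x ^ 5 := by ring

/-- With `b = n * r * (d + 1)`, the factors are at most `b`, `b ^ 2`, `b ^ 8`, `b ^ 2`; the
remaining factor 4 is at most `b ^ 2` since `b ≥ 2`. -/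
theorem modulusBound_le {n r d : ℕ} (hn : 1 ≤ n) (hr : 1 ≤ r) (hd : 1 ≤ d) :
    modulusBound n r d ≤ (n * r * (d + 1)) ^ 15 := by
  set b := n * r * (d + 1) with hb
  have hnr : 1 ≤ n * r := Nat.mul_pos hn hr
  have h1 : d + 1 ≤ b := Nat.le_mul_of_pos_left _ hnr
  have h2 : r * (d + 1) ≤ b := by
    rw [hb, mul_assoc]
    exact Nat.le_mul_of_pos_left _ hn
  have h3 : n ≤ b := by
    rw [hb, mul_assoc]
    exact Nat.le_mul_of_pos_right _ (Nat.mul_pos hr (Nat.succ_pos d))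
  have h4 : 2 ^ Nat.clog 2 d ≤ b ^ 2 := (two_pow_clog_le hd).trans (by nlinarith)
  have h5 : n * 2 ^ Nat.clog 2 d * (r * (d + 1)) ^ 8 * 2 ^ Nat.clog 2 d ≤
      b * b ^ 2 * b ^ 8 * b ^ 2 := by gcongr
  have h6 : 1 ≤ b ^ 13 := Nat.one_le_pow _ _ (by omega)
  have h7 : b * b ^ 2 * b ^ 8 * b ^ 2 = b ^ 13 := by ring
  have h8 : 2 * 2 * b ^ 13 ≤ b * b * b ^ 13 := by
    gcongr <;> omega
  calc modulusBound n r d ≤ 2 * 2 * b ^ 13 := by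
        unfold modulusBound
        omega
    _ ≤ b * b * b ^ 13 := h8
    _ = b ^ 15 := by ring

theorem card_bound {n r d : ℕ} (hn : 1 ≤ n) (hr : 1 ≤ r) (hd : 1 ≤ d) :
    modulusBound n r d ^ Nat.clog 2 d ≤ (n * r * (d + 1)) ^ (30 * Nat.log 2 (d + 1)) := by
  have hb : 1 ≤ n * r * (d + 1) := Nat.mul_pos (Nat.mul_pos hn hr) (Nat.succ_pos d)
  calc modulusBound n r d ^ Nat.clog 2 d ≤ ((n * r * (d + 1)) ^ 15) ^ Nat.clog 2 d :=
        Nat.pow_le_pow_left (modulusBound_le hn hr hd) _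
    _ = (n * r * (d + 1)) ^ (15 * Nat.clog 2 d) := by rw [← pow_mul]
    _ ≤ _ := Nat.pow_le_pow_right hb (by
        have := clog_le_two_mul_log_succ hd
        omega)

theorem add_le_two_pow {a b x y : ℕ} (ha : a ≤ 2 ^ x) (hb : b ≤ 2 ^ x) (hy : x + 1 ≤ y) :
    a + b ≤ 2 ^ y := by
  have h1 : 2 ^ (x + 1) ≤ 2 ^ y := Nat.pow_le_pow_right (by norm_num) hy
  rw [pow_succ] at h1
  omega

theorem mul_le_two_pow {a b x y z : ℕ} (ha : a ≤ 2 ^ x) (hb : b ≤ 2 ^ y) (hz : x + y ≤ z) :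
    a * b ≤ 2 ^ z :=
  (Nat.mul_le_mul ha hb).trans (by
    rw [← pow_add]
    exact Nat.pow_le_pow_right (by norm_num) hz)

theorem pow_le_two_pow {a k x z : ℕ} (ha : a ≤ 2 ^ x) (hz : x * k ≤ z) : a ^ k ≤ 2 ^ z :=
  (Nat.pow_le_pow_left ha k).trans (by
    rw [← pow_mul]
    exact Nat.pow_le_pow_right (by norm_num) hz)

theorem le_two_pow_of_le {a x z : ℕ} (ha : a ≤ 2 ^ x) (hz : x ≤ z) : a ≤ 2 ^ z :=
  ha.trans (Nat.pow_le_pow_right (by norm_num) hz)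

theorem outputsWithin_hittingPoints {n r d : ℕ} (hn : 1 ≤ n) (hr : 1 ≤ r) (hd : 1 ≤ d) :
    RAM.OutputsWithin RAM.hittingProg [n, r, d]
      (encodeOutput (2 * 3 ^ Nat.clog 2 d) (3 ^ (Nat.clog 2 d + 1)) 2
        (hittingPoints n (Nat.clog 2 d) d (modulusBound n r d)))
      (2 ^ (100 * (Nat.log 2 (n * r * d) + 1) ^ 2)) := by
  -- With `t` the bit length of `n * r * d`, single parameters are `2 ^ O(t)`, while the number of
  -- points and the weights are `2 ^ O(t ^ 2)`.
  obtain ⟨t, ht⟩ : ∃ t, t = Nat.log 2 (n * r * d) + 1 := ⟨_, rfl⟩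
  obtain ⟨h, hh⟩ : ∃ h, h = Nat.clog 2 d := ⟨_, rfl⟩
  obtain ⟨u, hu⟩ : ∃ u, u = (r * (d + 1)) ^ 8 := ⟨_, rfl⟩
  obtain ⟨N, hN⟩ : ∃ N, N = modulusBound n r d := ⟨_, rfl⟩
  obtain ⟨m, hm⟩ : ∃ m, m = 3 ^ (h + 1) := ⟨_, rfl⟩
  obtain ⟨B, hB⟩ : ∃ B, B = 2 ^ h * N + 1 := ⟨_, rfl⟩
  obtain ⟨E, hE⟩ : ∃ E, E = d * (m * m) + 1 := ⟨_, rfl⟩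
  have hN' : N = 2 * (n * 2 ^ h * u * 2 ^ h + 1) := by rw [hN, modulusBound, hu, hh]
  have hm' : m = 3 * 3 ^ h := by rw [hm, pow_succ']
  rw [← hN, ← hh, ← ht, encodeOutput_hittingPoints, pointScale, ← hm, ← hE, ← hB]
  have hlt : n * r * d < 2 ^ t := ht ▸ Nat.lt_pow_succ_log_self (by norm_num) _
  have ht1 : 1 ≤ t := by omega
  have hnr : 1 ≤ n * r := Nat.mul_pos hn hr
  have hd' : d + 1 ≤ 2 ^ t := (Nat.succ_le_succ (Nat.le_mul_of_pos_left d hnr)).trans hlt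
  have hn' : n + 1 ≤ 2 ^ t := by
    refine (Nat.succ_le_succ ?_).trans hlt
    rw [mul_assoc]
    exact Nat.le_mul_of_pos_right _ (Nat.mul_pos hr hd)
  have hr' : r ≤ 2 ^ t := by
    refine le_trans ?_ hlt.le
    rw [mul_comm n r, mul_assoc]
    exact Nat.le_mul_of_pos_right _ (Nat.mul_pos hn hd)
  have hht : h ≤ t := hh ▸ Nat.clog_le_of_le_pow (by omega)
  have hY : 2 ^ h ≤ 2 ^ t := Nat.pow_le_pow_right (by norm_num) hht
  have hL : 3 ^ h ≤ 2 ^ (2 * t) :=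
    (three_pow_le h).trans (pow_le_two_pow hY (by omega))
  have hone : ∀ x, 1 ≤ 2 ^ x := fun x => Nat.one_le_two_pow
  have hu2 : u ≤ 2 ^ (16 * t) := by
    rw [hu]
    exact pow_le_two_pow (mul_le_two_pow hr' hd' le_rfl) (by omega)
  have hN2 : N ≤ 2 ^ (21 * t) := by
    rw [hN']
    exact mul_le_two_pow (x := 1) le_rfl (add_le_two_pow (x := 19 * t)
      (mul_le_two_pow (mul_le_two_pow (mul_le_two_pow (Nat.le_of_succ_le hn') hY le_rfl) hu2 le_rfl)
        hY (by omega)) (hone _) le_rfl) (by omega)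
  have hm2 : m ≤ 2 ^ (4 * t) := by
    rw [hm']
    exact mul_le_two_pow (x := 2) (by norm_num) hL (by omega)
  have hB2 : B ≤ 2 ^ (23 * t) := by
    rw [hB]
    exact add_le_two_pow (mul_le_two_pow hY hN2 le_rfl) (hone _) (by omega)
  have hE2 : E ≤ 2 ^ (10 * t) := by
    rw [hE]
    exact add_le_two_pow (mul_le_two_pow (Nat.le_of_succ_le hd')
      (mul_le_two_pow hm2 hm2 le_rfl) le_rfl) (hone _) (by omega)
  have hQ2 : N ^ h ≤ 2 ^ (21 * t ^ 2) := pow_le_two_pow hN2 (by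
    rw [pow_two, ← mul_assoc]
    exact Nat.mul_le_mul_left _ hht)
  have hW2 : (n + 1) * B ^ h ≤ 2 ^ (t + 23 * t ^ 2) :=
    mul_le_two_pow hn' (pow_le_two_pow hB2 (z := 23 * t ^ 2) (by
      rw [pow_two, ← mul_assoc]
      exact Nat.mul_le_mul_left _ hht)) le_rfl
  have htt : t ≤ 2 ^ t := Nat.lt_two_pow_self.le
  -- The bound is `V = 2 ^ A`: `A` must exceed `t * d` because of `(n + 1) ^ d`, and a multiple of
  -- `t ^ 2` because of the points and weights. The bit length `A + 1` is still `2 ^ O(t)`.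
  obtain ⟨A, hA⟩ : ∃ A, A = 50 * t * 2 ^ t := ⟨_, rfl⟩
  have hA1 : 50 * t ^ 2 ≤ A := by
    rw [hA, pow_two, ← mul_assoc]
    exact Nat.mul_le_mul_left _ htt
  have hA3 : t ≤ t ^ 2 := Nat.le_self_pow (by norm_num) t
  have hdA : t * d ≤ A := by
    rw [hA]
    exact Nat.mul_le_mul (by omega) (Nat.le_of_succ_le hd')
  have hdA' : d ≤ A := (Nat.le_mul_of_pos_left d ht1).trans hdA
  have hout := RAM.outputsWithin_hittingProg (V := 2 ^ A) hh hu hN' hm' hB hE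
    (le_two_pow_of_le (Nat.le_of_succ_le hn') (by omega)) (le_two_pow_of_le hr' (by omega))
    (le_two_pow_of_le (Nat.le_of_succ_le hd') (by omega))
    (hht.trans (le_two_pow_of_le htt (by omega))) (le_two_pow_of_le hu2 (by omega))
    (lt_of_le_of_lt hN2 (Nat.pow_lt_pow_right (by norm_num) (by omega)))
    (le_two_pow_of_le hm2 (by omega)) (le_two_pow_of_le hB2 (by omega))
    (le_two_pow_of_le hE2 (by omega)) (le_two_pow_of_le hQ2 (by omega))
    (pow_le_two_pow hn' hdA) (Nat.pow_le_pow_right (by norm_num) hdA')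
    (le_two_pow_of_le hW2 (by omega))
  obtain ⟨c, s, ex, ho, hc⟩ := hout
  refine ⟨c, s, ex, ho, hc.trans ?_⟩
  have hlit : ∀ k, k ≤ 2 ^ 11 → k ≤ 2 ^ (11 * t) := fun k hk => le_two_pow_of_le hk (by omega)
  have hh2 : h ≤ 2 ^ t := hht.trans htt
  have hV : (2 ^ A).size + 1 ≤ 2 ^ (10 * t) := by
    rw [Nat.size_pow, hA]
    exact add_le_two_pow (x := 9 * t) (add_le_two_pow (x := 8 * t)
      (mul_le_two_pow (x := 7 * t) (mul_le_two_pow (x := 6) (by norm_num) htt (by omega)) le_rfl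
        (by omega)) (hone _) (by omega)) (hone _) (by omega)
  -- The two exponents bound the number of steps and the bit length of `V`; as `t ≤ t ^ 2`, they add
  -- up to less than `100 * t ^ 2`.
  refine mul_le_two_pow (x := 62 * t ^ 2 + 20 * t) (y := 10 * t) ?_ hV (by omega)
  refine add_le_two_pow (x := 60 * t ^ 2 + 20 * t) (add_le_two_pow (x := 20 * t)
    (mul_le_two_pow (hlit 602 (by norm_num)) hh2 (by omega))
    (le_two_pow_of_le (hlit 2003 (by norm_num)) (by omega)) (by omega)) ?_ (by omega)
  have h1 : 401 * h + 801 * m + 803 ≤ 2 ^ (17 * t) :=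
    add_le_two_pow (x := 16 * t) (add_le_two_pow (x := 15 * t)
      (mul_le_two_pow (hlit 401 (by norm_num)) hh2 (by omega))
      (mul_le_two_pow (hlit 801 (by norm_num)) hm2 (by omega)) (by omega))
      (le_two_pow_of_le (hlit 803 (by norm_num)) (by omega)) (by omega)
  have h2 : d * (401 * h + 801 * m + 803) + 602 ≤ 2 ^ (19 * t) :=
    add_le_two_pow (x := 18 * t) (mul_le_two_pow (Nat.le_of_succ_le hd') h1 (by omega))
      (le_two_pow_of_le (hlit 602 (by norm_num)) (by omega)) (by omega)
  have h3 : n * (d * (401 * h + 801 * m + 803) + 602) + 402 ≤ 2 ^ (21 * t) :=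
    add_le_two_pow (x := 20 * t) (mul_le_two_pow (Nat.le_of_succ_le hn') h2 (by omega))
      (le_two_pow_of_le (hlit 402 (by norm_num)) (by omega)) (by omega)
  exact mul_le_two_pow hQ2 h3 (by omega)

/-! ### The hitting set in the algebra and the final assembly. -/

open Classical in
/-- The hitting set in the division algebra. -/
def hittingSet (n h d N : ℕ) : Finset (Fin n → CyclicD (sigma h) (2 * 3 ^ h)) :=
  (Finset.range (N ^ h)).image fun q =>
    pointValue (sigma h) (2 * 3 ^ h) (omega h) (pointTerms n h d N q)

theorem mem_hittingSet {n h d N : ℕ} {q : Fin n → CyclicD (sigma h) (2 * 3 ^ h)} :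
    q ∈ hittingSet n h d N ↔
      ∃ p ∈ hittingPoints n h d N, pointValue (sigma h) (2 * 3 ^ h) (omega h) p = q := by
  simp [hittingSet, hittingPoints]

open Classical in
theorem card_hittingSet_le (n h d N : ℕ) : (hittingSet n h d N).card ≤ N ^ h :=
  Finset.card_image_le.trans (Finset.card_range _).le

theorem isHittingSet_hittingSet (n r d : ℕ) :
    IsHittingSet (abpClass n r d) (hittingSet n (Nat.clog 2 d) d (modulusBound n r d)) := by
  intro f hf hf0
  obtain ⟨q, hq, hne⟩ := exists_lift_ne_zero (Nat.le_pow_clog (by norm_num) d)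
    (le_refl (modulusBound n r d)) hf hf0
  exact ⟨_, mem_hittingSet.2 ⟨_, List.mem_map_of_mem (List.mem_range.2 hq), rfl⟩, hne⟩

theorem mainTheorem3 :
    ∃ (P : RAM.Prog) (C : ℕ), ∀ n r d : ℕ, 1 ≤ n → 1 ≤ r → 1 ≤ d →
      ∃ (ℓ m g : ℕ) (ω : RatZOmega m) (σ : RatZOmega m ≃ₐ[RatZ] RatZOmega m)
        (pts : List (Fin n → List DTerm)) (H : Finset (Fin n → CyclicD σ ℓ)),
        -- the algebra `D = (K/F, σ, z)`, `F = ℚ(z)`, `K = F(ω)`, and its index `ℓ`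
        IsPrimitiveRoot ω m ∧ σ ω = ω ^ g ∧
        IsCyclicDivisionAlgebra σ ℓ (RatFunc.X : RatZ) ∧
        d < ℓ ∧ ℓ ≤ (n * r * d + 1) ^ C ∧
        -- the set `H` in `D ^ n` and its size
        (∀ q, q ∈ H ↔ ∃ p ∈ pts, pointValue σ ℓ ω p = q) ∧
        H.card ≤ (n * r * (d + 1)) ^ (C * Nat.log 2 (d + 1)) ∧
        -- it hits, nonzero values are invertible, and so it hits strongly
        IsHittingSet (abpClass n r d) H ∧
        (∀ f ∈ abpClass n r d, ∀ q ∈ H,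
          FreeAlgebra.lift ℚ q f ≠ 0 → IsUnit (FreeAlgebra.lift ℚ q f)) ∧
        IsStrongHittingSet (abpClass n r d) H ∧
        -- the one program `P` writes down the algebra and the points in quasipolynomial time
        RAM.OutputsWithin P [n, r, d] (encodeOutput ℓ m g pts)
          (2 ^ (C * (Nat.log 2 (n * r * d) + 1) ^ C)) := by
  -- The constant covers the exponent 5 of `index_le`, the 30 of `card_bound`, and the factor 100
  -- and exponent 2 of the running time.
  refine ⟨RAM.hittingProg, 100, fun n r d hn hr hd => ?_⟩
  have hD := isCyclicDivisionAlgebra_sigma (Nat.clog 2 d)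
  refine ⟨2 * 3 ^ Nat.clog 2 d, 3 ^ (Nat.clog 2 d + 1), 2, omega (Nat.clog 2 d),
    sigma (Nat.clog 2 d), hittingPoints n (Nat.clog 2 d) d (modulusBound n r d),
    hittingSet n (Nat.clog 2 d) d (modulusBound n r d), isPrimitiveRoot_omega _, sigma_omega _, hD,
    le_two_mul_three_pow (Nat.le_pow_clog (by norm_num) d),
    (index_le hn hr hd).trans (Nat.pow_le_pow_right (Nat.succ_pos _) (by norm_num)),
    fun q => mem_hittingSet, ?_, isHittingSet_hittingSet n r d,
    fun f _ q _ hne => hD.isUnit_of_ne_zero _ hne, fun f hf hf0 => ?_, ?_⟩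
  · refine (card_hittingSet_le _ _ _ _).trans ((card_bound hn hr hd).trans ?_)
    exact Nat.pow_le_pow_right (Nat.mul_pos (Nat.mul_pos hn hr) (Nat.succ_pos d))
      (Nat.mul_le_mul_right _ (by norm_num))
  · obtain ⟨q, hq, hne⟩ := isHittingSet_hittingSet n r d f hf hf0
    exact ⟨q, hq, hD.isUnit_of_ne_zero _ hne⟩
  · obtain ⟨c, s, ex, ho, hc⟩ := outputsWithin_hittingPoints hn hr hd
    exact ⟨c, s, ex, ho, hc.trans (Nat.pow_le_pow_right (by norm_num)
      (Nat.mul_le_mul_left _ (Nat.pow_le_pow_right (Nat.succ_pos _) (by norm_num))))⟩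

end
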